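/- Let $G=(A\cup B,E)$ be a finite simple bipartite graph with edges $e=(v,u)$, $v\in A$, $u\in B$, weights $w_e\in\mathbb R$ and probabilities $p_e\in(0,1]$. Each edge is realized independently with probability $p_e$, giving the random subgraph $G_p$. Let $\mathrm{OPT}$ be the expected weight of a maximum-weight matching of $G_p$, and assume $\mathrm{OPT}>0$. For a vertex $z$, let $E_z$ be the set of edges incident to $z$. Let $\mathbf x$ be an optimal solution of the linear program $$\max \sum_{e\in E}x_ew_e\quad\text{s.t.}\quad \sum_{e\in F}x_e\le 1-\prod_{e\in F}(1-p_e)\ \ (z\in A\cup B,\ F\subseteq E_z),\qquad x_e\ge 0\ \ (e\in E),$$ and let $\mathrm{OPT}_{LP}=\sum_{e\in E} x_ew_e$. For $x\in[0,1)$ let $g(x,1)=\frac{(\mathrm e-1)(1-x)x}{\mathrm e-\mathrm e^{x}}$, and let $g(1,1)=1-1/\mathrm e$ ($\mathrm e$ is Euler's number); put $\tilde x_e=g(x_e,1)$. For $S\subseteq E$, let $\mathrm{Alg1}(S)$ (with $\sigma=1$) be the following randomized procedure. For each $u\in B$ add a new vertex to the side of $A$, joined only to $u$ by a dummy edge $d$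 with $w_d=0$, $p_d=1$, $x_d=1-\sum_{e\in S,\,e\ni u}x_e$, $\tilde x_d=g(x_d,1)$. Process the vertices $v$ on the side of $A$ (new ones included) in uniformly random order. For each $v$: 1. Draw a permutation $\pi_v$ of a subset of the edges at $v$ from a distribution $\mathcal D_v$ that is proportional to $\mathbf x$, that is, for each edge $e$ at $v$ the probability that $e$ is the first realized edge in the order $\pi_v$ is exactly $x_e$. 2. Build $\pi_v'$, initially empty, by going through $\pi_v$: at edge $e$, with probability $p_e(1-\tilde x_e/x_e)$ stop building, with probability $\tilde x_e/x_e$ append $e$ to $\pi'_v$, and otherwise skip $e$ (with $\tilde x_e/x_e$ read as $0$ if $x_e=0$). 3. Examine the edges in the order $\pi_v'$ until one is realized. Examining $e$ means querying it if both its end-points are unmatched; otherwise an independent coin declares it realized with probability $p_e$. If $e=(v,u)$ is the realized one, $v$ proposes to $u$; if $u$ is unmatched, $e$ joins the matching. The output is the matching obtained (dummy edges included). Then, for every $S\subseteq E$, proportional distributions as in step 1 exist. For any choice of them (depending on $S$ and $v$), let $\mathcal M_1=\mathrm{Alg1}(E)$, let $E_2$ be the set of edges of $E$ that were not examined in this run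 and share no end-point with an edge of $\mathcal M_1$, let $\mathcal M_2=\mathrm{Alg1}(E_2)$ (with the same $\mathbf x$), and $\mathcal M=\mathcal M_1\cup\mathcal M_2$. The edges of $E$ in $\mathcal M$ form a matching consisting of realized edges, and for every real $\tau$, with $H=\{e\in E:\tilde x_e/p_e\ge\tau\}$ and $\omega_H=\sum_{e\in H}w_ex_e$, $$\frac{\mathbb E[w(\mathcal M)]}{\mathrm{OPT}}\ \ge\ \Big(1-\frac1{\mathrm e}\Big)+\frac{(1-1/\mathrm e)^3}{4}\Big(1-\frac{\omega_H}{\mathrm{OPT}_{LP}}\Big)(1-\tau).$$ The expectation is over the realization of the edges and the randomness of the algorithm. -/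

import Mathlib

open scoped ENNReal

noncomputable section

namespace StochMatching

/-! ### The stochastic matching problem

A bipartite graph with parts `V` and `B` is given by its edge set, a `Finset (V × B)`.
Vectors indexed by the edges are functions `V × B → ℝ`; only their values on edges matter. -/

section Problem

variable {V B : Type*} [DecidableEq V] [DecidableEq B]

/-- No two distinct edges of `M` share an end-point. -/
def IsMatching (M : Finset (V × B)) : Prop :=
  ∀ e ∈ M, ∀ f ∈ M, e ≠ f → e.1 ≠ f.1 ∧ e.2 ≠ f.2

open Classical in
/-- The maximum weight of a matching contained in `R`. -/
def maxWeight (w : V × B → ℝ) (R : Finset (V × B)) : ℝ :=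
  (R.powerset.filter IsMatching).sup'
    ⟨∅, Finset.mem_filter.2 ⟨Finset.empty_mem_powerset R, fun _ h => absurd h (by simp)⟩⟩
    (fun M => ∑ e ∈ M, w e)

/-- The probability that exactly the edges in `R ⊆ E` are realized, when each edge `e ∈ E` is
realized independently with probability `p e`. -/
def realizationProb (E : Finset (V × B)) (p : V × B → ℝ) (R : Finset (V × B)) : ℝ :=
  (∏ e ∈ R, p e) * ∏ e ∈ E \ R, (1 - p e)

/-- The expectation of `φ R`, where `R` is the random set of realized edges. -/
def expectRealization (E : Finset (V × B)) (p : V × B → ℝ) (φ : Finset (V × B) → ℝ) : ℝ :=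
  ∑ R ∈ E.powerset, realizationProb E p R * φ R

/-- The expected weight of a maximum weight matching of the realized subgraph. -/
def opt (E : Finset (V × B)) (w p : V × B → ℝ) : ℝ :=
  expectRealization E p (maxWeight w)

/-- The feasible solutions of the linear program: `x ≥ 0` and, for every vertex and every set `F`
of edges incident to it, `∑ e ∈ F, x e` is at most the probability `1 - ∏ e ∈ F, (1 - p e)` that
some edge of `F` is realized. -/
structure IsLPFeasible (E : Finset (V × B)) (p x : V × B → ℝ) : Prop where
  nonneg : ∀ e ∈ E, 0 ≤ x e
  left : ∀ v : V, ∀ F ⊆ E.filter (fun e => e.1 = v), ∑ e ∈ F, x e ≤ 1 - ∏ e ∈ F, (1 - p e)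
  right : ∀ u : B, ∀ F ⊆ E.filter (fun e => e.2 = u), ∑ e ∈ F, x e ≤ 1 - ∏ e ∈ F, (1 - p e)

/-- The objective value of the linear program, `x · w`. -/
def lpValue (E : Finset (V × B)) (w x : V × B → ℝ) : ℝ := ∑ e ∈ E, x e * w e

/-- `x` is an optimal solution of the linear program. -/
def IsLPOptimal (E : Finset (V × B)) (w p x : V × B → ℝ) : Prop :=
  IsLPFeasible E p x ∧ ∀ y : V × B → ℝ, IsLPFeasible E p y → lpValue E w y ≤ lpValue E w x

end Problem

/-! ### Random primitives -/

/-- A coin that shows `true` with probability `q`, for `q ∈ [0, 1]`. -/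
def coin (q : ℝ) : PMF Bool :=
  PMF.ofFintype (fun b => cond b (min (ENNReal.ofReal q) 1) (1 - min (ENNReal.ofReal q) 1)) (by
    rw [Fintype.sum_bool]
    exact add_tsub_cancel_of_le (min_le_right _ _))

/-- What the permutation-drawing procedure does with the current edge. -/
inductive Step where
  | halt
  | add
  | skip

/-- The outcome of drawing `c` uniformly from `[0, 1]`, for `s, t ≥ 0`: it is `halt` if `c ≤ s`,
`add` if `s < c ≤ s + t`, and `skip` otherwise. -/
def stepLaw (s t : ℝ) : PMF Step :=
  PMF.ofFinset
    (fun o => match o with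
      | .halt => min (ENNReal.ofReal s) 1
      | .add => min (ENNReal.ofReal t) (1 - min (ENNReal.ofReal s) 1)
      | .skip => (1 - min (ENNReal.ofReal s) 1)
          - min (ENNReal.ofReal t) (1 - min (ENNReal.ofReal s) 1))
    (⟨{.halt, .add, .skip}, by simp⟩ : Finset Step)
    (by
      simp only [Finset.sum_mk, Multiset.insert_eq_cons, Multiset.map_cons,
        Multiset.map_singleton, Multiset.sum_cons, Multiset.sum_singleton]
      rw [add_tsub_cancel_of_le (min_le_right _ _), add_tsub_cancel_of_le (min_le_right _ _)])
    (fun o ho => absurd (by cases o <;> simp) ho)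

/-! ### The base algorithm on a graph whose dummy edges are already present -/

section Base

variable {V B : Type*} [DecidableEq V] [DecidableEq B]

/-- Query the edges `(v, u)`, for `u` in the given order, until one of them is realized, and output
that edge (represented by `u`); output `none` if there is none. -/
def firstRealized (p : V × B → ℝ) (v : V) : List B → PMF (Option B)
  | [] => PMF.pure none
  | u :: l => (coin (p (v, u))).bind fun b =>
      if b then PMF.pure (some u) else firstRealized p v l

/-- `d` is a distribution over permutations of subsets of the edges at `v` (an edge `(v, u)` being
represented by `u`) that is proportional to `x`: for every edge `e` at `v`, the probability that
`e` is the first realized edge in the random order is exactly `x e`. -/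
def IsProportional (E : Finset (V × B)) (p x : V × B → ℝ) (v : V) (d : PMF (List B)) : Prop :=
  (∀ l ∈ d.support, l.Nodup ∧ ∀ u ∈ l, (v, u) ∈ E) ∧
  ∀ u, (v, u) ∈ E → d.bind (firstRealized p v) (some u) = ENNReal.ofReal (x (v, u))

/-- The transformation function, with its value at `x = σ` being the limit. -/
def g (x σ : ℝ) : ℝ :=
  if x = σ then 1 - Real.exp (-σ)
  else (Real.exp σ - 1) * (σ - x) * x / (σ * (Real.exp σ - Real.exp x))

/-- Go through an order of the edges at `v`; at the edge `e` end the loop with probability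
`p e * (1 - x' e / x e)` and add `e` to the new order with probability `x' e / x e`. -/
def thin (p x x' : V × B → ℝ) (v : V) : List B → PMF (List B)
  | [] => PMF.pure []
  | u :: l =>
      (stepLaw (p (v, u) * (1 - x' (v, u) / x (v, u))) (x' (v, u) / x (v, u))).bind fun o =>
        match o with
        | .halt => PMF.pure []
        | .add => (thin p x x' v l).map (fun l' => u :: l')
        | .skip => thin p x x' v l

/-- The edges matched and the edges examined so far. -/
structure RunState (V B : Type*) where
  matching : Finset (V × B)
  examined : Finset (V × B)

/-- Examine the edge `(v, u)`, given the set `R` of realized edges and the current matching `M`.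
If both end-points are unmatched the edge is queried; otherwise a fresh coin is tossed. -/
def examine (p : V × B → ℝ) (R M : Finset (V × B)) (v : V) (u : B) : PMF Bool :=
  if ∀ f ∈ M, f.1 ≠ v ∧ f.2 ≠ u then PMF.pure (decide ((v, u) ∈ R)) else coin (p (v, u))

/-- The vertex `v` examines its edges in the given order until one is realized. It then proposes
along this edge, and the proposal is accepted if the other end-point is unmatched. -/
def propose (p : V × B → ℝ) (R : Finset (V × B)) (v : V) :
    List B → RunState V B → PMF (RunState V B)
  | [], s => PMF.pure s
  | u :: l, s => (examine p R s.matching v u).bind fun b =>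
      if b then
        PMF.pure
          { matching := if ∀ f ∈ s.matching, f.2 ≠ u then insert (v, u) s.matching else s.matching
            examined := insert (v, u) s.examined }
      else
        propose p R v l { matching := s.matching, examined := insert (v, u) s.examined }

/-- The turn of the vertex `v`: draw an order from `D v`, thin it out, and propose. -/
def turn (p x x' : V × B → ℝ) (D : V → PMF (List B)) (R : Finset (V × B)) (v : V)
    (s : RunState V B) : PMF (RunState V B) :=
  ((D v).bind (thin p x x' v)).bind fun l => propose p R v l s

/-- The turns of several vertices, one after the other. -/
def turns (p x x' : V × B → ℝ) (D : V → PMF (List B)) (R : Finset (V × B)) :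
    List V → RunState V B → PMF (RunState V B)
  | [], s => PMF.pure s
  | v :: vs, s => (turn p x x' D R v s).bind (turns p x x' D R vs)

/-- A uniformly random order of the elements of a finite type. -/
def randomOrder (V : Type*) [DecidableEq V] [Fintype V] : PMF (List V) :=
  haveI : Nonempty (Fin (Fintype.card V) ≃ V) := ⟨(Fintype.equivFin V).symm⟩
  (PMF.uniformOfFintype (Fin (Fintype.card V) ≃ V)).map
    fun π : Fin (Fintype.card V) ≃ V => List.ofFn (fun i => π i)

end Base

/-! ### Dummy edges

The dummy vertex attached to `u : B` is `Sum.inr u`, and the dummy edge at `u` is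
`(Sum.inr u, u)`. Dummy edges have weight `0` and are realized with probability `1`. -/

section Dummy

variable {A B : Type*} [DecidableEq A] [DecidableEq B]

/-- The edges in `S` together with all dummy edges. -/
def addDummies [Fintype B] (S : Finset (A × B)) : Finset ((A ⊕ B) × B) :=
  S.image (fun e => (Sum.inl e.1, e.2)) ∪ Finset.univ.image (fun u : B => (Sum.inr u, u))

/-- Realization probabilities, extended to dummy edges. -/
def extProb (p : A × B → ℝ) : (A ⊕ B) × B → ℝ
  | (Sum.inl v, u) => p (v, u)
  | (Sum.inr _, _) => 1

/-- Weights, extended to dummy edges. -/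
def extWeight (w : A × B → ℝ) : (A ⊕ B) × B → ℝ
  | (Sum.inl v, u) => w (v, u)
  | (Sum.inr _, _) => 0

/-- The fractional solution on the edges in `S`, extended to dummy edges in such a way that the
total at every `u : B` is `σ`. -/
def extSol (S : Finset (A × B)) (x : A × B → ℝ) (σ : ℝ) : (A ⊕ B) × B → ℝ
  | (Sum.inl v, u) => x (v, u)
  | (Sum.inr _, u) => σ - ∑ e ∈ S.filter (fun e => e.2 = u), x e

/-- The edges of the original graph in a set of edges of the extended graph. -/
def realEdges [Fintype A] [Fintype B] (M : Finset ((A ⊕ B) × B)) : Finset (A × B) :=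
  Finset.univ.filter fun e => (Sum.inl e.1, e.2) ∈ M

/-- A choice of order distributions for a run on the edge set `S`: for every vertex on the side
of `A`, dummy vertices included, one that is proportional to the extended fractional solution. -/
def IsProportionalFamily [Fintype B] (S : Finset (A × B)) (p x : A × B → ℝ) (σ : ℝ)
    (D : A ⊕ B → PMF (List B)) : Prop :=
  ∀ v : A ⊕ B, IsProportional (addDummies S) (extProb p) (extSol S x σ) v (D v)

variable [Fintype A] [Fintype B]

/-- One run of the base algorithm with parameter `σ` on the edge set `S`, when `R` is the set of
realized edges: the law of the matched edges (dummy edges included) and the examined edges. The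
extended solution is transformed by `g`, and the vertices take their turns in random order. The
edge set `S` enters through the solution on dummy edges and through the distributions `D`, which
are supported on orders of edges in `S` and dummy edges. -/
def alg1 (S : Finset (A × B)) (p x : A × B → ℝ) (σ : ℝ) (D : A ⊕ B → PMF (List B))
    (R : Finset (A × B)) : PMF (RunState (A ⊕ B) B) :=
  (randomOrder (A ⊕ B)).bind fun vs =>
    turns (extProb p) (extSol S x σ) (fun e => g (extSol S x σ e) σ) D (addDummies R) vs
      { matching := ∅, examined := ∅ }

/-- The edges of `E` that are still available after a run: they were not examined, and they share
no end-point with a matched edge. -/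
def available (E : Finset (A × B)) (s : RunState (A ⊕ B) B) : Finset (A × B) :=
  E.filter fun e => (Sum.inl e.1, e.2) ∉ s.examined ∧
    ∀ f ∈ s.matching, f.1 ≠ Sum.inl e.1 ∧ f.2 ≠ e.2

/-- Run the base algorithm with `σ = 1` on `E`, then run it again with `σ = 1` on the edges that
are still available. The result is the law of the union of the two matchings, when `R` is the set
of realized edges. The distributions used in a run on the edge set `S` are `D S`. -/
def twoRounds (E : Finset (A × B)) (p x : A × B → ℝ)
    (D : Finset (A × B) → A ⊕ B → PMF (List B)) (R : Finset (A × B)) :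
    PMF (Finset ((A ⊕ B) × B)) :=
  (alg1 E p x 1 (D E) R).bind fun s₁ =>
    (alg1 (available E s₁) p x 1 (D (available E s₁)) R).map fun s₂ =>
      s₁.matching ∪ s₂.matching

/-- The expected weight of the output of the two runs, over the realization of the edges and the
randomness of the algorithm. -/
def twoRoundsWeight (E : Finset (A × B)) (w p x : A × B → ℝ)
    (D : Finset (A × B) → A ⊕ B → PMF (List B)) : ℝ :=
  expectRealization E p fun R =>
    ∑ M : Finset ((A ⊕ B) × B), (twoRounds E p x D R M).toReal * ∑ e ∈ M, extWeight w e

/-- The heavy edges, those with `g (x e) 1 / p e ≥ τ`. -/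
def heavy (E : Finset (A × B)) (p x : A × B → ℝ) (τ : ℝ) : Finset (A × B) :=
  E.filter fun e => τ ≤ g (x e) 1 / p e

end Dummy

end StochMatching

end

noncomputable section

namespace StochMatching

set_option linter.unusedSectionVars false

/-! ### The transformation function -/

section Transformation

open Real MeasureTheory Set

/-! Write c = 1 - 1/exp 1. The theorem is a weighted sum of the edgewise bound P(f ∈ M) ≥ c x_f +
c³/4 · (1 - g(x_f)/p_f) x_f (`twoRoundsProb_ge`). LP optimality gives x_f = 0 where w_f < 0, and
such edges are never matched. In the second term a heavy edge contributes at least 0 and a light one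
at least its share of 1 - τ. Finally OPT ≤ OPT_LP, since the edge marginals of a maximum matching
are LP-feasible.

One run. No edge is queried twice in a run, so after averaging over the realization the queries can
be replaced by fresh coins (`expect_turns`); then what a vertex examines and proposes is independent
of the current state. Thinning makes v propose to u with probability exactly g(y_v), where y denotes
the extended solution at u. With uniform arrival times in place of the random order, the proposal is
accepted with probability ∫₀¹ ∏_{a ≠ v} (1 - t g(y_a)) dt. Replacing each factor by exp(-t y_a) only
lowers the integral (`integral_exp_le_integral_prod`). The dummy edge makes the y_a sum to 1, and g
solves g(y) ∫₀¹ exp(-(1-y)t) dt = c y, so every edge is matched with probability at least c x_f.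

Survival. The edge (v, u) is still available if no other vertex proposes to u, v does not examine
the edge, and a proposal of v elsewhere is rejected. The first event has probability at least
exp(-9/8) ≥ c/2, the second 1 - g(x_f)/p_f. The third costs a factor c/2: along an edge of value y a
proposal survives thinning with probability g(y)/y and is accepted with probability at most (1 +
exp(-(1-y)))/2, and the product of the two is at most 1 - c/2. Dependence helps: a vertex makes only
one proposal, so if nobody proposes to u, another a is at least as likely to be taken
(`ex_freshTurns_available_not_free_ge`).

Second run. The probability that the first run ends in a state depends only on the edges examined in
it, and the second run reads only unexamined edges. The two are therefore independent
(`expect_alg1_alg1`), and an available edge is matched with probability at least c x_f once more.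

Proportional distributions exist because the LP constraints at a vertex describe a polymatroid on
which querying in decreasing order of weight is optimal; separation then puts x in the convex hull
of the vectors given by orders (`mem_convexHull_firstRealized`). -/

lemma nonneg_of_concaveOn_of_endpoints {f : ℝ → ℝ} (hf : ConcaveOn ℝ (Icc 0 1) f)
    (h0 : 0 ≤ f 0) (h1 : 0 ≤ f 1) {y : ℝ} (hy : y ∈ Icc (0 : ℝ) 1) : 0 ≤ f y := by
  have h := hf.2 (left_mem_Icc.2 zero_le_one) (right_mem_Icc.2 zero_le_one)
    (sub_nonneg.2 hy.2) hy.1 (by ring)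
  simp only [smul_eq_mul, mul_zero, mul_one, zero_add] at h
  have := mul_nonneg (sub_nonneg.2 hy.2) h0
  have := mul_nonneg hy.1 h1
  linarith

lemma concaveOn_Icc_of_hasDerivAt2 {f f' f'' : ℝ → ℝ} (h1 : ∀ y, HasDerivAt f (f' y) y)
    (h2 : ∀ y, HasDerivAt f' (f'' y) y) (h : ∀ y ∈ Icc (0 : ℝ) 1, f'' y ≤ 0) :
    ConcaveOn ℝ (Icc 0 1) f := by
  have e1 : deriv f = f' := funext fun y => (h1 y).deriv
  have e2 : deriv f' = f'' := funext fun y => (h2 y).deriv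
  refine concaveOn_of_deriv2_nonpos (convex_Icc 0 1)
    (fun y _ => (h1 y).continuousAt.continuousWithinAt)
    (fun y _ => (h1 y).differentiableAt.differentiableWithinAt) ?_ ?_
  · rw [e1]
    exact fun y _ => (h2 y).differentiableAt.differentiableWithinAt
  · intro y hy
    simp only [Function.iterate_succ, Function.iterate_zero, Function.comp_apply, id]
    rw [e1, e2]
    exact h y (interior_subset hy)

lemma exp_one_sub_exp_pos {y : ℝ} (hy : y < 1) : 0 < exp 1 - exp y :=
  sub_pos.2 (exp_lt_exp.2 hy)

lemma g_one : g 1 1 = 1 - 1 / exp 1 := by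
  simp [g, exp_neg]

lemma g_of_lt {y : ℝ} (hy : y < 1) :
    g y 1 = (exp 1 - 1) * (1 - y) * y / (exp 1 - exp y) := by
  simp [g, hy.ne]

@[simp]
lemma g_zero : g 0 1 = 0 := by
  simp [g_of_lt zero_lt_one]

lemma g_nonneg {y : ℝ} (hy : y ∈ Icc (0 : ℝ) 1) : 0 ≤ g y 1 := by
  have he : 1 ≤ exp 1 := one_le_exp zero_le_one
  rcases hy.2.eq_or_lt with rfl | h1
  · rw [g_one, sub_nonneg]
    exact (div_le_one (exp_pos 1)).2 he
  · rw [g_of_lt h1]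
    have := exp_one_sub_exp_pos h1
    have := hy.1
    have : 0 ≤ 1 - y := by linarith
    have : 0 ≤ exp 1 - 1 := by linarith
    positivity

/-- After clearing the denominator the difference of the two sides is concave and vanishes at 0 and
1. The constant 1/3 is what `one_sub_exp_neg_le_mul` needs: y · (y²/3)/2 is the cubic term y³/6 of 1
- exp(-y). -/
lemma g_le_sub_sq {y : ℝ} (hy : y ∈ Icc (0 : ℝ) 1) : g y 1 ≤ y - y ^ 2 / 3 := by
  have he := exp_one_lt_d9
  rcases hy.2.eq_or_lt with rfl | h1
  · rw [g_one]
    have : 1 / 3 ≤ 1 / exp 1 := one_div_le_one_div_of_le (exp_pos 1) (by linarith)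
    linarith
  · have hc : ConcaveOn ℝ (Icc 0 1)
        (fun y : ℝ => (1 - y / 3) * (exp 1 - exp y) - (exp 1 - 1) * (1 - y)) := by
      refine concaveOn_Icc_of_hasDerivAt2
        (f' := fun y => -(1 / 3) * (exp 1 - exp y) + (1 - y / 3) * (-exp y) + (exp 1 - 1))
        (f'' := fun y => exp y * (-(1 / 3) + y / 3)) ?_ ?_ ?_
      · intro y
        have h1 : HasDerivAt (fun y : ℝ => 1 - y / 3) (-(1 / 3)) y := by
          simpa using ((hasDerivAt_id y).div_const 3).const_sub 1
        have h2 : HasDerivAt (fun y : ℝ => exp 1 - exp y) (-exp y) y :=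
          (hasDerivAt_exp y).const_sub _
        have h3 : HasDerivAt (fun y : ℝ => (exp 1 - 1) * (1 - y)) (-(exp 1 - 1)) y := by
          simpa using ((hasDerivAt_id y).const_sub 1).const_mul (exp 1 - 1)
        exact ((h1.mul h2).sub h3).congr_deriv (by ring)
      · intro y
        have h1 : HasDerivAt (fun y : ℝ => 1 - y / 3) (-(1 / 3)) y := by
          simpa using ((hasDerivAt_id y).div_const 3).const_sub 1
        have h2 : HasDerivAt (fun y : ℝ => exp 1 - exp y) (-exp y) y :=
          (hasDerivAt_exp y).const_sub _
        exact (((h2.const_mul (-(1 / 3))).add (h1.mul (hasDerivAt_exp y).neg)).add_const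
          (exp 1 - 1)).congr_deriv (by simp only [Pi.neg_apply]; ring)
      · intro y hy
        have := exp_pos y
        have := hy.2
        nlinarith
    have h := nonneg_of_concaveOn_of_endpoints hc (by simp) (by simp) hy
    rw [g_of_lt h1, div_le_iff₀ (exp_one_sub_exp_pos h1)]
    have := hy.1
    nlinarith

lemma g_le_self {y : ℝ} (hy : y ∈ Icc (0 : ℝ) 1) : g y 1 ≤ y :=
  (g_le_sub_sq hy).trans (by have := sq_nonneg y; linarith)

lemma g_le_one {y : ℝ} (hy : y ∈ Icc (0 : ℝ) 1) : g y 1 ≤ 1 :=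
  (g_le_self hy).trans hy.2

lemma integral_exp_const_mul {c : ℝ} (hc : c ≠ 0) :
    ∫ t in (0 : ℝ)..1, exp (c * t) = (exp c - 1) / c := by
  rw [intervalIntegral.integral_comp_mul_left (f := exp) hc]
  simp [div_eq_inv_mul]

/-- Integrate the convexity inequality exp(yt + (1-y)s) ≤ y exp t + (1-y) exp s over the unit
square, first in t and then in s. -/
lemma exp_sub_one_mul_le {y : ℝ} (hy : y ∈ Ioo (0 : ℝ) 1) :
    (exp y - 1) * (exp (1 - y) - 1) ≤ (exp 1 - 1) * (y * (1 - y)) := by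
  have hy0 := hy.1
  have hy1 : 0 < 1 - y := by linarith [hy.2]
  have hconv : ∀ s t : ℝ, exp (y * t) * exp ((1 - y) * s) ≤ y * exp t + (1 - y) * exp s := by
    intro s t
    rw [← exp_add]
    have := convexOn_exp.2 (mem_univ t) (mem_univ s) hy0.le hy1.le (by ring)
    simpa [smul_eq_mul] using this
  have h1 : ∀ s : ℝ, (exp y - 1) / y * exp ((1 - y) * s) ≤ y * (exp 1 - 1) + (1 - y) * exp s := by
    intro s
    have := intervalIntegral.integral_mono_on (a := 0) (b := 1) (μ := volume)
      (f := fun t => exp (y * t) * exp ((1 - y) * s))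
      (g := fun t => y * exp t + (1 - y) * exp s) zero_le_one
      (Continuous.intervalIntegrable (by fun_prop) _ _)
      (Continuous.intervalIntegrable (by fun_prop) _ _) (fun t _ => hconv s t)
    rw [intervalIntegral.integral_mul_const, integral_exp_const_mul hy0.ne',
      intervalIntegral.integral_add (Continuous.intervalIntegrable (by fun_prop) _ _)
        (Continuous.intervalIntegrable (by fun_prop) _ _),
      intervalIntegral.integral_const_mul, integral_exp] at this
    simpa using this
  have h2 := intervalIntegral.integral_mono_on (a := 0) (b := 1) (μ := volume)
      (f := fun s => (exp y - 1) / y * exp ((1 - y) * s))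
      (g := fun s => y * (exp 1 - 1) + (1 - y) * exp s) zero_le_one
      (Continuous.intervalIntegrable (by fun_prop) _ _)
      (Continuous.intervalIntegrable (by fun_prop) _ _) (fun t _ => h1 t)
  rw [intervalIntegral.integral_const_mul, integral_exp_const_mul hy1.ne',
    intervalIntegral.integral_add (Continuous.intervalIntegrable (by fun_prop) _ _)
      (Continuous.intervalIntegrable (by fun_prop) _ _),
    intervalIntegral.integral_const_mul, intervalIntegral.integral_const_mul, integral_exp] at h2
  simp only [intervalIntegral.integral_const, sub_zero, smul_eq_mul, one_mul, exp_zero] at h2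
  rw [div_mul_div_comm, div_le_iff₀ (mul_pos hy0 hy1)] at h2
  linarith

lemma one_sub_exp_neg_le_g {y : ℝ} (hy : y ∈ Icc (0 : ℝ) 1) : 1 - exp (-y) ≤ g y 1 := by
  rcases hy.2.eq_or_lt with rfl | h1
  · simp [g_one, exp_neg]
  rcases hy.1.eq_or_lt with rfl | h0
  · simp
  rw [g_of_lt h1, le_div_iff₀ (exp_one_sub_exp_pos h1)]
  have h := exp_sub_one_mul_le ⟨h0, h1⟩
  have e : (1 - exp (-y)) * (exp 1 - exp y) = (exp y - 1) * (exp (1 - y) - 1) := by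
    have e1 : exp (-y) * exp y = 1 := by rw [← exp_add]; simp
    have e2 : exp (1 - y) = exp 1 * exp (-y) := by rw [← exp_add]; ring_nf
    rw [e2]
    linear_combination (1 - exp 1) * e1
  rw [e]
  linarith

/-- The identity that dictates the formula for `g`: it turns the lower bound for the acceptance
probability into the same factor for all edges. -/
lemma g_mul_integral {y : ℝ} (hy : y ∈ Icc (0 : ℝ) 1) :
    g y 1 * ∫ t in (0 : ℝ)..1, exp (-(1 - y) * t) = (1 - 1 / exp 1) * y := by
  rcases hy.2.eq_or_lt with rfl | h1
  · simp [g_one]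
  have h0 : 1 - y ≠ 0 := by linarith
  rw [integral_exp_const_mul (neg_ne_zero.2 h0), g_of_lt h1]
  have h2 := (exp_one_sub_exp_pos h1).ne'
  have e2 : exp (-(1 - y)) = exp y / exp 1 := by rw [← exp_sub]; ring_nf
  rw [e2]
  have := exp_ne_zero 1
  field_simp
  ring

/-- Controls the chance that a vertex gets matched along an edge of value y that is the first
realized one. Again a concave function vanishing at both ends; at y = 1 itself the claim is exp 1 ≤
3. -/
lemma g_mul_one_add_exp_le {y : ℝ} (hy : y ∈ Icc (0 : ℝ) 1) :
    g y 1 * (1 + exp (-(1 - y))) ≤ (1 + 1 / exp 1) * y := by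
  rcases hy.2.eq_or_lt with rfl | h1
  · have : 0 < 1 / exp 1 := by positivity
    have he : 1 / exp 1 ≤ 1 / 2 :=
      one_div_le_one_div_of_le (by norm_num) (by linarith [exp_one_gt_d9])
    simp only [g_one, sub_self, neg_zero, exp_zero]
    linarith [exp_one_gt_d9, one_div_le_one_div_of_le (a := 2.7) (by norm_num)
      (by linarith [exp_one_gt_d9] : (2.7 : ℝ) ≤ exp 1), one_div_le_one_div_of_le
        (exp_pos 1) (by linarith [exp_one_lt_d9] : exp 1 ≤ 3)]
  have he := exp_one_lt_d9
  have hc : ConcaveOn ℝ (Icc 0 1) (fun y : ℝ =>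
      (exp 1 + 1) * (exp 1 - exp y) - (exp 1 - 1) * (1 - y) * (exp 1 + exp y)) := by
    refine concaveOn_Icc_of_hasDerivAt2
      (f' := fun y => exp 1 * (exp 1 - 1) - exp y * (2 + (exp 1 - 1) * (1 - y)))
      (f'' := fun y => -(exp y * (2 - (exp 1 - 1) * y))) ?_ ?_ ?_
    · intro y
      have h2 : HasDerivAt (fun y : ℝ => (exp 1 + 1) * (exp 1 - exp y))
          ((exp 1 + 1) * (-exp y)) y := ((hasDerivAt_exp y).const_sub _).const_mul _
      have h3 : HasDerivAt (fun y : ℝ => (exp 1 - 1) * (1 - y)) (-(exp 1 - 1)) y := by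
        simpa using ((hasDerivAt_id y).const_sub 1).const_mul (exp 1 - 1)
      exact (h2.sub (h3.mul ((hasDerivAt_exp y).const_add (exp 1)))).congr_deriv (by ring)
    · intro y
      have h3 : HasDerivAt (fun y : ℝ => 2 + (exp 1 - 1) * (1 - y)) (-(exp 1 - 1)) y := by
        simpa using (((hasDerivAt_id y).const_sub 1).const_mul (exp 1 - 1)).const_add 2
      exact (((hasDerivAt_exp y).mul h3).const_sub (exp 1 * (exp 1 - 1))).congr_deriv (by ring)
    · intro y hy
      have h1 : (exp 1 - 1) * y ≤ 2 := by nlinarith [hy.1, hy.2]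
      have := exp_pos y
      nlinarith
  have h := nonneg_of_concaveOn_of_endpoints hc (by simp; ring_nf; rfl) (by simp) hy
  have e2 : exp (-(1 - y)) = exp y / exp 1 := by rw [← exp_sub]; ring_nf
  rw [g_of_lt h1, e2, div_mul_eq_mul_div, div_le_iff₀ (exp_one_sub_exp_pos h1)]
  have h3 : 0 < exp 1 := exp_pos 1
  have e3 : (1 + exp y / exp 1) = (exp 1 + exp y) / exp 1 := by field_simp
  have e4 : (1 + 1 / exp 1) = (exp 1 + 1) / exp 1 := by field_simp
  rw [e3, e4, ← mul_div_assoc, div_mul_eq_mul_div, div_mul_eq_mul_div,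
    div_le_div_iff_of_pos_right h3]
  have := hy.1
  nlinarith

/-- The rate 9/8 is large enough for this converse of `one_sub_exp_neg_le_g` and small enough that
exp(-9/8) ≥ (1 - 1/exp 1)/2. By `g_le_sub_sq` it suffices to compare with a quadratic. -/
lemma exp_neg_le_one_sub_g {y : ℝ} (hy : y ∈ Icc (0 : ℝ) 1) :
    exp (-(9 / 8 * y)) ≤ 1 - g y 1 := by
  have h := g_le_sub_sq hy
  have h0 := hy.1
  have h1 := hy.2
  suffices exp (-(9 / 8 * y)) ≤ 1 - y + y ^ 2 / 3 by linarith
  have hz : 0 ≤ 9 / 8 * y := by positivity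
  have ht := sum_le_exp_of_nonneg hz 5
  simp only [Finset.sum_range_succ, Finset.sum_range_zero, Nat.factorial] at ht
  push_cast at ht
  rw [exp_neg, inv_le_comm₀ (exp_pos _) (by nlinarith)]
  refine le_trans ?_ ht
  rw [inv_le_iff_one_le_mul₀ (by nlinarith)]
  -- Tangent lines of the powers at y = 0.85, near the minimum of the polynomial below.
  have b3 : 2.1675 * y - 1.22825 ≤ y ^ 3 := by
    nlinarith [mul_nonneg (by linarith : 0 ≤ y + 1.7) (sq_nonneg (y - 0.85))]
  have b4 : 2.4565 * y - 1.56602 ≤ y ^ 4 := by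
    nlinarith [mul_nonneg (by nlinarith : 0 ≤ y ^ 2 + 1.7 * y + 2.1675) (sq_nonneg (y - 0.85))]
  have b5 : 2.61003 * y - 1.77483 ≤ y ^ 5 := by
    nlinarith [mul_nonneg (by positivity : 0 ≤ y ^ 3 + 1.7 * y ^ 2 + 2.1675 * y + 2.4565)
      (sq_nonneg (y - 0.85))]
  -- The coefficients of (1 - y + y²/3) T(y) - 1, rounded down, where T is the Taylor polynomial of
  -- degree 4 of exp(9y/8).
  have e : 0 ≤ y * (0.125 - 0.159 * y - 0.0206 * y ^ 2 + 0.0402 * y ^ 3 + 0.0123 * y ^ 4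
      + 0.0222 * y ^ 5) := by
    refine mul_nonneg h0 ?_
    nlinarith
  nlinarith [pow_nonneg h0 2, pow_nonneg h0 3, pow_nonneg h0 4, pow_nonneg h0 5, pow_nonneg h0 6]

lemma exp_neg_nine_eighths_ge : (1 - 1 / exp 1) / 2 ≤ exp (-(9 / 8 : ℝ)) := by
  have h1 : exp (9 / 8 : ℝ) = exp 1 * exp (1 / 8) := by rw [← exp_add]; norm_num
  have h2 : exp (1 / 8 : ℝ) ≤ 8 / 7 := by
    have := add_one_le_exp (-(1 / 8) : ℝ)
    rw [exp_neg] at this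
    rw [← inv_inv (exp (1 / 8)), inv_le_comm₀ (by positivity) (by norm_num)]
    linarith
  rw [exp_neg, h1]
  have he := exp_one_lt_d9
  have he0 := exp_pos 1
  have h3 : exp 1 * exp (1 / 8) ≤ exp 1 * (8 / 7) := by gcongr
  refine le_trans ?_ (inv_anti₀ (by positivity) h3)
  rw [div_le_iff₀ (by norm_num), one_sub_div he0.ne', mul_inv, div_le_iff₀ he0]
  field_simp
  linarith

end Transformation

/-! ### Acceptance probabilities under independent uniform arrival times -/

section Arrival

open Real MeasureTheory Set

lemma one_sub_exp_neg_le_mul {y : ℝ} (hy : y ∈ Icc (0 : ℝ) 1) :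
    1 - exp (-y) ≤ y * (1 - g y 1 / 2) := by
  have h0 := hy.1
  have h1 := hy.2
  have hb := exp_bound' h0 h1 (n := 4) (by norm_num)
  simp only [Finset.sum_range_succ, Finset.sum_range_zero, Nat.factorial] at hb
  push_cast at hb
  have hpos : 0 < 1 - y + y ^ 2 / 2 - y ^ 3 / 6 := by nlinarith [pow_nonneg h0 3, sq_nonneg (y - 1)]
  have hexp : 1 - y + y ^ 2 / 2 - y ^ 3 / 6 ≤ exp (-y) := by
    rw [exp_neg, le_inv_comm₀ hpos (exp_pos y)]
    refine hb.trans ?_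
    rw [le_inv_comm₀ (by positivity) hpos, ← one_div, le_div_iff₀ (by positivity)]
    nlinarith [pow_nonneg h0 4, pow_nonneg h0 5, pow_nonneg h0 6, pow_nonneg h0 7]
  have := mul_le_mul_of_nonneg_left (g_le_sub_sq hy) h0
  nlinarith

/-- The linear factor 1 - t g(y) need not dominate exp(-yt) for every t, but it does on average,
which is enough against a decreasing weight. -/
lemma integral_one_sub_mul_sub_exp_nonneg {y : ℝ} (hy : y ∈ Icc (0 : ℝ) 1) :
    0 ≤ ∫ t in (0 : ℝ)..1, (1 - t * g y 1 - exp (-y * t)) := by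
  rcases hy.1.eq_or_lt with rfl | h0
  · simp
  rw [intervalIntegral.integral_sub (Continuous.intervalIntegrable (by fun_prop) _ _)
      (Continuous.intervalIntegrable (by fun_prop) _ _),
    intervalIntegral.integral_sub (Continuous.intervalIntegrable (by fun_prop) _ _)
      (Continuous.intervalIntegrable (by fun_prop) _ _),
    integral_exp_const_mul (neg_ne_zero.2 h0.ne'), intervalIntegral.integral_mul_const, integral_id]
  have h := one_sub_exp_neg_le_mul hy
  have e : (exp (-y) - 1) / -y = (1 - exp (-y)) / y := by
    rw [div_neg, ← neg_div, neg_sub]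
  rw [e]
  have h2 : (1 - exp (-y)) / y ≤ 1 - g y 1 / 2 := by
    rw [div_le_iff₀ h0]
    linarith
  simp only [intervalIntegral.integral_const, smul_eq_mul]
  linarith

lemma concaveOn_one_sub_mul_sub_exp (c y : ℝ) :
    ConcaveOn ℝ (Icc 0 1) (fun t : ℝ => 1 - t * c - exp (-y * t)) := by
  refine concaveOn_Icc_of_hasDerivAt2
    (f' := fun t => -c - exp (-y * t) * -y) (f'' := fun t => -(exp (-y * t) * -y * -y)) ?_ ?_ ?_
  · intro t
    have h1 : HasDerivAt (fun t : ℝ => 1 - t * c) (-c) t := by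
      simpa using ((hasDerivAt_id t).mul_const c).const_sub 1
    have h2 : HasDerivAt (fun t : ℝ => -y * t) (-y) t := by
      simpa using (hasDerivAt_id t).const_mul (-y)
    exact h1.sub h2.exp
  · intro t
    have h2 : HasDerivAt (fun t : ℝ => -y * t) (-y) t := by
      simpa using (hasDerivAt_id t).const_mul (-y)
    exact (h2.exp.mul_const (-y)).const_sub (-c)
  · intro t _
    have := exp_pos (-y * t)
    nlinarith [mul_nonneg this.le (sq_nonneg y)]

/-- A concave function that vanishes at `0` is first nonnegative and then nonpositive. -/
lemma exists_sign_change {k : ℝ → ℝ} (hk : ConcaveOn ℝ (Icc 0 1) k) (h0 : k 0 = 0) :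
    ∃ a ∈ Icc (0 : ℝ) 1, (∀ t ∈ Icc (0 : ℝ) 1, t < a → 0 ≤ k t) ∧
      ∀ t ∈ Icc (0 : ℝ) 1, a < t → k t ≤ 0 := by
  -- The sign changes at the supremum of this set: concavity between 0 and a later point of it gives
  -- nonnegativity before.
  set S : Set ℝ := {t | t ∈ Icc (0 : ℝ) 1 ∧ 0 ≤ k t} with hS
  have hne : S.Nonempty := ⟨0, by simp [hS, h0]⟩
  have hbdd : BddAbove S := ⟨1, fun t ht => ht.1.2⟩
  refine ⟨sSup S, ⟨le_csSup hbdd (by simp [hS, h0]), csSup_le hne fun t ht => ht.1.2⟩, ?_, ?_⟩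
  · intro t ht hlt
    obtain ⟨b, hb, htb⟩ := exists_lt_of_lt_csSup hne hlt
    have hb0 : 0 < b := ht.1.trans_lt htb
    have h := hk.2 (left_mem_Icc.2 zero_le_one) hb.1
      (show 0 ≤ 1 - t / b from sub_nonneg.2 ((div_le_one hb0).2 htb.le))
      (show 0 ≤ t / b from div_nonneg ht.1 hb0.le) (by ring)
    simp only [smul_eq_mul, mul_zero, zero_add, h0] at h
    rw [div_mul_cancel₀ _ hb0.ne'] at h
    exact (mul_nonneg (div_nonneg ht.1 hb0.le) hb.2).trans h
  · intro t ht hlt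
    by_contra hcon
    exact absurd (le_csSup hbdd ⟨ht, (not_le.1 hcon).le⟩) (not_le.2 hlt)

/-- If a is the point where k turns from nonnegative to nonpositive, then (ψ(t) - ψ(a)) k(t) ≥ 0 on
both sides of a, because ψ decreases. So ψ may be replaced by the constant ψ(a). -/
lemma integral_mul_nonneg_of_concaveOn {k ψ : ℝ → ℝ} (hk : ConcaveOn ℝ (Icc 0 1) k)
    (hk0 : k 0 = 0) (hkc : Continuous k) (hint : 0 ≤ ∫ t in (0 : ℝ)..1, k t)
    (hψ : AntitoneOn ψ (Icc 0 1)) (hψ0 : ∀ t ∈ Icc (0 : ℝ) 1, 0 ≤ ψ t) (hψc : Continuous ψ) :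
    0 ≤ ∫ t in (0 : ℝ)..1, ψ t * k t := by
  obtain ⟨a, ha, hpos, hneg⟩ := exists_sign_change hk hk0
  calc (0 : ℝ) ≤ ψ a * ∫ t in (0 : ℝ)..1, k t := mul_nonneg (hψ0 a ha) hint
    _ = ∫ t in (0 : ℝ)..1, ψ a * k t := (intervalIntegral.integral_const_mul _ _).symm
    _ ≤ ∫ t in (0 : ℝ)..1, ψ t * k t := by
      refine intervalIntegral.integral_mono_on zero_le_one
        (Continuous.intervalIntegrable (by fun_prop) _ _)
        (Continuous.intervalIntegrable (by fun_prop) _ _) fun t ht => ?_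
      rcases lt_trichotomy t a with h | rfl | h
      · exact mul_le_mul_of_nonneg_right (hψ ht ha h.le) (hpos t ht h)
      · exact le_rfl
      · exact mul_le_mul_of_nonpos_right (hψ ha ht h.le) (hneg t ht h)

lemma integral_mul_exp_le {ψ : ℝ → ℝ} (hψ : AntitoneOn ψ (Icc 0 1))
    (hψ0 : ∀ t ∈ Icc (0 : ℝ) 1, 0 ≤ ψ t) (hψc : Continuous ψ) {y : ℝ} (hy : y ∈ Icc (0 : ℝ) 1) :
    ∫ t in (0 : ℝ)..1, ψ t * exp (-y * t) ≤ ∫ t in (0 : ℝ)..1, ψ t * (1 - t * g y 1) := by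
  have h := integral_mul_nonneg_of_concaveOn (concaveOn_one_sub_mul_sub_exp (g y 1) y)
    (by simp) (by fun_prop) (integral_one_sub_mul_sub_exp_nonneg hy) hψ hψ0 hψc
  rw [← sub_nonneg, ← intervalIntegral.integral_sub
    (Continuous.intervalIntegrable (by fun_prop) _ _)
    (Continuous.intervalIntegrable (by fun_prop) _ _)]
  refine h.trans_eq (intervalIntegral.integral_congr fun t _ => ?_)
  ring

lemma antitoneOn_mul_of_nonneg {f h : ℝ → ℝ} {s : Set ℝ} (hf : AntitoneOn f s)
    (hh : AntitoneOn h s) (hf0 : ∀ t ∈ s, 0 ≤ f t) (hh0 : ∀ t ∈ s, 0 ≤ h t) :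
    AntitoneOn (fun t => f t * h t) s := fun a ha b hb hab =>
  mul_le_mul (hf ha hb hab) (hh ha hb hab) (hh0 b hb) (hf0 a ha)

lemma one_sub_mul_mem {t q : ℝ} (ht : t ∈ Icc (0 : ℝ) 1) (hq : q ∈ Icc (0 : ℝ) 1) :
    0 ≤ 1 - t * q := by
  nlinarith [ht.1, ht.2, hq.1, hq.2]

lemma antitoneOn_prod_one_sub_mul {ι : Type*} (F : Finset ι) {q : ι → ℝ}
    (hq : ∀ i ∈ F, q i ∈ Icc (0 : ℝ) 1) :
    AntitoneOn (fun t => ∏ i ∈ F, (1 - t * q i)) (Icc 0 1) := fun s hs t ht hst =>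
  Finset.prod_le_prod (fun i hi => one_sub_mul_mem ht (hq i hi))
    (fun i hi => by nlinarith [(hq i hi).1])

/-- Exchange one exponential at a time by `integral_mul_exp_le`; the remaining factors form the
decreasing weight. The parameter c collects the exponentials that are not exchanged yet. -/
lemma integral_exp_le_integral_prod {ι : Type*} (F : Finset ι) {y : ι → ℝ}
    (hy : ∀ i ∈ F, y i ∈ Icc (0 : ℝ) 1) {c : ℝ} (hc : 0 ≤ c) :
    ∫ t in (0 : ℝ)..1, exp (-(c + ∑ i ∈ F, y i) * t) ≤
      ∫ t in (0 : ℝ)..1, (∏ i ∈ F, (1 - t * g (y i) 1)) * exp (-c * t) := by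
  classical
  induction F using Finset.induction_on generalizing c with
  | empty => simp
  | insert a F ha ih =>
    have hya := hy a (Finset.mem_insert_self _ _)
    have hyF : ∀ i ∈ F, y i ∈ Icc (0 : ℝ) 1 := fun i hi => hy i (Finset.mem_insert_of_mem hi)
    have hgF : ∀ i ∈ F, g (y i) 1 ∈ Icc (0 : ℝ) 1 := fun i hi =>
      ⟨g_nonneg (hyF i hi), g_le_one (hyF i hi)⟩
    have h1 := ih hyF (c := c + y a) (add_nonneg hc hya.1)
    have h2 := integral_mul_exp_le (ψ := fun t => (∏ i ∈ F, (1 - t * g (y i) 1)) * exp (-c * t))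
      (antitoneOn_mul_of_nonneg (antitoneOn_prod_one_sub_mul F hgF)
        (fun s _ t _ hst => exp_le_exp.2 (by nlinarith))
        (fun t ht => Finset.prod_nonneg fun i hi => one_sub_mul_mem ht (hgF i hi))
        (fun t _ => (exp_pos _).le))
      (fun t ht => mul_nonneg (Finset.prod_nonneg fun i hi => one_sub_mul_mem ht (hgF i hi))
        (exp_pos _).le) (by fun_prop) hya
    rw [Finset.sum_insert ha, ← add_assoc]
    refine h1.trans (le_trans (le_of_eq ?_) (h2.trans (le_of_eq ?_)))
    · refine intervalIntegral.integral_congr fun t _ => ?_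
      simp only [mul_assoc, ← exp_add]
      ring_nf
    · refine intervalIntegral.integral_congr fun t _ => ?_
      simp only [Finset.prod_insert ha]
      ring

/-- The product lies below its chord over [0, 1]; integrating the chord bounds acceptance
probabilities from above. -/
lemma prod_one_sub_mul_le {ι : Type*} (F : Finset ι) {q : ι → ℝ}
    (hq : ∀ i ∈ F, q i ∈ Icc (0 : ℝ) 1) {t : ℝ} (ht : t ∈ Icc (0 : ℝ) 1) :
    ∏ i ∈ F, (1 - t * q i) ≤ 1 - t * (1 - ∏ i ∈ F, (1 - q i)) := by
  classical
  induction F using Finset.induction_on with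
  | empty => simp
  | insert a F ha ih =>
    have hqa := hq a (Finset.mem_insert_self _ _)
    have hqF : ∀ i ∈ F, q i ∈ Icc (0 : ℝ) 1 := fun i hi => hq i (Finset.mem_insert_of_mem hi)
    have h1 := mul_le_mul_of_nonneg_left (ih hqF) (one_sub_mul_mem ht hqa)
    rw [Finset.prod_insert ha, Finset.prod_insert ha]
    have h2 : ∏ i ∈ F, (1 - q i) ≤ 1 := Finset.prod_le_one
      (fun i hi => sub_nonneg.2 (hqF i hi).2) (fun i hi => by linarith [(hqF i hi).1])
    have h3 : 0 ≤ (t * (1 - t)) * (q a * (1 - ∏ i ∈ F, (1 - q i))) :=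
      mul_nonneg (mul_nonneg ht.1 (sub_nonneg.2 ht.2)) (mul_nonneg hqa.1 (sub_nonneg.2 h2))
    nlinarith

lemma integral_prod_one_sub_mul_le {ι : Type*} (F : Finset ι) {q : ι → ℝ}
    (hq : ∀ i ∈ F, q i ∈ Icc (0 : ℝ) 1) :
    ∫ t in (0 : ℝ)..1, ∏ i ∈ F, (1 - t * q i) ≤ (1 + ∏ i ∈ F, (1 - q i)) / 2 := by
  have h := intervalIntegral.integral_mono_on (a := 0) (b := 1) (μ := volume)
    (f := fun t => ∏ i ∈ F, (1 - t * q i)) (g := fun t => 1 - t * (1 - ∏ i ∈ F, (1 - q i)))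
    zero_le_one (Continuous.intervalIntegrable (by fun_prop) _ _)
    (Continuous.intervalIntegrable (by fun_prop) _ _) (fun t ht => prod_one_sub_mul_le F hq ht)
  rw [intervalIntegral.integral_sub (Continuous.intervalIntegrable (by fun_prop) _ _)
      (Continuous.intervalIntegrable (by fun_prop) _ _),
    intervalIntegral.integral_mul_const, integral_id] at h
  simp only [intervalIntegral.integral_const, smul_eq_mul] at h
  linarith

lemma prod_one_sub_g_le_exp {ι : Type*} (F : Finset ι) {y : ι → ℝ}
    (hy : ∀ i ∈ F, y i ∈ Icc (0 : ℝ) 1) :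
    ∏ i ∈ F, (1 - g (y i) 1) ≤ exp (-∑ i ∈ F, y i) := by
  rw [← Finset.sum_neg_distrib, exp_sum]
  exact Finset.prod_le_prod (fun i hi => sub_nonneg.2 (g_le_one (hy i hi)))
    (fun i hi => by linarith [one_sub_exp_neg_le_g (hy i hi)])

lemma exp_le_prod_one_sub_g {ι : Type*} (F : Finset ι) {y : ι → ℝ}
    (hy : ∀ i ∈ F, y i ∈ Icc (0 : ℝ) 1) :
    exp (-(9 / 8 * ∑ i ∈ F, y i)) ≤ ∏ i ∈ F, (1 - g (y i) 1) := by
  rw [Finset.mul_sum, ← Finset.sum_neg_distrib, exp_sum]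
  exact Finset.prod_le_prod (fun i _ => (exp_pos _).le)
    (fun i hi => exp_neg_le_one_sub_g (hy i hi))

end Arrival

/-! ### Random orders -/

section RandomOrder

open Finset

variable {V : Type*} [Fintype V] [DecidableEq V] {n : ℕ}

/-- The last element of a set in a random order is uniformly distributed. -/
lemma card_filter_forall_lt (T : Finset V) {v : V} (hv : v ∉ T) :
    (#{π : Fin n ≃ V | ∀ a ∈ T, π.symm a < π.symm v}) * (#T + 1) =
      Fintype.card (Fin n ≃ V) := by
  set T' := insert v T with hT'
  have hvT' : v ∈ T' := mem_insert_self _ _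
  -- Swapping v and w is a bijection between the orders in which w comes last and those in which v
  -- does.
  have key : ∀ w ∈ T', #{π : Fin n ≃ V | ∀ a ∈ T', π.symm a ≤ π.symm w} =
      #{π : Fin n ≃ V | ∀ a ∈ T', π.symm a ≤ π.symm v} := by
    intro w hw
    refine card_bij' (fun π _ => π.trans (Equiv.swap v w)) (fun π _ => π.trans (Equiv.swap v w))
      ?_ ?_ ?_ ?_
    · simp only [mem_filter, mem_univ, true_and]
      intro π hπ a ha
      simp only [Equiv.symm_trans_apply, Equiv.symm_swap, Equiv.swap_apply_left]
      refine hπ _ ?_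
      rw [Equiv.swap_apply_def]
      split_ifs <;> assumption
    · simp only [mem_filter, mem_univ, true_and]
      intro π hπ a ha
      simp only [Equiv.symm_trans_apply, Equiv.symm_swap, Equiv.swap_apply_right]
      refine hπ _ ?_
      rw [Equiv.swap_apply_def]
      split_ifs <;> assumption
    · intro π _
      ext i
      simp
    · intro π _
      ext i
      simp
  have hcover : (univ : Finset (Fin n ≃ V)) =
      T'.biUnion fun w => {π : Fin n ≃ V | ∀ a ∈ T', π.symm a ≤ π.symm w} := by
    ext π
    simp only [mem_univ, mem_biUnion, mem_filter, true_and, true_iff]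
    exact exists_max_image T' (fun a => π.symm a) ⟨v, hvT'⟩
  have hdisj : (T' : Set V).PairwiseDisjoint
      fun w => ({π : Fin n ≃ V | ∀ a ∈ T', π.symm a ≤ π.symm w} : Finset (Fin n ≃ V)) := by
    intro w hw w' hw' hne
    rw [Function.onFun, disjoint_left]
    intro π h1 h2
    simp only [mem_filter, mem_univ, true_and] at h1 h2
    exact hne (π.symm.injective (le_antisymm (h2 w hw) (h1 w' hw')))
  have hcard : Fintype.card (Fin n ≃ V) =
      #T' * #{π : Fin n ≃ V | ∀ a ∈ T', π.symm a ≤ π.symm v} := by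
    have h := card_biUnion hdisj
    rwa [← hcover, card_univ, sum_congr rfl key, sum_const, smul_eq_mul] at h
  rw [hcard, hT', card_insert_of_notMem hv, mul_comm]
  congr 2
  refine filter_congr fun π _ => ?_
  constructor
  · intro h a ha
    rcases mem_insert.1 ha with rfl | ha
    · exact le_rfl
    · exact (h a ha).le
  · intro h a ha
    exact lt_of_le_of_ne (h a (mem_insert_of_mem ha))
      fun e => hv (π.symm.injective e ▸ ha)

/-- The probability that nobody before `v` in a random order succeeds, when `a` succeeds
with probability `q a`, computed with independent uniform arrival times. -/
lemma sum_prod_before_eq_integral (q : V → ℝ) (v : V) :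
    ∑ π : Fin n ≃ V, ∏ a ∈ univ.erase v, (if π.symm a < π.symm v then 1 - q a else 1) =
      Fintype.card (Fin n ≃ V) * ∫ t in (0 : ℝ)..1, ∏ a ∈ univ.erase v, (1 - t * q a) := by
  -- Expand both products over subsets T. All of T precedes v in a fraction 1/(|T| + 1) of the
  -- orders, which is also ∫₀¹ t^|T| dt.
  have h1 : ∀ π : Fin n ≃ V,
      ∏ a ∈ univ.erase v, (if π.symm a < π.symm v then 1 - q a else 1) =
      ∑ T ∈ (univ.erase v).powerset,
        if ∀ a ∈ T, π.symm a < π.symm v then ∏ a ∈ T, (-q a) else 0 := by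
    intro π
    rw [prod_congr rfl fun a _ => (by split_ifs <;> ring :
      (if π.symm a < π.symm v then 1 - q a else 1) =
        1 + (if π.symm a < π.symm v then -q a else 0)), prod_one_add]
    exact sum_congr rfl fun T _ => by rw [prod_ite_zero]; congr
  have h2 : ∀ t : ℝ, ∏ a ∈ univ.erase v, (1 - t * q a) =
      ∑ T ∈ (univ.erase v).powerset, (∏ a ∈ T, (-q a)) * t ^ #T := by
    intro t
    rw [prod_congr rfl fun a _ => (by ring : 1 - t * q a = 1 + -q a * t), prod_one_add]
    exact sum_congr rfl fun T _ => by rw [prod_mul_distrib, prod_const]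
  simp only [h1, h2]
  rw [sum_comm, intervalIntegral.integral_finsetSum
    (fun T _ => Continuous.intervalIntegrable (by fun_prop) _ _), mul_sum]
  refine sum_congr rfl fun T hT => ?_
  have hvT : v ∉ T := fun h => by simpa using mem_powerset.1 hT h
  have hc := card_filter_forall_lt (n := n) T hvT
  rw [intervalIntegral.integral_const_mul, integral_pow, ← sum_filter, sum_const, nsmul_eq_mul,
    ← hc]
  push_cast
  have : (#T : ℝ) + 1 ≠ 0 := by positivity
  field_simp
  simp

end RandomOrder

/-! ### Expectations -/

section Expectation

variable {α β γ : Type*}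

/-- The expectation of `φ` under `P`. -/
def ex (P : PMF α) (φ : α → ℝ) : ℝ := ∑' a, (P a).toReal * φ a

lemma toReal_pmf_nonneg (P : PMF α) (a : α) : 0 ≤ (P a).toReal := ENNReal.toReal_nonneg

lemma summable_toReal (P : PMF α) : Summable fun a => (P a).toReal :=
  ENNReal.summable_toReal P.tsum_coe_ne_top

lemma tsum_toReal (P : PMF α) : ∑' a, (P a).toReal = 1 := by
  rw [← ENNReal.tsum_toReal_eq P.apply_ne_top, P.tsum_coe, ENNReal.toReal_one]

lemma summable_toReal_mul (P : PMF α) {φ : α → ℝ} {C : ℝ} (h : ∀ a, |φ a| ≤ C) :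
    Summable fun a => (P a).toReal * φ a := by
  refine Summable.of_norm_bounded ((summable_toReal P).mul_right C) fun a => ?_
  rw [norm_mul, Real.norm_eq_abs, Real.norm_eq_abs, abs_of_nonneg (toReal_pmf_nonneg P a)]
  exact mul_le_mul_of_nonneg_left (h a) (toReal_pmf_nonneg P a)

lemma exists_bound [Finite α] (φ : α → ℝ) : ∃ C, ∀ a, |φ a| ≤ C := by
  obtain ⟨C, hC⟩ := (Set.finite_range fun a => |φ a|).bddAbove
  exact ⟨C, fun a => hC ⟨a, rfl⟩⟩

lemma ex_congr {P : PMF α} {φ ψ : α → ℝ} (h : ∀ a ∈ P.support, φ a = ψ a) : ex P φ = ex P ψ := by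
  refine tsum_congr fun a => ?_
  by_cases ha : P a = 0
  · simp [ha]
  · rw [h a ((P.mem_support_iff a).2 ha)]

lemma ex_nonneg {P : PMF α} {φ : α → ℝ} (h : ∀ a ∈ P.support, 0 ≤ φ a) : 0 ≤ ex P φ := by
  refine tsum_nonneg fun a => ?_
  by_cases ha : P a = 0
  · simp [ha]
  · exact mul_nonneg (toReal_pmf_nonneg P a) (h a ((P.mem_support_iff a).2 ha))

lemma ex_const (P : PMF α) (c : ℝ) : ex P (fun _ => c) = c := by
  rw [ex, tsum_mul_right, tsum_toReal, one_mul]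

lemma ex_pure (a : α) (φ : α → ℝ) : ex (PMF.pure a) φ = φ a := by
  rw [ex_congr (ψ := fun _ => φ a), ex_const]
  intro b hb
  rw [(PMF.mem_support_pure_iff a b).1 hb]

lemma abs_ex_le (P : PMF α) {φ : α → ℝ} {C : ℝ} (h : ∀ a, |φ a| ≤ C) : |ex P φ| ≤ C := by
  calc |ex P φ| ≤ ∑' a, (P a).toReal * C := by
        rw [← Real.norm_eq_abs]
        refine tsum_of_norm_bounded ((summable_toReal P).mul_right C).hasSum fun a => ?_
        rw [norm_mul, Real.norm_eq_abs, Real.norm_eq_abs, abs_of_nonneg (toReal_pmf_nonneg P a)]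
        exact mul_le_mul_of_nonneg_left (h a) (toReal_pmf_nonneg P a)
    _ = C := ex_const P C

lemma ex_fintype [Fintype α] (P : PMF α) (φ : α → ℝ) : ex P φ = ∑ a, (P a).toReal * φ a :=
  tsum_fintype _

lemma ex_const_mul (P : PMF α) (c : ℝ) (φ : α → ℝ) : ex P (fun a => c * φ a) = c * ex P φ := by
  rw [ex, ex, ← tsum_mul_left]
  exact tsum_congr fun a => by ring

lemma ex_mul_const (P : PMF α) (c : ℝ) (φ : α → ℝ) : ex P (fun a => φ a * c) = ex P φ * c := by
  simp only [mul_comm _ c, ex_const_mul]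

lemma ex_finsetSum [Finite α] {ι : Type*} (P : PMF α) (s : Finset ι) (φ : ι → α → ℝ) :
    ex P (fun a => ∑ i ∈ s, φ i a) = ∑ i ∈ s, ex P (φ i) := by
  cases nonempty_fintype α
  simp only [ex_fintype, Finset.mul_sum]
  exact Finset.sum_comm

lemma ex_add [Finite α] (P : PMF α) (φ ψ : α → ℝ) :
    ex P (fun a => φ a + ψ a) = ex P φ + ex P ψ := by
  cases nonempty_fintype α
  simp only [ex_fintype, mul_add, Finset.sum_add_distrib]

lemma ex_sub [Finite α] (P : PMF α) (φ ψ : α → ℝ) :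
    ex P (fun a => φ a - ψ a) = ex P φ - ex P ψ := by
  cases nonempty_fintype α
  simp only [ex_fintype, mul_sub, Finset.sum_sub_distrib]

lemma ex_mono [Finite α] {P : PMF α} {φ ψ : α → ℝ} (h : ∀ a ∈ P.support, φ a ≤ ψ a) :
    ex P φ ≤ ex P ψ := by
  rw [← sub_nonneg, ← ex_sub]
  exact ex_nonneg fun a ha => sub_nonneg.2 (h a ha)

lemma ex_comm [Finite α] [Finite β] (P : PMF α) (Q : PMF β) (φ : α → β → ℝ) :
    ex P (fun a => ex Q (φ a)) = ex Q (fun b => ex P fun a => φ a b) := by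
  cases nonempty_fintype α
  cases nonempty_fintype β
  simp only [ex_fintype, Finset.mul_sum]
  rw [Finset.sum_comm]
  exact Finset.sum_congr rfl fun b _ => Finset.sum_congr rfl fun a _ => by ring

/-- Only the target is required to be finite, since P may be a law on lists; finiteness of β bounds
φ and gives the summability. -/
lemma ex_bind [Finite β] (P : PMF α) (f : α → PMF β) (φ : β → ℝ) :
    ex (P.bind f) φ = ex P fun a => ex (f a) φ := by
  cases nonempty_fintype β
  obtain ⟨C, hC⟩ := exists_bound φ
  have hs : ∀ b, Summable fun a => (P a).toReal * ((f a b).toReal * φ b) := by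
    intro b
    refine summable_toReal_mul P (C := C) fun a => ?_
    rw [abs_mul, abs_of_nonneg (toReal_pmf_nonneg (f a) b)]
    refine (mul_le_of_le_one_left (abs_nonneg _) ?_).trans (hC b)
    exact ENNReal.toReal_le_of_le_ofReal zero_le_one (by simpa using (f a).coe_le_one b)
  simp only [ex, Finset.mul_sum, tsum_fintype]
  rw [Summable.tsum_finsetSum fun b _ => hs b]
  refine Finset.sum_congr rfl fun b _ => ?_
  rw [PMF.bind_apply, ENNReal.tsum_toReal_eq, ← tsum_mul_right]
  · simp only [ENNReal.toReal_mul, mul_assoc]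
  · exact fun a => ENNReal.mul_ne_top (P.apply_ne_top a) ((f a).apply_ne_top b)

lemma ex_map [Finite β] (P : PMF α) (f : α → β) (φ : β → ℝ) :
    ex (P.map f) φ = ex P fun a => φ (f a) := by
  rw [← PMF.bind_pure_comp, ex_bind]
  simp only [Function.comp_apply, ex_pure]

lemma ex_coin {q : ℝ} (h0 : 0 ≤ q) (h1 : q ≤ 1) (φ : Bool → ℝ) :
    ex (coin q) φ = q * φ true + (1 - q) * φ false := by
  have h : min (ENNReal.ofReal q) 1 = ENNReal.ofReal q :=
    min_eq_left (by simpa using ENNReal.ofReal_le_ofReal h1)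
  rw [ex_fintype, Fintype.sum_bool]
  simp only [coin, PMF.ofFintype_apply, cond_true, cond_false, h]
  rw [← ENNReal.ofReal_one, ← ENNReal.ofReal_sub _ h0, ENNReal.toReal_ofReal h0,
    ENNReal.toReal_ofReal (sub_nonneg.2 h1)]

instance : Fintype Step := ⟨⟨{.halt, .add, .skip}, by simp⟩, fun o => by cases o <;> simp⟩

lemma ex_stepLaw {s t : ℝ} (hs : 0 ≤ s) (ht : 0 ≤ t) (hst : s + t ≤ 1) (φ : Step → ℝ) :
    ex (stepLaw s t) φ = s * φ .halt + t * φ .add + (1 - s - t) * φ .skip := by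
  have h : min (ENNReal.ofReal s) 1 = ENNReal.ofReal s :=
    min_eq_left (by simpa using ENNReal.ofReal_le_ofReal (by linarith : s ≤ 1))
  have e : (1 : ℝ≥0∞) - ENNReal.ofReal s = ENNReal.ofReal (1 - s) := by
    rw [← ENNReal.ofReal_one, ← ENNReal.ofReal_sub _ hs]
  have h' : min (ENNReal.ofReal t) (ENNReal.ofReal (1 - s)) = ENNReal.ofReal t :=
    min_eq_left (ENNReal.ofReal_le_ofReal (by linarith))
  have hu : (Finset.univ : Finset Step) = ⟨{.halt, .add, .skip}, by simp⟩ := rfl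
  rw [ex_fintype, hu, Finset.sum_mk]
  simp only [stepLaw, PMF.ofFinset_apply, Multiset.insert_eq_cons, Multiset.map_cons,
    Multiset.map_singleton, Multiset.sum_cons, Multiset.sum_singleton, h, e, h']
  rw [← ENNReal.ofReal_sub _ ht, ENNReal.toReal_ofReal hs, ENNReal.toReal_ofReal ht,
    ENNReal.toReal_ofReal (by linarith)]
  ring

end Expectation

/-! ### Random realizations -/

section Realization

variable {V B : Type*}

/-- `f` depends only on which of the edges in `T` are realized. -/
def IsLocal {α : Type*} (T : Set (V × B)) (f : Finset (V × B) → α) : Prop :=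
  ∀ R R', (∀ e ∈ T, e ∈ R ↔ e ∈ R') → f R = f R'

lemma IsLocal.comp {α β : Type*} {T : Set (V × B)} {f : Finset (V × B) → α}
    (hf : IsLocal T f) (k : α → β) : IsLocal T fun R => k (f R) :=
  fun R R' hR => congrArg k (hf R R' hR)

variable [DecidableEq V] [DecidableEq B]

lemma IsLocal.comp_insert {α : Type*} {T : Set (V × B)} {f : Finset (V × B) → α}
    (hf : IsLocal T f) (e : V × B) : IsLocal T fun R => f (insert e R) :=
  fun R R' hR => hf _ _ fun a ha => by simp [hR a ha]

lemma IsLocal.apply_insert {α : Type*} {T : Set (V × B)} {f : Finset (V × B) → α}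
    (hf : IsLocal T f) {e : V × B} (he : e ∉ T) (R : Finset (V × B)) : f (insert e R) = f R :=
  hf _ _ fun a ha => by
    have : a ≠ e := fun h => he (h ▸ ha)
    simp [this]

variable {E : Finset (V × B)} {p : V × B → ℝ}

lemma expectRealization_insert {e : V × B} (he : e ∉ E) (φ : Finset (V × B) → ℝ) :
    expectRealization (insert e E) p φ =
      p e * expectRealization E p (fun R => φ (insert e R)) +
        (1 - p e) * expectRealization E p φ := by
  simp only [expectRealization]
  rw [Finset.sum_powerset_insert he, add_comm, Finset.mul_sum, Finset.mul_sum]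
  congr 1
  · refine Finset.sum_congr rfl fun R hR => ?_
    have heR : e ∉ R := fun h => he (Finset.mem_powerset.1 hR h)
    have : insert e E \ insert e R = E \ R := by
      ext a
      simp only [Finset.mem_sdiff, Finset.mem_insert]
      by_cases h : a = e <;> simp [h, he]
    rw [realizationProb, realizationProb, Finset.prod_insert heR, this]
    ring
  · refine Finset.sum_congr rfl fun R hR => ?_
    have heR : e ∉ R := fun h => he (Finset.mem_powerset.1 hR h)
    rw [realizationProb, realizationProb, Finset.insert_sdiff_of_notMem _ heR,
      Finset.prod_insert (by simp [he])]
    ring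

lemma expectRealization_congr {φ ψ : Finset (V × B) → ℝ} (h : ∀ R ⊆ E, φ R = ψ R) :
    expectRealization E p φ = expectRealization E p ψ :=
  Finset.sum_congr rfl fun R hR => by rw [h R (Finset.mem_powerset.1 hR)]

lemma expectRealization_add (φ ψ : Finset (V × B) → ℝ) :
    expectRealization E p (fun R => φ R + ψ R) =
      expectRealization E p φ + expectRealization E p ψ := by
  simp only [expectRealization, mul_add, Finset.sum_add_distrib]

lemma expectRealization_const_mul (c : ℝ) (φ : Finset (V × B) → ℝ) :
    expectRealization E p (fun R => c * φ R) = c * expectRealization E p φ := by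
  simp only [expectRealization, Finset.mul_sum]
  exact Finset.sum_congr rfl fun R _ => by ring

lemma expectRealization_mul_const (c : ℝ) (φ : Finset (V × B) → ℝ) :
    expectRealization E p (fun R => φ R * c) = expectRealization E p φ * c := by
  simp only [mul_comm _ c, expectRealization_const_mul]

lemma expectRealization_finsetSum {ι : Type*} (s : Finset ι) (φ : ι → Finset (V × B) → ℝ) :
    expectRealization E p (fun R => ∑ i ∈ s, φ i R) = ∑ i ∈ s, expectRealization E p (φ i) := by
  simp only [expectRealization, Finset.mul_sum]
  exact Finset.sum_comm

lemma expectRealization_const (c : ℝ) : expectRealization E p (fun _ => c) = c := by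
  induction E using Finset.induction_on with
  | empty => simp [expectRealization, realizationProb]
  | insert e E he ih =>
    rw [expectRealization_insert he, ih]
    ring

lemma realizationProb_nonneg (hp : ∀ e ∈ E, 0 ≤ p e ∧ p e ≤ 1) {R : Finset (V × B)} (hR : R ⊆ E) :
    0 ≤ realizationProb E p R :=
  mul_nonneg (Finset.prod_nonneg fun e he => (hp e (hR he)).1)
    (Finset.prod_nonneg fun e he => sub_nonneg.2 (hp e (Finset.mem_sdiff.1 he).1).2)

lemma expectRealization_mono (hp : ∀ e ∈ E, 0 ≤ p e ∧ p e ≤ 1) {φ ψ : Finset (V × B) → ℝ}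
    (h : ∀ R ⊆ E, φ R ≤ ψ R) : expectRealization E p φ ≤ expectRealization E p ψ :=
  Finset.sum_le_sum fun R hR => mul_le_mul_of_nonneg_left (h R (Finset.mem_powerset.1 hR))
    (realizationProb_nonneg hp (Finset.mem_powerset.1 hR))

lemma expectRealization_nonneg (hp : ∀ e ∈ E, 0 ≤ p e ∧ p e ≤ 1) {φ : Finset (V × B) → ℝ}
    (h : ∀ R ⊆ E, 0 ≤ φ R) : 0 ≤ expectRealization E p φ :=
  Finset.sum_nonneg fun R hR => mul_nonneg (realizationProb_nonneg hp (Finset.mem_powerset.1 hR))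
    (h R (Finset.mem_powerset.1 hR))

/-- Functions of disjoint sets of edges are independent. -/
lemma expectRealization_mul {T T' : Set (V × B)} (hT : Disjoint T T')
    {f h : Finset (V × B) → ℝ} (hf : IsLocal T f) (hh : IsLocal T' h) :
    expectRealization E p (fun R => f R * h R) =
      expectRealization E p f * expectRealization E p h := by
  induction E using Finset.induction_on generalizing f h with
  | empty => simp [expectRealization, realizationProb]
  | insert e E he ih =>
    rw [expectRealization_insert he, expectRealization_insert he, expectRealization_insert he,
      ih hf hh, ih (hf.comp_insert e) (hh.comp_insert e)]
    -- The edge lies outside one of the two disjoint sets, so one factor does not see whether it is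
    -- realized.
    by_cases heT : e ∈ T
    · simp only [hh.apply_insert (Set.disjoint_left.1 hT heT)]
      ring
    · simp only [hf.apply_insert heT]
      ring

lemma expectRealization_mem {e : V × B} (he : e ∈ E) :
    expectRealization E p (fun R => if e ∈ R then 1 else 0) = p e := by
  obtain ⟨E', he', rfl⟩ : ∃ E', e ∉ E' ∧ insert e E' = E :=
    ⟨E.erase e, Finset.notMem_erase e E, Finset.insert_erase he⟩
  rw [expectRealization_insert he', expectRealization_congr (ψ := fun _ => (1 : ℝ)),
    expectRealization_congr (E := E') (φ := fun R => if e ∈ R then (1 : ℝ) else 0)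
      (ψ := fun _ => (0 : ℝ)), expectRealization_const, expectRealization_const]
  · ring
  · intro R hR
    simp [show e ∉ R from fun h => he' (hR h)]
  · intro R _
    simp

lemma isLocal_mem (e : V × B) (a b : ℝ) : IsLocal {e} fun R => if e ∈ R then a else b :=
  fun R R' h => by simp only [h e rfl]

/-- Condition on whether the edge `e` is realized. -/
lemma expectRealization_ite {e : V × B} (he : e ∈ E) {T : Set (V × B)} (heT : e ∉ T)
    {f h : Finset (V × B) → ℝ} (hf : IsLocal T f) (hh : IsLocal T h) :
    expectRealization E p (fun R => if e ∈ R then f R else h R) =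
      p e * expectRealization E p f + (1 - p e) * expectRealization E p h := by
  have hd : Disjoint ({e} : Set (V × B)) T := Set.disjoint_singleton_left.2 heT
  have h1 : ∀ R : Finset (V × B), (if e ∈ R then f R else h R) =
      (if e ∈ R then (1 : ℝ) else 0) * f R + (if e ∈ R then (0 : ℝ) else 1) * h R := by
    intro R
    split_ifs <;> simp
  have h2 : expectRealization E p (fun R => if e ∈ R then (0 : ℝ) else 1) = 1 - p e := by
    have := expectRealization_add (E := E) (p := p) (fun R => if e ∈ R then (0 : ℝ) else 1)
      (fun R => if e ∈ R then (1 : ℝ) else 0)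
    rw [expectRealization_mem he, expectRealization_congr (ψ := fun _ => (1 : ℝ)),
      expectRealization_const] at this
    · linarith
    · intro R _
      split_ifs <;> simp
  simp only [h1]
  rw [expectRealization_add, expectRealization_mul hd (isLocal_mem e 1 0) hf,
    expectRealization_mul hd (isLocal_mem e 0 1) hh, expectRealization_mem he, h2]

/-- The probability that no edge of `F` is realized. -/
lemma expectRealization_disjoint {F : Finset (V × B)} (hF : F ⊆ E) :
    expectRealization E p (fun R => if Disjoint F R then 1 else 0) = ∏ e ∈ F, (1 - p e) := by
  induction F using Finset.induction_on with
  | empty => simp [expectRealization_const]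
  | insert e F he ih =>
    have heE := hF (Finset.mem_insert_self e F)
    rw [Finset.prod_insert he, ← ih fun a ha => hF (Finset.mem_insert_of_mem ha)]
    have := expectRealization_ite (E := E) (p := p) heE (T := (F : Set (V × B))) (by simpa using he)
      (f := fun _ => 0) (h := fun R => if Disjoint F R then 1 else 0) (fun _ _ _ => rfl) ?_
    · rw [expectRealization_const, mul_zero, zero_add] at this
      rw [← this]
      refine expectRealization_congr fun R _ => ?_
      by_cases h : e ∈ R <;> simp [h, Finset.disjoint_insert_left]
    · intro R R' h
      have : Disjoint F R ↔ Disjoint F R' := by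
        simp only [Finset.disjoint_left]
        exact forall₂_congr fun a ha => not_congr (h a ha)
      simp only [this]

lemma expectRealization_of_eq_one (h : ∀ e ∈ E, p e = 1) (φ : Finset (V × B) → ℝ) :
    expectRealization E p φ = φ E := by
  induction E using Finset.induction_on generalizing φ with
  | empty => simp [expectRealization, realizationProb]
  | insert e E he ih =>
    rw [expectRealization_insert he, h e (Finset.mem_insert_self e E),
      ih fun a ha => h a (Finset.mem_insert_of_mem ha)]
    ring

lemma expectRealization_ex {α : Type*} (P : PMF α)
    (φ : Finset (V × B) → α → ℝ) {C : ℝ} (hφ : ∀ R a, |φ R a| ≤ C) :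
    expectRealization E p (fun R => ex P (φ R)) =
      ex P fun a => expectRealization E p fun R => φ R a := by
  simp only [expectRealization, ex, Finset.mul_sum]
  rw [Summable.tsum_finsetSum]
  · refine Finset.sum_congr rfl fun R _ => ?_
    rw [← tsum_mul_left]
    exact tsum_congr fun a => by ring
  · intro R _
    simpa only [mul_left_comm] using (summable_toReal_mul P (hφ R)).mul_left (realizationProb E p R)

end Realization

/-! ### Dummy edges are realized with certainty -/

section DummyRealization

variable {A B : Type*} [DecidableEq A] [DecidableEq B] [Fintype B]

@[simp]
lemma inl_mem_addDummies {S : Finset (A × B)} {v : A} {u : B} :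
    (Sum.inl v, u) ∈ addDummies S ↔ (v, u) ∈ S := by
  simp [addDummies]

@[simp]
lemma inr_mem_addDummies {S : Finset (A × B)} {u u' : B} :
    ((Sum.inr u', u) : (A ⊕ B) × B) ∈ addDummies S ↔ u' = u := by
  simp [addDummies]

lemma addDummies_insert (e : A × B) (S : Finset (A × B)) :
    addDummies (insert e S) = insert (Sum.inl e.1, e.2) (addDummies S) := by
  simp [addDummies, Finset.image_insert, Finset.insert_union]

lemma addDummies_mono {S S' : Finset (A × B)} (h : S ⊆ S') : addDummies S ⊆ addDummies S' :=
  Finset.union_subset_union (Finset.image_subset_image h) le_rfl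

lemma expectRealization_addDummies (E : Finset (A × B)) (p : A × B → ℝ)
    (φ : Finset ((A ⊕ B) × B) → ℝ) :
    expectRealization (addDummies E) (extProb p) φ =
      expectRealization E p fun R => φ (addDummies R) := by
  induction E using Finset.induction_on generalizing φ with
  | empty =>
    rw [expectRealization_of_eq_one]
    · simp [expectRealization, realizationProb]
    · rintro ⟨v | v, u⟩ h
      · simp at h
      · rfl
  | insert e E he ih =>
    rw [addDummies_insert, expectRealization_insert (by simpa using he), ih, ih,
      expectRealization_insert he]
    simp only [addDummies_insert]
    rfl

end DummyRealization

/-! ### Existence of proportional distributions -/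

section Proportional

lemma toReal_apply_eq_ex {α : Type*} [DecidableEq α] (P : PMF α) (a : α) :
    (P a).toReal = ex P fun b => if b = a then 1 else 0 := by
  rw [ex, tsum_eq_single a fun b hb => by simp [hb]]
  simp

variable {V B : Type*} {p : V × B → ℝ} {v : V}

lemma firstRealized_nil_toReal (u : B) : (firstRealized p v [] (some u)).toReal = 0 := by
  simp [firstRealized]

variable [Fintype B] [DecidableEq B]

lemma firstRealized_cons_toReal {m : B} (h0 : 0 ≤ p (v, m)) (h1 : p (v, m) ≤ 1) (l : List B)
    (u : B) : (firstRealized p v (m :: l) (some u)).toReal =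
      p (v, m) * (if m = u then 1 else 0) +
        (1 - p (v, m)) * (firstRealized p v l (some u)).toReal := by
  rw [toReal_apply_eq_ex, toReal_apply_eq_ex, firstRealized, ex_bind, ex_coin h0 h1]
  simp [ex_pure]

lemma firstRealized_toReal_of_notMem {l : List B} (hp : ∀ m ∈ l, 0 ≤ p (v, m) ∧ p (v, m) ≤ 1)
    {u : B} (hu : u ∉ l) : (firstRealized p v l (some u)).toReal = 0 := by
  induction l with
  | nil => exact firstRealized_nil_toReal u
  | cons m l ih =>
    rw [List.mem_cons, not_or] at hu
    rw [List.forall_mem_cons] at hp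
    rw [firstRealized_cons_toReal hp.1.1 hp.1.2, ih hp.2 hu.2, if_neg (Ne.symm hu.1)]
    ring

lemma firstRealized_append_toReal {l : List B} {m : B}
    (hp : ∀ a ∈ l ++ [m], 0 ≤ p (v, a) ∧ p (v, a) ≤ 1) {u : B} (hu : u ≠ m) :
    (firstRealized p v (l ++ [m]) (some u)).toReal = (firstRealized p v l (some u)).toReal := by
  induction l with
  | nil =>
    rw [firstRealized_nil_toReal]
    exact firstRealized_toReal_of_notMem hp (by simpa using hu)
  | cons a l ih =>
    simp only [List.cons_append, List.forall_mem_cons] at hp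
    rw [List.cons_append, firstRealized_cons_toReal hp.1.1 hp.1.2, ih hp.2,
      firstRealized_cons_toReal hp.1.1 hp.1.2]

lemma sum_firstRealized_toReal {l : List B} (hp : ∀ a ∈ l, 0 ≤ p (v, a) ∧ p (v, a) ≤ 1)
    (hl : l.Nodup) : ∑ u ∈ l.toFinset, (firstRealized p v l (some u)).toReal =
      1 - ∏ u ∈ l.toFinset, (1 - p (v, u)) := by
  -- The summation set is freed from `l` so that it stays fixed in the induction.
  have key : ∀ U : Finset B, (∀ a ∈ l, a ∈ U) →
      ∑ u ∈ U, (firstRealized p v l (some u)).toReal =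
        1 - (l.map fun u => 1 - p (v, u)).prod := by
    clear hl
    induction l with
    | nil => simp [firstRealized_nil_toReal]
    | cons m l ih =>
      simp only [List.forall_mem_cons] at hp
      intro U hU
      simp only [List.forall_mem_cons] at hU
      simp only [firstRealized_cons_toReal hp.1.1 hp.1.2, Finset.sum_add_distrib,
        ← Finset.mul_sum, ih hp.2 U hU.2, Finset.sum_ite_eq, hU.1, if_true, List.map_cons,
        List.prod_cons]
      ring
  rw [key _ (by simp), List.prod_toFinset _ hl]

/-- For nonnegative weights, querying in decreasing order of weight is at least as good as any
vector in the polymatroid. -/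
lemma exists_order_sum_le (w x : B → ℝ) {U : Finset B}
    (hp : ∀ u ∈ U, 0 ≤ p (v, u) ∧ p (v, u) ≤ 1)
    (hx : ∀ F ⊆ U, ∑ u ∈ F, x u ≤ 1 - ∏ u ∈ F, (1 - p (v, u))) :
    ∃ l : List B, l.Nodup ∧ l.toFinset = U ∧ ∀ c, (∀ u ∈ U, c ≤ w u) →
      ∑ u ∈ U, (w u - c) * x u ≤
        ∑ u ∈ U, (w u - c) * (firstRealized p v l (some u)).toReal := by
  induction U using Finset.induction_on_min_value w with
  | empty => exact ⟨[], by simp⟩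
  | insert a U ha hmin ih =>
    obtain ⟨l, hl, hlU, hle⟩ := ih (fun u hu => hp u (Finset.mem_insert_of_mem hu))
      fun F hF => hx F (hF.trans (Finset.subset_insert a U))
    have hal : a ∉ l := fun h => ha (hlU ▸ List.mem_toFinset.2 h)
    have hla : (l ++ [a]).Nodup := by
      rw [List.nodup_append]
      exact ⟨hl, by simp, fun b hb c hc => by
        rw [List.mem_singleton.1 hc]
        exact fun e => hal (e ▸ hb)⟩
    have hlaU : (l ++ [a]).toFinset = insert a U := by
      rw [List.toFinset_append, hlU]
      ext
      simp
    have hpl : ∀ b ∈ l ++ [a], 0 ≤ p (v, b) ∧ p (v, b) ≤ 1 := fun b hb =>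
      hp b (hlaU ▸ List.mem_toFinset.2 hb)
    refine ⟨l ++ [a], hla, hlaU, fun c hc => ?_⟩
    -- Abel summation: raise the reference level from c to the minimal weight w a. Then a drops out
    -- of the first sum, and the second is a total, for which the order attains the polymatroid
    -- bound.
    have hsplit : ∀ y : B → ℝ, ∑ u ∈ insert a U, (w u - c) * y u =
        ∑ u ∈ U, (w u - w a) * y u + (w a - c) * ∑ u ∈ insert a U, y u := by
      intro y
      rw [Finset.sum_insert ha, Finset.sum_insert ha, mul_add, Finset.mul_sum, add_left_comm,
        ← Finset.sum_add_distrib]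
      congr 1
      exact Finset.sum_congr rfl fun u _ => by ring
    have htot := sum_firstRealized_toReal hpl hla
    rw [hlaU] at htot
    rw [hsplit, hsplit, htot]
    refine add_le_add ((hle (w a) hmin).trans_eq (Finset.sum_congr rfl fun u hu => ?_))
      (mul_le_mul_of_nonneg_left (hx _ le_rfl)
        (sub_nonneg.2 (hc a (Finset.mem_insert_self a U))))
    rw [firstRealized_append_toReal hpl fun e => ha (e ▸ hu)]

/-- There are finitely many orders, so the hull is closed and a point outside is strictly separated
by a linear functional; the greedy order for that functional contradicts the separation. -/
lemma mem_convexHull_firstRealized (x : B → ℝ) {U : Finset B}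
    (hp : ∀ u ∈ U, 0 ≤ p (v, u) ∧ p (v, u) ≤ 1) (hx0 : ∀ u ∈ U, 0 ≤ x u)
    (hx : ∀ F ⊆ U, ∑ u ∈ F, x u ≤ 1 - ∏ u ∈ F, (1 - p (v, u))) :
    (fun u => if u ∈ U then x u else 0) ∈ convexHull ℝ
      ((fun (l : List B) u => (firstRealized p v l (some u)).toReal) ''
        {l | l.Nodup ∧ ∀ u ∈ l, u ∈ U}) := by
  have hfin : {l : List B | l.Nodup ∧ ∀ u ∈ l, u ∈ U}.Finite :=
    (Set.finite_coe_iff.1 (inferInstanceAs (Finite {l : List B // l.Nodup}))).subset fun l hl => hl.1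
  by_contra hcon
  obtain ⟨f, c, hlt, hgt⟩ := geometric_hahn_banach_closed_point (convex_convexHull ℝ _)
    ((hfin.image _).isClosed_convexHull ℝ) hcon
  have hf : ∀ y : B → ℝ, f y = ∑ u, f (Pi.single u 1) * y u := by
    intro y
    conv_lhs => rw [pi_eq_sum_univ' y]
    rw [map_sum]
    refine Finset.sum_congr rfl fun u _ => ?_
    rw [map_smul, smul_eq_mul, mul_comm]
  set w : B → ℝ := fun u => f (Pi.single u 1) with hw
  -- Coordinates of nonpositive weight cannot raise the value at x ≥ 0, and the greedy order may
  -- omit them.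
  set U' := U.filter fun u => 0 < w u with hU'
  have hU'U : U' ⊆ U := Finset.filter_subset _ _
  obtain ⟨l, hl, hlU, hle⟩ := exists_order_sum_le (p := p) (v := v) w x
    (fun u hu => hp u (hU'U hu)) fun F hF => hx F (hF.trans hU'U)
  have hlmem : ∀ u ∈ l, u ∈ U' := fun u hu => hlU ▸ List.mem_toFinset.2 hu
  have h1 := hlt _ (subset_convexHull ℝ _ ⟨l, ⟨hl, fun u hu => hU'U (hlmem u hu)⟩, rfl⟩)
  have h2 := hle 0 fun u hu => (Finset.mem_filter.1 hu).2.le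
  simp only [sub_zero] at h2
  have h3 : f (fun u => if u ∈ U then x u else 0) ≤ ∑ u ∈ U', w u * x u := by
    rw [hf, hU', Finset.sum_filter]
    refine (Finset.sum_le_sum (g := fun u =>
      if u ∈ U then if 0 < w u then w u * x u else 0 else 0) fun u _ => ?_).trans_eq ?_
    · by_cases hu : u ∈ U
      · simp only [hu, if_true]
        split_ifs with h
        · exact le_rfl
        · exact mul_nonpos_of_nonpos_of_nonneg (not_lt.1 h) (hx0 u hu)
      · simp [hu]
    · rw [← Finset.sum_filter]
      simp
  have h4 : f (fun u => (firstRealized p v l (some u)).toReal) =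
      ∑ u ∈ U', w u * (firstRealized p v l (some u)).toReal := by
    rw [hf]
    refine (Finset.sum_subset (Finset.subset_univ _) fun u _ hu => ?_).symm
    rw [firstRealized_toReal_of_notMem (fun m hm => hp m (hU'U (hlmem m hm)))
      (fun h => hu (hlmem u h)), mul_zero]
  linarith

lemma exists_isProportional [DecidableEq V] {E : Finset (V × B)} {p x : V × B → ℝ} {v : V}
    (hp : ∀ u, (v, u) ∈ E → 0 ≤ p (v, u) ∧ p (v, u) ≤ 1) (hx0 : ∀ u, (v, u) ∈ E → 0 ≤ x (v, u))
    (hx : ∀ F : Finset B, (∀ u ∈ F, (v, u) ∈ E) →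
      ∑ u ∈ F, x (v, u) ≤ 1 - ∏ u ∈ F, (1 - p (v, u))) :
    ∃ d, IsProportional E p x v d := by
  set U : Finset B := {u | (v, u) ∈ E} with hU
  have hUE : ∀ u, u ∈ U ↔ (v, u) ∈ E := by simp [hU]
  have hmem := mem_convexHull_firstRealized (p := p) (v := v) (fun u => x (v, u)) (U := U)
    (fun u hu => hp u ((hUE u).1 hu)) (fun u hu => hx0 u ((hUE u).1 hu))
    (fun F hF => hx F fun u hu => (hUE u).1 (hF hu))
  rw [mem_convexHull_iff_exists_fintype] at hmem
  obtain ⟨ι, _, c, z, hc0, hc1, hz, hsum⟩ := hmem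
  choose o ho hoz using hz
  have hc1' : ∑ i, ENNReal.ofReal (c i) = 1 := by
    rw [← ENNReal.ofReal_sum_of_nonneg fun i _ => hc0 i, hc1, ENNReal.ofReal_one]
  refine ⟨(PMF.ofFintype (fun i => ENNReal.ofReal (c i)) hc1').map o, ?_, ?_⟩
  · intro l hl
    rw [PMF.support_map] at hl
    obtain ⟨i, -, rfl⟩ := hl
    exact ⟨(ho i).1, fun u hu => (hUE u).1 ((ho i).2 u hu)⟩
  · intro u hu
    rw [PMF.bind_map, ← ENNReal.ofReal_toReal (PMF.apply_ne_top _ (some u)), toReal_apply_eq_ex,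
      ex_bind, ex_fintype]
    congr 1
    have := congrFun hsum u
    simp only [Finset.sum_apply, Pi.smul_apply, smul_eq_mul, ← hoz, (hUE u).2 hu, if_true] at this
    rw [← this]
    refine Finset.sum_congr rfl fun i _ => ?_
    rw [PMF.ofFintype_apply, ENNReal.toReal_ofReal (hc0 i), Function.comp_apply,
      ← toReal_apply_eq_ex]

end Proportional

/-! ### The linear program -/

section LinearProgram

variable {V B : Type*} [DecidableEq V] [DecidableEq B] {E : Finset (V × B)} {w p x : V × B → ℝ}

lemma IsLPFeasible.le_prob (hx : IsLPFeasible E p x) {e : V × B} (he : e ∈ E) : x e ≤ p e := by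
  simpa using hx.left e.1 {e} (by simpa using he)

lemma IsLPFeasible.mem_Icc (hx : IsLPFeasible E p x) (hp : ∀ e ∈ E, 0 < p e ∧ p e ≤ 1)
    {e : V × B} (he : e ∈ E) : x e ∈ Set.Icc (0 : ℝ) 1 :=
  ⟨hx.nonneg e he, (hx.le_prob he).trans (hp e he).2⟩

/-- The constraints are monotone, so resetting the coordinate to 0 keeps feasibility, and it would
strictly raise the objective. -/
lemma IsLPOptimal.eq_zero_of_neg (hx : IsLPOptimal E w p x) {e : V × B} (he : e ∈ E)
    (hw : w e < 0) : x e = 0 := by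
  by_contra h
  have hpos : 0 < x e := lt_of_le_of_ne (hx.1.nonneg e he) (Ne.symm h)
  have hle : ∀ a ∈ E, Function.update x e 0 a ≤ x a := by
    intro a ha
    rcases eq_or_ne a e with rfl | hae
    · simpa using hx.1.nonneg a ha
    · simp [hae]
  have hf : IsLPFeasible E p (Function.update x e 0) := by
    refine ⟨fun a ha => ?_, fun v F hF => ?_, fun u F hF => ?_⟩
    · rcases eq_or_ne a e with rfl | hae
      · simp
      · simpa [hae] using hx.1.nonneg a ha
    · exact (Finset.sum_le_sum fun a ha => hle a (Finset.mem_filter.1 (hF ha)).1).trans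
        (hx.1.left v F hF)
    · exact (Finset.sum_le_sum fun a ha => hle a (Finset.mem_filter.1 (hF ha)).1).trans
        (hx.1.right u F hF)
  have hlt : lpValue E w x < lpValue E w (Function.update x e 0) := by
    refine Finset.sum_lt_sum (fun a ha => ?_) ⟨e, he, by simpa using mul_neg_of_pos_of_neg hpos hw⟩
    rcases eq_or_ne a e with rfl | hae
    · simpa using (mul_neg_of_pos_of_neg hpos hw).le
    · simp [hae]
  exact absurd (hx.2 _ hf) (not_le.2 hlt)

lemma IsLPOptimal.mul_nonneg (hx : IsLPOptimal E w p x) {e : V × B} (he : e ∈ E) :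
    0 ≤ w e * x e := by
  rcases lt_or_ge (w e) 0 with h | h
  · simp [hx.eq_zero_of_neg he h]
  · exact _root_.mul_nonneg h (hx.1.nonneg e he)

lemma exists_max_matching (w : V × B → ℝ) (R : Finset (V × B)) :
    ∃ M ⊆ R, IsMatching M ∧ maxWeight w R = ∑ e ∈ M, w e := by
  classical
  obtain ⟨M, hM, h⟩ := Finset.exists_mem_eq_sup' (s := R.powerset.filter IsMatching)
    ⟨∅, Finset.mem_filter.2 ⟨Finset.empty_mem_powerset R, fun _ h => absurd h (by simp)⟩⟩
    (fun M => ∑ e ∈ M, w e)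
  rw [Finset.mem_filter, Finset.mem_powerset] at hM
  refine ⟨M, hM.1, hM.2, ?_⟩
  rw [maxWeight]
  convert h

/-- A set of edges of which at most one is in any matching contains an edge of a random matching
with at most the probability that one of its edges is realized. -/
lemma sum_expect_mem_le (hp : ∀ e ∈ E, 0 ≤ p e ∧ p e ≤ 1) {M : Finset (V × B) → Finset (V × B)}
    (hM : ∀ R, M R ⊆ R) {F : Finset (V × B)} (hF : F ⊆ E)
    (hone : ∀ R, ∀ e ∈ F, ∀ f ∈ F, e ∈ M R → f ∈ M R → e = f) :
    ∑ e ∈ F, expectRealization E p (fun R => if e ∈ M R then 1 else 0) ≤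
      1 - ∏ e ∈ F, (1 - p e) := by
  rw [← expectRealization_disjoint hF, ← expectRealization_finsetSum]
  have h1 : (1 : ℝ) - expectRealization E p (fun R => if Disjoint F R then 1 else 0) =
      expectRealization E p (fun R => if Disjoint F R then 0 else 1) := by
    have := expectRealization_add (E := E) (p := p) (fun R => if Disjoint F R then (1 : ℝ) else 0)
      (fun R => if Disjoint F R then 0 else 1)
    rw [expectRealization_congr (ψ := fun _ => (1 : ℝ)), expectRealization_const] at this
    · linarith
    · intro R _
      split_ifs <;> simp
  rw [h1]
  refine expectRealization_mono hp fun R _ => ?_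
  rw [← Finset.sum_filter, Finset.sum_const, nsmul_eq_mul, mul_one]
  have hcard : (F.filter fun e => e ∈ M R).card ≤ 1 := Finset.card_le_one.2 fun a ha b hb =>
    hone R a (Finset.mem_filter.1 ha).1 b (Finset.mem_filter.1 hb).1
      (Finset.mem_filter.1 ha).2 (Finset.mem_filter.1 hb).2
  split_ifs with hd
  · rw [Finset.filter_false_of_mem fun e he heM => Finset.disjoint_left.1 hd he (hM R heM)]
    simp
  · exact_mod_cast hcard

/-- The probabilities with which the edges belong to a fixed choice of maximum matching form a
feasible solution of value OPT. -/
lemma opt_le_lpValue (hp : ∀ e ∈ E, 0 < p e ∧ p e ≤ 1) (hx : IsLPOptimal E w p x) :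
    opt E w p ≤ lpValue E w x := by
  have hp' : ∀ e ∈ E, 0 ≤ p e ∧ p e ≤ 1 := fun e he => ⟨(hp e he).1.le, (hp e he).2⟩
  choose M hMR hM hmax using exists_max_matching w
  set y : V × B → ℝ := fun e => expectRealization E p (fun R => if e ∈ M R then 1 else 0) with hy
  have hval : opt E w p = lpValue E w y := by
    simp only [opt, lpValue, hy]
    simp only [mul_comm _ (w _), ← expectRealization_const_mul]
    rw [← expectRealization_finsetSum]
    refine expectRealization_congr fun R hR => ?_
    rw [hmax]
    simp only [mul_ite, mul_one, mul_zero]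
    rw [← Finset.sum_filter, Finset.filter_mem_eq_inter,
      Finset.inter_eq_right.2 ((hMR R).trans hR)]
  rw [hval]
  refine hx.2 y ⟨fun e _ => ?_, fun v F hF => ?_, fun u F hF => ?_⟩
  · exact expectRealization_nonneg hp' fun R _ => by split_ifs <;> simp
  · refine sum_expect_mem_le hp' hMR (hF.trans (Finset.filter_subset _ _)) ?_
    intro R e he f hf heM hfM
    by_contra hne
    exact (hM R e heM f hfM hne).1
      ((Finset.mem_filter.1 (hF he)).2.trans (Finset.mem_filter.1 (hF hf)).2.symm)
  · refine sum_expect_mem_le hp' hMR (hF.trans (Finset.filter_subset _ _)) ?_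
    intro R e he f hf heM hfM
    by_contra hne
    exact (hM R e heM f hfM hne).2
      ((Finset.mem_filter.1 (hF he)).2.trans (Finset.mem_filter.1 (hF hf)).2.symm)

end LinearProgram

/-! ### Feasibility of the solution extended to dummy edges -/

section ExtendedSolution

variable {A B : Type*} [Fintype B] [DecidableEq A] [DecidableEq B] {E S : Finset (A × B)}
  {p x : A × B → ℝ}

lemma sum_filter_snd_le_one (hp : ∀ e ∈ E, 0 < p e ∧ p e ≤ 1) (hx : IsLPFeasible E p x)
    (hS : S ⊆ E) (u : B) : ∑ e ∈ S.filter (fun e => e.2 = u), x e ≤ 1 := by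
  refine (hx.right u _ (Finset.filter_subset_filter _ hS)).trans (sub_le_self 1 ?_)
  exact Finset.prod_nonneg fun e he => sub_nonneg.2 (hp e (hS (Finset.mem_filter.1 he).1)).2

lemma extSol_mem_Icc (hp : ∀ e ∈ E, 0 < p e ∧ p e ≤ 1) (hx : IsLPFeasible E p x)
    (hS : S ⊆ E) {e : (A ⊕ B) × B} (he : e ∈ addDummies S) :
    extSol S x 1 e ∈ Set.Icc (0 : ℝ) 1 := by
  obtain ⟨v | v, u⟩ := e
  · exact hx.mem_Icc hp (hS (inl_mem_addDummies.1 he))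
  · refine ⟨sub_nonneg.2 (sum_filter_snd_le_one hp hx hS u), sub_le_self 1 ?_⟩
    exact Finset.sum_nonneg fun e he => hx.nonneg e (hS (Finset.mem_filter.1 he).1)

lemma extProb_mem (hp : ∀ e ∈ E, 0 < p e ∧ p e ≤ 1) (hS : S ⊆ E) {e : (A ⊕ B) × B}
    (he : e ∈ addDummies S) : 0 < extProb p e ∧ extProb p e ≤ 1 := by
  obtain ⟨v | v, u⟩ := e
  · exact hp _ (hS (inl_mem_addDummies.1 he))
  · simp [extProb]

lemma exists_isProportionalFamily (hp : ∀ e ∈ E, 0 < p e ∧ p e ≤ 1) (hx : IsLPFeasible E p x)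
    (hS : S ⊆ E) : ∃ d : A ⊕ B → PMF (List B), IsProportionalFamily S p x 1 d := by
  suffices ∀ v, ∃ d, IsProportional (addDummies S) (extProb p) (extSol S x 1) v d by
    choose d hd using this
    exact ⟨d, hd⟩
  intro v
  refine exists_isProportional
    (fun u hu => ⟨(extProb_mem hp hS hu).1.le, (extProb_mem hp hS hu).2⟩)
    (fun u hu => (extSol_mem_Icc hp hx hS hu).1) fun F hF => ?_
  cases v with
  | inl v =>
    have hinj : Set.InjOn (fun u : B => (v, u)) F := fun a _ b _ h => congrArg Prod.snd h
    have h := hx.left v (F.image fun u => (v, u)) fun e he => by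
      obtain ⟨u, hu, rfl⟩ := Finset.mem_image.1 he
      exact Finset.mem_filter.2 ⟨hS (inl_mem_addDummies.1 (hF u hu)), rfl⟩
    rwa [Finset.sum_image hinj, Finset.prod_image hinj] at h
  | inr v =>
    have hF' : F ⊆ {v} := fun u hu => by
      rw [Finset.mem_singleton]
      exact (inr_mem_addDummies.1 (hF u hu)).symm
    rcases Finset.subset_singleton_iff.1 hF' with rfl | rfl
    · simp
    · simpa [extProb] using
        (extSol_mem_Icc hp hx hS (hF v (Finset.mem_singleton_self v))).2

end ExtendedSolution

/-! ### Locality and invariants of a run -/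

section Run

variable {V B : Type*} [DecidableEq V] [DecidableEq B]

instance [Finite V] [Finite B] : Finite (RunState V B) :=
  Finite.of_injective (fun s : RunState V B => (s.matching, s.examined)) fun s t h => by
    cases s
    cases t
    simpa using h

variable {p x x' : V × B → ℝ} {D : V → PMF (List B)} {v : V}

lemma sublist_of_mem_support_thin {l l' : List B} (h : l' ∈ (thin p x x' v l).support) :
    l'.Sublist l := by
  induction l generalizing l' with
  | nil =>
    rw [thin, PMF.mem_support_pure_iff] at h
    rw [h]
  | cons u l ih =>
    rw [thin, PMF.mem_support_bind_iff] at h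
    obtain ⟨o, -, h⟩ := h
    cases o with
    | halt =>
      rw [(PMF.mem_support_pure_iff _ _).1 h]
      exact List.nil_sublist _
    | add =>
      obtain ⟨l'', hl'', rfl⟩ := (PMF.mem_support_map_iff _ _ _).1 h
      exact (ih hl'').cons_cons u
    | skip => exact (ih h).cons u

lemma isLocal_propose (l : List B) (s : RunState V B) :
    IsLocal {e | e.1 = v ∧ e.2 ∈ l} fun R => propose p R v l s := by
  induction l generalizing s with
  | nil => exact fun R R' _ => rfl
  | cons u l ih =>
    intro R R' h
    have h1 : ((v, u) ∈ R) = ((v, u) ∈ R') := propext (h (v, u) (by simp))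
    have h2 : ∀ s, propose p R v l s = propose p R' v l s := fun s =>
      ih s R R' fun e he => h e ⟨he.1, List.mem_cons_of_mem u he.2⟩
    simp only [propose, examine, h1, h2]

lemma isLocal_turn (s : RunState V B) {G : Finset (V × B)}
    (hD : ∀ l ∈ (D v).support, ∀ u ∈ l, (v, u) ∈ G) :
    IsLocal {e | e.1 = v ∧ e ∈ G} fun R => turn p x x' D R v s := by
  intro R R' h
  simp only [turn]
  ext s'
  simp only [PMF.bind_apply]
  refine tsum_congr fun l => ?_
  by_cases hl : ((D v).bind (thin p x x' v)) l = 0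
  · simp only [PMF.bind_apply] at hl
    simp only [hl, zero_mul]
  · obtain ⟨l₀, hl₀, hl⟩ := (PMF.mem_support_bind_iff _ _ _).1 ((PMF.mem_support_iff _ _).2 hl)
    congr 2
    refine isLocal_propose l s R R' fun e he => h e ⟨he.1, ?_⟩
    have := hD l₀ hl₀ e.2 ((sublist_of_mem_support_thin hl).subset he.2)
    rwa [← he.1] at this

lemma isLocal_turns {G : Finset (V × B)} (hD : ∀ v, ∀ l ∈ (D v).support, ∀ u ∈ l, (v, u) ∈ G)
    (vs : List V) (s : RunState V B) :
    IsLocal {e | e.1 ∈ vs ∧ e ∈ G} fun R => turns p x x' D R vs s := by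
  induction vs generalizing s with
  | nil => exact fun R R' _ => rfl
  | cons v vs ih =>
    intro R R' h
    simp only [turns]
    have h1 : turn p x x' D R v s = turn p x x' D R' v s :=
      isLocal_turn s (hD v) R R' fun e he => h e ⟨by simp [he.1], he.2⟩
    rw [h1]
    congr 1
    funext s
    exact ih s R R' fun e he => h e ⟨List.mem_cons_of_mem v he.1, he.2⟩

lemma examined_subset_of_mem_support_propose {R : Finset (V × B)} {l : List B}
    {s s' : RunState V B} (h : s' ∈ (propose p R v l s).support) : s.examined ⊆ s'.examined := by
  induction l generalizing s with
  | nil =>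
    rw [propose, PMF.mem_support_pure_iff] at h
    rw [h]
  | cons u l ih =>
    rw [propose, PMF.mem_support_bind_iff] at h
    obtain ⟨b, -, h⟩ := h
    cases b with
    | true =>
      rw [if_pos rfl, PMF.mem_support_pure_iff] at h
      rw [h]
      exact Finset.subset_insert _ _
    | false => exact (Finset.subset_insert _ _).trans (ih h)

lemma examined_subset_of_mem_support_turn {R : Finset (V × B)} {s s' : RunState V B}
    (h : s' ∈ (turn p x x' D R v s).support) : s.examined ⊆ s'.examined := by
  obtain ⟨l, -, h⟩ := (PMF.mem_support_bind_iff _ _ _).1 h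
  exact examined_subset_of_mem_support_propose h

lemma examined_subset_of_mem_support_turns {R : Finset (V × B)} {vs : List V}
    {s s' : RunState V B} (h : s' ∈ (turns p x x' D R vs s).support) :
    s.examined ⊆ s'.examined := by
  induction vs generalizing s with
  | nil =>
    rw [turns, PMF.mem_support_pure_iff] at h
    rw [h]
  | cons v vs ih =>
    rw [turns, PMF.mem_support_bind_iff] at h
    obtain ⟨t, ht, h⟩ := h
    exact (examined_subset_of_mem_support_turn ht).trans (ih h)

/-- The probability of ending in a given state depends only on the edges examined in it. -/
lemma propose_apply_congr {R R' : Finset (V × B)} {s' : RunState V B}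
    (h : ∀ e ∈ s'.examined, e ∈ R ↔ e ∈ R') (l : List B) (s : RunState V B) :
    propose p R v l s s' = propose p R' v l s s' := by
  induction l generalizing s with
  | nil => rfl
  | cons u l ih =>
    by_cases hu : (v, u) ∈ s'.examined
    · have h1 : ((v, u) ∈ R) = ((v, u) ∈ R') := propext (h _ hu)
      simp only [propose, examine, h1, PMF.bind_apply]
      refine tsum_congr fun b => ?_
      cases b
      · simp [ih]
      · simp
    · have key : ∀ R, propose p R v (u :: l) s s' = 0 := by
        intro R
        by_contra hne
        obtain ⟨b, -, hb⟩ := (PMF.mem_support_bind_iff _ _ _).1 ((PMF.mem_support_iff _ _).2 hne)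
        cases b with
        | true =>
          rw [if_pos rfl, PMF.mem_support_pure_iff] at hb
          exact hu (hb ▸ Finset.mem_insert_self _ _)
        | false =>
          exact hu (examined_subset_of_mem_support_propose hb (Finset.mem_insert_self _ _))
      rw [key, key]

lemma turns_apply_congr {R R' : Finset (V × B)} {s' : RunState V B}
    (h : ∀ e ∈ s'.examined, e ∈ R ↔ e ∈ R') (vs : List V) (s : RunState V B) :
    turns p x x' D R vs s s' = turns p x x' D R' vs s s' := by
  induction vs generalizing s with
  | nil => rfl
  | cons v vs ih =>
    simp only [turns, PMF.bind_apply]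
    refine tsum_congr fun t => ?_
    by_cases ht : turns p x x' D R vs t s' = 0
    · rw [← ih t, ht, mul_zero, mul_zero]
    · have hsub := examined_subset_of_mem_support_turns ((PMF.mem_support_iff _ _).2 ht)
      rw [ih t]
      congr 1
      simp only [turn, PMF.bind_apply]
      exact tsum_congr fun l => by rw [propose_apply_congr fun e he => h e (hsub he)]

/-- As long as v is unmatched, a coin replaces a query only if u is already matched, and then the
proposal is refused. Hence accepted edges are truly realized. -/
lemma matching_of_mem_support_propose {R : Finset (V × B)} {l : List B}
    {s s' : RunState V B} (h : s' ∈ (propose p R v l s).support) :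
    s'.matching = s.matching ∨ ∃ u ∈ l, s'.matching = insert (v, u) s.matching ∧
      (∀ f ∈ s.matching, f.2 ≠ u) ∧ ((∀ f ∈ s.matching, f.1 ≠ v) → (v, u) ∈ R) := by
  induction l generalizing s with
  | nil =>
    rw [propose, PMF.mem_support_pure_iff] at h
    exact Or.inl (by rw [h])
  | cons u l ih =>
    rw [propose, PMF.mem_support_bind_iff] at h
    obtain ⟨b, hb, h⟩ := h
    cases b with
    | true =>
      rw [if_pos rfl, PMF.mem_support_pure_iff] at h
      by_cases hu : ∀ f ∈ s.matching, f.2 ≠ u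
      · refine Or.inr ⟨u, List.mem_cons_self, ?_, hu, fun hv => ?_⟩
        · rw [h]
          exact if_pos hu
        · rw [examine, if_pos fun f hf => ⟨hv f hf, hu f hf⟩, PMF.mem_support_pure_iff] at hb
          exact of_decide_eq_true hb.symm
      · refine Or.inl ?_
        rw [h]
        exact if_neg hu
    | false =>
      rcases ih h with h | ⟨a, ha, h⟩
      · exact Or.inl h
      · exact Or.inr ⟨a, List.mem_cons_of_mem u ha, h⟩

lemma matching_of_mem_support_turns {R G : Finset (V × B)}
    (hD : ∀ v, ∀ l ∈ (D v).support, ∀ u ∈ l, (v, u) ∈ G) {vs : List V} (hvs : vs.Nodup)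
    {s s' : RunState V B} (h : s' ∈ (turns p x x' D R vs s).support)
    (hs : IsMatching s.matching ∧ s.matching ⊆ R ∧ s.matching ⊆ G)
    (hsv : ∀ f ∈ s.matching, f.1 ∉ vs) :
    IsMatching s'.matching ∧ s'.matching ⊆ R ∧ s'.matching ⊆ G := by
  induction vs generalizing s with
  | nil =>
    rw [turns, PMF.mem_support_pure_iff] at h
    rwa [h]
  | cons v vs ih =>
    rw [turns, PMF.mem_support_bind_iff] at h
    obtain ⟨t, ht, h⟩ := h
    rw [List.nodup_cons] at hvs
    obtain ⟨l, hl, ht⟩ := (PMF.mem_support_bind_iff _ _ _).1 ht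
    obtain ⟨l₀, hl₀, hl⟩ := (PMF.mem_support_bind_iff _ _ _).1 hl
    have hv : ∀ f ∈ s.matching, f.1 ≠ v := fun f hf e => hsv f hf (e ▸ List.mem_cons_self)
    have hvs' : ∀ f ∈ s.matching, f.1 ∉ vs := fun f hf e => hsv f hf (List.mem_cons_of_mem v e)
    rcases matching_of_mem_support_propose ht with he | ⟨u, hu, he, hfree, hR⟩
    · exact ih hvs.2 h (he ▸ hs) (he ▸ hvs')
    · have huG := hD v l₀ hl₀ u ((sublist_of_mem_support_thin hl).subset hu)
      refine ih hvs.2 h ⟨?_, ?_, ?_⟩ ?_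
      · rw [he]
        intro a ha b hb hab
        rcases Finset.mem_insert.1 ha with rfl | ha <;> rcases Finset.mem_insert.1 hb with rfl | hb
        · exact absurd rfl hab
        · exact ⟨(hv b hb).symm, (hfree b hb).symm⟩
        · exact ⟨hv a ha, hfree a ha⟩
        · exact hs.1 a ha b hb hab
      · rw [he]
        exact Finset.insert_subset (hR hv) hs.2.1
      · rw [he]
        exact Finset.insert_subset huG hs.2.2
      · rw [he]
        intro f hf
        rcases Finset.mem_insert.1 hf with rfl | hf
        · exact hvs.1
        · exact hvs' f hf

end Run

/-! ### Runs with fresh coins -/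

section Fresh

variable {V B : Type*} [DecidableEq V] [DecidableEq B]

/-- Examine edges in the given order, tossing a fresh coin for each. The result consists of the
examined edges and the proposal. -/
def freshPropose (p : V × B → ℝ) (v : V) : List B → PMF (Finset (V × B) × Option B)
  | [] => PMF.pure (∅, none)
  | u :: l => (coin (p (v, u))).bind fun b =>
      if b then PMF.pure ({(v, u)}, some u)
      else (freshPropose p v l).map fun o => (insert (v, u) o.1, o.2)

/-- Thin out an order and examine the remaining edges with fresh coins. -/
def listOutcome (p x x' : V × B → ℝ) (v : V) (l : List B) : PMF (Finset (V × B) × Option B) :=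
  (thin p x x' v l).bind (freshPropose p v)

/-- The examined edges and the proposal in the turn of `v`, with fresh coins. -/
def outcome (p x x' : V × B → ℝ) (D : V → PMF (List B)) (v : V) :
    PMF (Finset (V × B) × Option B) :=
  (D v).bind (listOutcome p x x' v)

/-- The state after the turn of `v`. -/
def RunState.update (v : V) (s : RunState V B) (o : Finset (V × B) × Option B) : RunState V B where
  matching := match o.2 with
    | none => s.matching
    | some u => if ∀ f ∈ s.matching, f.2 ≠ u then insert (v, u) s.matching else s.matching
  examined := s.examined ∪ o.1

/-- The turns of several vertices, with fresh coins. -/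
def freshTurns (p x x' : V × B → ℝ) (D : V → PMF (List B)) :
    List V → RunState V B → PMF (RunState V B)
  | [], s => PMF.pure s
  | v :: vs, s => (outcome p x x' D v).bind fun o => freshTurns p x x' D vs (s.update v o)

variable [Fintype V] [Fintype B] {p x x' : V × B → ℝ} {D : V → PMF (List B)} {v : V}
  {E : Finset (V × B)}

lemma ex_freshPropose_cons {u : B} (hp : 0 ≤ p (v, u) ∧ p (v, u) ≤ 1) (l : List B)
    (φ : Finset (V × B) × Option B → ℝ) :
    ex (freshPropose p v (u :: l)) φ = p (v, u) * φ ({(v, u)}, some u) +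
      (1 - p (v, u)) * ex (freshPropose p v l) fun o => φ (insert (v, u) o.1, o.2) := by
  rw [freshPropose, ex_bind, ex_coin hp.1 hp.2]
  simp [ex_pure, ex_map]

lemma ex_listOutcome_nil (φ : Finset (V × B) × Option B → ℝ) :
    ex (listOutcome p x x' v []) φ = φ (∅, none) := by
  simp [listOutcome, thin, freshPropose, ex_pure]

/-- The coin for u is independent of the thinning of the rest, so it can be tossed first; this gives
a recursion for thinning and examining combined. -/
lemma ex_listOutcome_cons {u : B} (hp : 0 ≤ p (v, u) ∧ p (v, u) ≤ 1)
    (hr : 0 ≤ x' (v, u) / x (v, u) ∧ x' (v, u) / x (v, u) ≤ 1) (l : List B)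
    (φ : Finset (V × B) × Option B → ℝ) :
    ex (listOutcome p x x' v (u :: l)) φ =
      p (v, u) * (1 - x' (v, u) / x (v, u)) * φ (∅, none) +
      x' (v, u) / x (v, u) * (p (v, u) * φ ({(v, u)}, some u) +
        (1 - p (v, u)) * ex (listOutcome p x x' v l) fun o => φ (insert (v, u) o.1, o.2)) +
      (1 - x' (v, u) / x (v, u)) * (1 - p (v, u)) * ex (listOutcome p x x' v l) φ := by
  have hadd : (((thin p x x' v l).map fun l' => u :: l').bind (freshPropose p v)) =
      (coin (p (v, u))).bind fun b => if b then PMF.pure ({(v, u)}, some u)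
        else (listOutcome p x x' v l).map fun o => (insert (v, u) o.1, o.2) := by
    rw [PMF.bind_map]
    have : (freshPropose p v ∘ fun l' => u :: l') = fun l' => (coin (p (v, u))).bind fun b =>
      if b then PMF.pure ({(v, u)}, some u)
        else (freshPropose p v l').map fun o => (insert (v, u) o.1, o.2) := rfl
    rw [this, PMF.bind_comm]
    congr 1
    funext b
    cases b
    · simp [listOutcome, PMF.map_bind]
    · simp
  have hs : 0 ≤ p (v, u) * (1 - x' (v, u) / x (v, u)) :=
    mul_nonneg hp.1 (sub_nonneg.2 hr.2)
  have hst : p (v, u) * (1 - x' (v, u) / x (v, u)) + x' (v, u) / x (v, u) ≤ 1 := by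
    nlinarith [mul_nonneg (sub_nonneg.2 hp.2) (sub_nonneg.2 hr.2)]
  rw [listOutcome, thin, PMF.bind_bind, ex_bind, ex_stepLaw hs hr.1 hst, hadd, ex_bind (coin _),
    ex_coin hp.1 hp.2]
  simp only [PMF.pure_bind, freshPropose, ex_pure, if_true, Bool.false_eq_true, if_false, ex_map]
  rw [← listOutcome]
  ring

lemma of_mem_support_freshPropose {l : List B} {o : Finset (V × B) × Option B}
    (h : o ∈ (freshPropose p v l).support) : ∀ e ∈ o.1, e.1 = v ∧ e.2 ∈ l := by
  induction l generalizing o with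
  | nil =>
    rw [freshPropose, PMF.mem_support_pure_iff] at h
    simp [h]
  | cons u l ih =>
    rw [freshPropose, PMF.mem_support_bind_iff] at h
    obtain ⟨b, -, h⟩ := h
    cases b with
    | true =>
      rw [if_pos rfl, PMF.mem_support_pure_iff] at h
      simp [h]
    | false =>
      obtain ⟨o', ho', rfl⟩ := (PMF.mem_support_map_iff _ _ _).1 h
      intro e he
      rcases Finset.mem_insert.1 he with rfl | he
      · simp
      · exact ⟨(ih ho' e he).1, List.mem_cons_of_mem u (ih ho' e he).2⟩

lemma of_mem_support_listOutcome {l : List B} {o : Finset (V × B) × Option B}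
    (h : o ∈ (listOutcome p x x' v l).support) : ∀ e ∈ o.1, e.1 = v ∧ e.2 ∈ l := by
  obtain ⟨l', hl', h⟩ := (PMF.mem_support_bind_iff _ _ _).1 h
  exact fun e he => ⟨(of_mem_support_freshPropose h e he).1,
    (sublist_of_mem_support_thin hl').subset (of_mem_support_freshPropose h e he).2⟩

lemma fst_eq_of_mem_support_outcome {o : Finset (V × B) × Option B}
    (h : o ∈ (outcome p x x' D v).support) : ∀ e ∈ o.1, e.1 = v := by
  obtain ⟨l, -, h⟩ := (PMF.mem_support_bind_iff _ _ _).1 h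
  exact fun e he => (of_mem_support_listOutcome h e he).1

/-- Queries of distinct edges are as good as fresh coins. -/
lemma expect_propose (hp : ∀ e ∈ E, 0 ≤ p e ∧ p e ≤ 1) {l : List B} (hl : l.Nodup)
    (hlE : ∀ u ∈ l, (v, u) ∈ E) (s : RunState V B) (φ : RunState V B → ℝ) :
    expectRealization E p (fun R => ex (propose p R v l s) φ) =
      ex (freshPropose p v l) fun o => φ (s.update v o) := by
  induction l generalizing s with
  | nil =>
    simp only [propose, freshPropose, ex_pure, expectRealization_const]
    simp [RunState.update]
  | cons u l ih =>
    rw [List.nodup_cons] at hl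
    rw [List.forall_mem_cons] at hlE
    have hpu := hp _ hlE.1
    set s₁ : RunState V B :=
      { matching := if ∀ f ∈ s.matching, f.2 ≠ u then insert (v, u) s.matching else s.matching
        examined := insert (v, u) s.examined } with hs₁
    set s₂ : RunState V B := { matching := s.matching, examined := insert (v, u) s.examined }
      with hs₂
    have e1 : s.update v ({(v, u)}, some u) = s₁ := by
      simp only [RunState.update, hs₁, Finset.union_singleton]
      congr
    have e2 : ∀ o : Finset (V × B) × Option B,
        s.update v (insert (v, u) o.1, o.2) = s₂.update v o := by
      intro o
      simp [RunState.update, hs₂]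
    rw [ex_freshPropose_cons hpu, e1]
    simp only [e2]
    rw [← ih hl.2 hlE.2 s₂]
    -- A query splits on the status of (v, u), which the rest of the order does not read since u ∉
    -- l; a coin has the same bias.
    by_cases hfree : ∀ f ∈ s.matching, f.1 ≠ v ∧ f.2 ≠ u
    · have h1 : ∀ R, ex (propose p R v (u :: l) s) φ =
          if (v, u) ∈ R then φ s₁ else ex (propose p R v l s₂) φ := by
        intro R
        rw [propose, examine, if_pos hfree, PMF.pure_bind]
        by_cases h : (v, u) ∈ R <;> simp [h, ex_pure, hs₁, hs₂]
      simp only [h1]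
      rw [expectRealization_ite hlE.1 (T := {e | e.1 = v ∧ e.2 ∈ l}) (by simpa using hl.1)
        (fun _ _ _ => rfl) ((isLocal_propose l s₂).comp fun P => ex P φ),
        expectRealization_const]
    · have h1 : ∀ R, ex (propose p R v (u :: l) s) φ =
          p (v, u) * φ s₁ + (1 - p (v, u)) * ex (propose p R v l s₂) φ := by
        intro R
        rw [propose, examine, if_neg hfree, ex_bind, ex_coin hpu.1 hpu.2]
        simp [ex_pure, hs₁, hs₂]
      simp only [h1]
      rw [expectRealization_add, expectRealization_const, expectRealization_const_mul]

lemma expect_turn (hp : ∀ e ∈ E, 0 ≤ p e ∧ p e ≤ 1)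
    (hD : ∀ l ∈ (D v).support, l.Nodup ∧ ∀ u ∈ l, (v, u) ∈ E)
    (s : RunState V B) (φ : RunState V B → ℝ) :
    expectRealization E p (fun R => ex (turn p x x' D R v s) φ) =
      ex (outcome p x x' D v) fun o => φ (s.update v o) := by
  obtain ⟨C, hC⟩ := exists_bound φ
  have hout : outcome p x x' D v = ((D v).bind (thin p x x' v)).bind (freshPropose p v) := by
    rw [PMF.bind_bind]
    rfl
  have hturn : ∀ R, ex (turn p x x' D R v s) φ =
      ex ((D v).bind (thin p x x' v)) fun l => ex (propose p R v l s) φ := fun R => ex_bind _ _ φ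
  simp only [hturn]
  rw [expectRealization_ex _ _ fun R l => abs_ex_le _ hC, hout, ex_bind _ (freshPropose p v)]
  refine ex_congr fun l hl => ?_
  obtain ⟨l₀, hl₀, hl⟩ := (PMF.mem_support_bind_iff _ _ _).1 hl
  have hsub := sublist_of_mem_support_thin hl
  exact expect_propose hp (hsub.nodup (hD l₀ hl₀).1)
    (fun u hu => (hD l₀ hl₀).2 u (hsub.subset hu)) s φ

/-- In a run that follows an order without repetitions, the queries are as good as fresh coins. -/
lemma expect_turns (hp : ∀ e ∈ E, 0 ≤ p e ∧ p e ≤ 1)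
    (hD : ∀ v, ∀ l ∈ (D v).support, l.Nodup ∧ ∀ u ∈ l, (v, u) ∈ E) {vs : List V} (hvs : vs.Nodup)
    (s : RunState V B) (φ : RunState V B → ℝ) :
    expectRealization E p (fun R => ex (turns p x x' D R vs s) φ) =
      ex (freshTurns p x x' D vs s) φ := by
  induction vs generalizing s with
  | nil => simp only [turns, freshTurns, expectRealization_const]
  | cons v vs ih =>
    rw [List.nodup_cons] at hvs
    have := Fintype.ofFinite (RunState V B)
    -- Turns of different vertices read different edges, so the later turns can be averaged
    -- separately.
    have hd : Disjoint {e : V × B | e.1 = v ∧ e ∈ E} {e : V × B | e.1 ∈ vs ∧ e ∈ E} :=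
      Set.disjoint_left.2 fun e he he' => hvs.1 (he.1 ▸ he'.1)
    have hD' : ∀ v, ∀ l ∈ (D v).support, ∀ u ∈ l, (v, u) ∈ E := fun v l hl => (hD v l hl).2
    have h1 : ∀ R, ex (turns p x x' D R (v :: vs) s) φ =
        ∑ t, (turn p x x' D R v s t).toReal * ex (turns p x x' D R vs t) φ := by
      intro R
      rw [turns, ex_bind, ex_fintype]
    have h2 : ∀ t, expectRealization E p
        (fun R => (turn p x x' D R v s t).toReal * ex (turns p x x' D R vs t) φ) =
        expectRealization E p (fun R => (turn p x x' D R v s t).toReal *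
          ex (freshTurns p x x' D vs t) φ) := by
      intro t
      rw [expectRealization_mul hd
        ((isLocal_turn s (hD' v)).comp fun P => (P t).toReal)
        ((isLocal_turns hD' vs t).comp fun P => ex P φ), ih hvs.2]
      rw [expectRealization_mul_const]
    simp only [h1]
    rw [expectRealization_finsetSum, Finset.sum_congr rfl fun t _ => h2 t,
      ← expectRealization_finsetSum]
    simp only [← ex_fintype]
    rw [expect_turn hp (hD v) s, freshTurns, ex_bind]

end Fresh

/-! ### The law of a single turn -/

section Outcome

variable {V B : Type*} [DecidableEq V] [DecidableEq B]

/-- The data of a run on the graph `G` make sense: the orders are proportional to `x`, and the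
transformed solution `x'` satisfies `0 ≤ x' ≤ x`. -/
structure IsRunInput (G : Finset (V × B)) (p x x' : V × B → ℝ) (D : V → PMF (List B)) : Prop where
  prob : ∀ e ∈ G, 0 < p e ∧ p e ≤ 1
  nonneg : ∀ e ∈ G, 0 ≤ x' e
  le : ∀ e ∈ G, x' e ≤ x e
  proportional : ∀ v, IsProportional G p x v (D v)

/-- The probability that `v` proposes to `u`. -/
def proposalProb (G : Finset (V × B)) (x' : V × B → ℝ) (v : V) (u : B) : ℝ :=
  if (v, u) ∈ G then x' (v, u) else 0

variable {G : Finset (V × B)} {p x x' : V × B → ℝ} {D : V → PMF (List B)}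

lemma IsRunInput.ratio_mem (h : IsRunInput G p x x' D) {e : V × B} (he : e ∈ G) :
    0 ≤ x' e / x e ∧ x' e / x e ≤ 1 :=
  ⟨div_nonneg (h.nonneg e he) ((h.nonneg e he).trans (h.le e he)),
    div_le_one_of_le₀ (h.le e he) ((h.nonneg e he).trans (h.le e he))⟩

lemma IsRunInput.prob_mem (h : IsRunInput G p x x' D) {e : V × B} (he : e ∈ G) :
    0 ≤ p e ∧ p e ≤ 1 :=
  ⟨(h.prob e he).1.le, (h.prob e he).2⟩

lemma IsRunInput.ratio_mul (h : IsRunInput G p x x' D) {e : V × B} (he : e ∈ G) :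
    x' e / x e * x e = x' e := by
  -- Here the quotient is 0 by convention, and 0 ≤ x' ≤ x forces x' = 0.
  rcases eq_or_ne (x e) 0 with h0 | h0
  · have := h.nonneg e he
    have := h.le e he
    rw [h0, mul_zero]
    linarith
  · exact div_mul_cancel₀ _ h0

lemma IsRunInput.proposalProb_nonneg (h : IsRunInput G p x x' D) (v : V) (u : B) :
    0 ≤ proposalProb G x' v u := by
  rw [proposalProb]
  split_ifs with hG
  · exact h.nonneg _ hG
  · exact le_rfl

variable [Fintype V] [Fintype B]

/-- Halting with probability p(1 - r), where r = x'/x, imitates a realized edge that is discarded.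
The process thus moves past an edge with probability 1 - p, as in the original order, and a first
realized edge is kept with probability r. -/
lemma ex_listOutcome_proposal (h : IsRunInput G p x x' D) {v : V} {l : List B}
    (hl : ∀ a ∈ l, (v, a) ∈ G) (u : B) :
    ex (listOutcome p x x' v l) (fun o => if o.2 = some u then 1 else 0) =
      x' (v, u) / x (v, u) * (firstRealized p v l (some u)).toReal := by
  induction l with
  | nil => simp [ex_listOutcome_nil, firstRealized_nil_toReal]
  | cons a l ih =>
    rw [List.forall_mem_cons] at hl
    have hpa := h.prob_mem hl.1
    rw [ex_listOutcome_cons hpa (h.ratio_mem hl.1), firstRealized_cons_toReal hpa.1 hpa.2, ih hl.2]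
    rcases eq_or_ne a u with rfl | hau
    · simp
      ring
    · simp [hau]
      ring

lemma ex_outcome_proposal (h : IsRunInput G p x x' D) (v : V) (u : B) :
    ex (outcome p x x' D v) (fun o => if o.2 = some u then 1 else 0) = proposalProb G x' v u := by
  have h1 : ex (outcome p x x' D v) (fun o => if o.2 = some u then 1 else 0) =
      x' (v, u) / x (v, u) * ((D v).bind (firstRealized p v) (some u)).toReal := by
    rw [outcome, ex_bind, toReal_apply_eq_ex, ex_bind, ← ex_const_mul]
    refine ex_congr fun l hl => ?_
    rw [ex_listOutcome_proposal h ((h.proportional v).1 l hl).2, toReal_apply_eq_ex]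
  rw [h1, proposalProb]
  split_ifs with hG
  · rw [(h.proportional v).2 u hG,
      ENNReal.toReal_ofReal ((h.nonneg _ hG).trans (h.le _ hG)), h.ratio_mul hG]
  · rw [toReal_apply_eq_ex, ex_bind, ex_congr (ψ := fun _ => 0), ex_const, mul_zero]
    intro l hl
    have hlG := ((h.proportional v).1 l hl).2
    rw [← toReal_apply_eq_ex]
    exact firstRealized_toReal_of_notMem (fun m hm => h.prob_mem (hlG m hm))
      fun hu => hG (hlG u hu)

/-- An edge is examined at most once, and its coin is independent of the decision to examine it. -/
lemma ex_listOutcome_examined (h : IsRunInput G p x x' D) {v : V} {l : List B}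
    (hl : ∀ a ∈ l, (v, a) ∈ G) (hnd : l.Nodup) (u : B) :
    p (v, u) * ex (listOutcome p x x' v l) (fun o => if (v, u) ∈ o.1 then 1 else 0) =
      ex (listOutcome p x x' v l) (fun o => if o.2 = some u then 1 else 0) := by
  induction l with
  | nil => simp [ex_listOutcome_nil]
  | cons a l ih =>
    rw [List.forall_mem_cons] at hl
    rw [List.nodup_cons] at hnd
    have hpa := h.prob_mem hl.1
    have hra := h.ratio_mem hl.1
    have ih' := ih hl.2 hnd.2
    rw [ex_listOutcome_cons hpa hra, ex_listOutcome_cons hpa hra]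
    rcases eq_or_ne a u with rfl | hau
    · have h0 : ex (listOutcome p x x' v l) (fun o => if (v, a) ∈ o.1 then 1 else 0) = 0 := by
        rw [ex_congr (ψ := fun _ => 0), ex_const]
        intro o ho
        rw [if_neg fun hmem => hnd.1 (of_mem_support_listOutcome ho _ hmem).2]
      rw [h0, mul_zero] at ih'
      simp only [← ih', h0]
      simp [ex_const]
      ring
    · simp only [← ih']
      simp [hau, hau.symm]
      ring

lemma ex_outcome_examined (h : IsRunInput G p x x' D) {v : V} {u : B} (hG : (v, u) ∈ G) :
    ex (outcome p x x' D v) (fun o => if (v, u) ∈ o.1 then 1 else 0) = x' (v, u) / p (v, u) := by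
  have h1 : p (v, u) * ex (outcome p x x' D v) (fun o => if (v, u) ∈ o.1 then 1 else 0) =
      x' (v, u) := by
    rw [← show proposalProb G x' v u = x' (v, u) from if_pos hG, ← ex_outcome_proposal h,
      outcome, ex_bind, ex_bind, ← ex_const_mul]
    exact ex_congr fun l hl => ex_listOutcome_examined h ((h.proportional v).1 l hl).2
      ((h.proportional v).1 l hl).1 u
  rw [eq_div_iff (h.prob _ hG).1.ne', mul_comm, h1]

/-- The conditional probability that `v` is not matched, when a proposal to `a` is rejected with
probability `ρ a` and the edge to `u` must not be examined. -/
def missValue (ρ : B → ℝ) (v : V) (u : B) (o : Finset (V × B) × Option B) : ℝ :=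
  if (v, u) ∈ o.1 then 0 else match o.2 with
    | none => 1
    | some a => if a = u then 0 else ρ a

/-- At each a ≠ u the process ends there with probability p in total, by halting or by proposing;
given that, v stays unmatched with probability 1 - r(1 - ρ a) ≥ κ. Hence κ is lost only once,
however long the order is. -/
lemma ex_listOutcome_miss_ge (h : IsRunInput G p x x' D) {v : V} {u : B} {ρ : B → ℝ} {κ : ℝ}
    (hκ1 : κ ≤ 1)
    (hρ : ∀ a, a ≠ u → (v, a) ∈ G → κ ≤ 1 - x' (v, a) / x (v, a) * (1 - ρ a)) {l : List B}
    (hl : ∀ a ∈ l, (v, a) ∈ G) :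
    κ * ex (listOutcome p x x' v l) (fun o => if (v, u) ∈ o.1 then 0 else 1) ≤
      ex (listOutcome p x x' v l) (missValue ρ v u) := by
  induction l with
  | nil => simpa [ex_listOutcome_nil, missValue] using hκ1
  | cons a l ih =>
    rw [List.forall_mem_cons] at hl
    have hpa := h.prob_mem hl.1
    have hra := h.ratio_mem hl.1
    have ih' := ih hl.2
    have hq := sub_nonneg.2 hpa.2
    have hr := sub_nonneg.2 hra.2
    rw [ex_listOutcome_cons hpa hra, ex_listOutcome_cons hpa hra]
    rcases eq_or_ne a u with rfl | hau
    · have h2 := mul_le_mul_of_nonneg_left ih' (mul_nonneg hr hq)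
      have h3 : κ * (p (v, a) * (1 - x' (v, a) / x (v, a))) ≤
          p (v, a) * (1 - x' (v, a) / x (v, a)) :=
        mul_le_of_le_one_left (mul_nonneg hpa.1 hr) hκ1
      simp only [missValue, Finset.notMem_empty, if_false, Finset.mem_singleton, if_true,
        Finset.mem_insert, true_or, ex_const] at h2 ⊢
      linarith
    · have hne : ((v, u) : V × B) ≠ (v, a) := fun e => hau (congrArg Prod.snd e).symm
      have h2 := mul_le_mul_of_nonneg_left ih' hq
      have h3 := mul_le_mul_of_nonneg_left (hρ a hau hl.1) hpa.1
      have e1 : ∀ o : Finset (V × B) × Option B,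
          missValue ρ v u (insert (v, a) o.1, o.2) = missValue ρ v u o := by
        simp [missValue, hne]
      have e2 : missValue ρ v u ({(v, a)}, some a) = ρ a := by simp [missValue, hau, hau.symm]
      have e3 : missValue ρ v u (∅, none) = 1 := by simp [missValue]
      simp only [e1, e2, e3, Finset.notMem_empty, if_false, Finset.mem_singleton, hne,
        Finset.mem_insert, false_or]
      linarith

lemma ex_outcome_miss_ge (h : IsRunInput G p x x' D) {v : V} {u : B} (hG : (v, u) ∈ G)
    {ρ : B → ℝ} {κ : ℝ} (hκ1 : κ ≤ 1)
    (hρ : ∀ a, a ≠ u → (v, a) ∈ G → κ ≤ 1 - x' (v, a) / x (v, a) * (1 - ρ a)) :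
    κ * (1 - x' (v, u) / p (v, u)) ≤ ex (outcome p x x' D v) (missValue ρ v u) := by
  have h1 : ex (outcome p x x' D v) (fun o => if (v, u) ∈ o.1 then 0 else 1) =
      1 - x' (v, u) / p (v, u) := by
    rw [← ex_outcome_examined h hG, eq_sub_iff_add_eq, ← ex_add,
      ex_congr (ψ := fun _ => 1), ex_const]
    exact fun o _ => by split_ifs <;> simp
  rw [← h1, ← ex_const_mul, ← sub_nonneg, ← ex_sub, outcome, ex_bind]
  refine ex_nonneg fun l hl => ?_
  rw [ex_sub, ex_const_mul, sub_nonneg]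
  exact ex_listOutcome_miss_ge h hκ1 hρ ((h.proportional v).1 l hl).2

end Outcome

/-! ### Events in a run with fresh coins -/

section FreshEvents

variable {V B : Type*} [DecidableEq V] [DecidableEq B]

/-- The vertex `u` is unmatched. -/
def RunState.Free (s : RunState V B) (u : B) : Prop := ∀ f ∈ s.matching, f.2 ≠ u

/-- The edge `e` is unexamined and its end-points are unmatched. -/
def RunState.Available (s : RunState V B) (e : V × B) : Prop :=
  e ∉ s.examined ∧ ∀ f ∈ s.matching, f.1 ≠ e.1 ∧ f.2 ≠ e.2

instance (s : RunState V B) (u : B) : Decidable (s.Free u) :=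
  inferInstanceAs (Decidable (∀ f ∈ s.matching, f.2 ≠ u))

instance (s : RunState V B) (e : V × B) : Decidable (s.Available e) :=
  inferInstanceAs (Decidable (_ ∧ _))

lemma update_matching_none (v : V) (s : RunState V B) {o : Finset (V × B) × Option B}
    (ho : o.2 = none) : (s.update v o).matching = s.matching := by
  simp [RunState.update, ho]

lemma update_matching_some (v : V) (s : RunState V B) {o : Finset (V × B) × Option B} {a : B}
    (ho : o.2 = some a) : (s.update v o).matching =
      if s.Free a then insert (v, a) s.matching else s.matching := by
  simp only [RunState.update, ho, RunState.Free]
  congr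

lemma mem_update_matching {v : V} {s : RunState V B} {o : Finset (V × B) × Option B} {e : V × B} :
    e ∈ (s.update v o).matching ↔ e ∈ s.matching ∨ e.1 = v ∧ o.2 = some e.2 ∧ s.Free e.2 := by
  obtain ⟨b, a⟩ := e
  rcases ho : o.2 with _ | c
  · simp [update_matching_none v s ho]
  · rw [update_matching_some v s ho]
    by_cases hc : s.Free c
    · rw [if_pos hc, Finset.mem_insert, Prod.mk.injEq, Option.some.injEq]
      constructor
      · rintro (⟨rfl, rfl⟩ | h)
        · exact Or.inr ⟨rfl, rfl, hc⟩
        · exact Or.inl h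
      · rintro (h | ⟨rfl, rfl, -⟩)
        · exact Or.inr h
        · exact Or.inl ⟨rfl, rfl⟩
    · rw [if_neg hc, Option.some.injEq]
      constructor
      · exact Or.inl
      · rintro (h | ⟨-, rfl, h⟩)
        · exact h
        · exact absurd h hc

lemma free_update {v : V} {s : RunState V B} {o : Finset (V × B) × Option B} {u : B} :
    (s.update v o).Free u ↔ s.Free u ∧ o.2 ≠ some u := by
  constructor
  · intro h
    have hs : s.Free u := fun f hf => h f (mem_update_matching.2 (Or.inl hf))
    exact ⟨hs, fun ho => h (v, u) (mem_update_matching.2 (Or.inr ⟨rfl, ho, hs⟩)) rfl⟩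
  · rintro ⟨hs, ho⟩ f hf hfu
    rcases mem_update_matching.1 hf with h | ⟨-, h, -⟩
    · exact hs f h hfu
    · exact ho (hfu ▸ h)

lemma available_update_of_ne {v v' : V} {s : RunState V B} {o : Finset (V × B) × Option B} {u : B}
    (hs : s.Available (v, u)) (hv : v' ≠ v) (hX : ∀ e ∈ o.1, e.1 = v') (ho : o.2 ≠ some u) :
    (s.update v' o).Available (v, u) := by
  refine ⟨?_, fun f hf => ?_⟩
  · simp only [RunState.update, Finset.mem_union, not_or]
    exact ⟨hs.1, fun h => hv (hX _ h).symm⟩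
  · rcases mem_update_matching.1 hf with h | ⟨h1, h2, -⟩
    · exact hs.2 f h
    · exact ⟨h1 ▸ hv, fun h => ho (h2.trans (congrArg some h))⟩

variable [Fintype V] [Fintype B] {G : Finset (V × B)} {p x x' : V × B → ℝ} {D : V → PMF (List B)}

lemma freshTurns_append (pre post : List V) (s : RunState V B) :
    freshTurns p x x' D (pre ++ post) s =
      (freshTurns p x x' D pre s).bind (freshTurns p x x' D post) := by
  induction pre generalizing s with
  | nil => simp [freshTurns]
  | cons v pre ih => simp only [List.cons_append, freshTurns, PMF.bind_bind, ih]

lemma ex_freshTurns_cons (v : V) (vs : List V) (s : RunState V B) (φ : RunState V B → ℝ) :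
    ex (freshTurns p x x' D (v :: vs) s) φ =
      ex (outcome p x x' D v) fun o => ex (freshTurns p x x' D vs (s.update v o)) φ := by
  rw [freshTurns, ex_bind]

lemma ex_outcome_not_proposal (h : IsRunInput G p x x' D) (v : V) (u : B) :
    ex (outcome p x x' D v) (fun o => if o.2 = some u then 0 else 1) =
      1 - proposalProb G x' v u := by
  rw [← ex_outcome_proposal h, eq_sub_iff_add_eq, ← ex_add, ex_congr (ψ := fun _ => 1),
    ex_const]
  exact fun o _ => by split_ifs <;> simp

lemma IsRunInput.proposalProb_le_one (h : IsRunInput G p x x' D) (v : V) (u : B) :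
    proposalProb G x' v u ≤ 1 := by
  rw [← sub_nonneg, ← ex_outcome_not_proposal h]
  exact ex_nonneg fun o _ => by split_ifs <;> simp

/-- The probability that nobody in `vs` proposes to `u`. -/
def noneProb (G : Finset (V × B)) (x' : V × B → ℝ) (u : B) (vs : List V) : ℝ :=
  (vs.map fun v => 1 - proposalProb G x' v u).prod

lemma noneProb_cons (u : B) (v : V) (vs : List V) :
    noneProb G x' u (v :: vs) = (1 - proposalProb G x' v u) * noneProb G x' u vs := by
  simp [noneProb]

lemma IsRunInput.noneProb_nonneg (h : IsRunInput G p x x' D) (u : B) (vs : List V) :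
    0 ≤ noneProb G x' u vs := by
  refine List.prod_nonneg fun a ha => ?_
  obtain ⟨v, -, rfl⟩ := List.mem_map.1 ha
  exact sub_nonneg.2 (h.proposalProb_le_one v u)

/-- A free vertex accepts the first proposal, so staying free means receiving none; with fresh coins
the proposals are independent of the state. -/
lemma ex_freshTurns_free (h : IsRunInput G p x x' D) (u : B) (vs : List V) (s : RunState V B) :
    ex (freshTurns p x x' D vs s) (fun t => if t.Free u then 1 else 0) =
      (if s.Free u then 1 else 0) * noneProb G x' u vs := by
  induction vs generalizing s with
  | nil => simp [freshTurns, ex_pure, noneProb]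
  | cons v vs ih =>
    rw [ex_freshTurns_cons, noneProb_cons, ← ex_outcome_not_proposal h, ← mul_assoc,
      ← ex_const_mul, ← ex_mul_const]
    refine ex_congr fun o _ => ?_
    rw [ih]
    simp only [free_update]
    by_cases h1 : s.Free u <;> by_cases h2 : o.2 = some u <;> simp [h1, h2]

lemma ex_freshTurns_mem_of_notMem {v : V} (u : B) {vs : List V} (hv : v ∉ vs)
    (s : RunState V B) :
    ex (freshTurns p x x' D vs s) (fun t => if (v, u) ∈ t.matching then 1 else 0) =
      if (v, u) ∈ s.matching then 1 else 0 := by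
  induction vs generalizing s with
  | nil => simp [freshTurns, ex_pure]
  | cons a vs ih =>
    rw [List.mem_cons, not_or] at hv
    rw [ex_freshTurns_cons, ← ex_const (outcome p x x' D a) (if (v, u) ∈ s.matching then 1 else 0)]
    refine ex_congr fun o _ => ?_
    rw [ih hv.2]
    simp only [mem_update_matching, hv.1, false_and, or_false]

/-- An edge is matched if and only if it is proposed, and nobody proposed to the same vertex
before. -/
lemma ex_freshTurns_mem (h : IsRunInput G p x x' D) (v : V) (u : B) {pre post : List V}
    (hpre : v ∉ pre) (hpost : v ∉ post) :
    ex (freshTurns p x x' D (pre ++ v :: post) ⟨∅, ∅⟩)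
        (fun t => if (v, u) ∈ t.matching then 1 else 0) =
      proposalProb G x' v u * noneProb G x' u pre := by
  have h1 : ∀ s : RunState V B, ex (freshTurns p x x' D (v :: post) s)
      (fun t => if (v, u) ∈ t.matching then 1 else 0) =
      (if (v, u) ∈ s.matching then 1 else 0) +
        (if s.Free u then 1 else 0) * proposalProb G x' v u := by
    intro s
    rw [ex_freshTurns_cons, ← ex_outcome_proposal h, ← ex_const_mul,
      ← ex_const (outcome p x x' D v) (if (v, u) ∈ s.matching then 1 else 0), ← ex_add]
    refine ex_congr fun o _ => ?_
    rw [ex_freshTurns_mem_of_notMem u hpost]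
    simp only [mem_update_matching, true_and]
    by_cases hm : (v, u) ∈ s.matching
    · have : ¬ s.Free u := fun hf => hf _ hm rfl
      simp [hm, this]
    · by_cases h1 : s.Free u <;> by_cases h2 : o.2 = some u <;> simp [h1, h2, hm]
  rw [freshTurns_append, ex_bind]
  simp only [h1]
  rw [ex_add, ex_freshTurns_mem_of_notMem u hpre, ex_mul_const, ex_freshTurns_free h]
  simp [RunState.Free]
  ring

/-- Other vertices can neither examine (v, u) nor match v; they destroy availability only by
proposing to u. -/
lemma ex_freshTurns_available_ge (h : IsRunInput G p x x' D) {v : V} (u : B) {vs : List V}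
    (hv : v ∉ vs) (s : RunState V B) :
    (if s.Available (v, u) then 1 else 0) * noneProb G x' u vs ≤
      ex (freshTurns p x x' D vs s) (fun t => if t.Available (v, u) then 1 else 0) := by
  induction vs generalizing s with
  | nil => simp [freshTurns, ex_pure, noneProb]
  | cons a vs ih =>
    rw [List.mem_cons, not_or] at hv
    rw [ex_freshTurns_cons, noneProb_cons, ← ex_outcome_not_proposal h, ← mul_assoc,
      ← ex_const_mul, ← ex_mul_const]
    refine ex_mono fun o ho => le_trans ?_ (ih hv.2 _)
    refine mul_le_mul_of_nonneg_right ?_ (h.noneProb_nonneg u vs)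
    by_cases h1 : s.Available (v, u)
    · by_cases h2 : o.2 = some u
      · simp only [h2, if_true, mul_zero]
        split_ifs <;> simp
      · have := available_update_of_ne h1 (Ne.symm hv.1) (fst_eq_of_mem_support_outcome ho) h2
        simp [h1, h2, this]
    · simp only [h1, if_false, zero_mul]
      split_ifs <;> simp

lemma ex_outcome_not_proposal₂ (h : IsRunInput G p x x' D) (v : V) {u a : B} (hau : a ≠ u) :
    ex (outcome p x x' D v) (fun o => if o.2 = some u ∨ o.2 = some a then 0 else 1) =
      1 - proposalProb G x' v u - proposalProb G x' v a := by
  rw [← ex_outcome_not_proposal h, ← ex_outcome_proposal h v a, ← ex_sub]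
  refine ex_congr fun o _ => ?_
  by_cases h1 : o.2 = some u
  · simp [h1, hau.symm]
  · by_cases h2 : o.2 = some a <;> simp [h1, h2, hau]

/-- It is at least as likely as for independent proposals that nobody proposes to `u` while
somebody proposes to `a`. -/
lemma ex_freshTurns_available_not_free_ge (h : IsRunInput G p x x' D) {v : V} {u a : B}
    (hau : a ≠ u) {vs : List V} (hv : v ∉ vs) {s : RunState V B} (hs : s.Available (v, u)) :
    noneProb G x' u vs * (if s.Free a then 1 - noneProb G x' a vs else 1) ≤
      ex (freshTurns p x x' D vs s)
        (fun t => if t.Available (v, u) ∧ ¬ t.Free a then 1 else 0) := by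
  induction vs generalizing s with
  | nil =>
    simp only [freshTurns, ex_pure, noneProb, hs]
    by_cases h1 : s.Free a <;> simp [h1]
  | cons b vs ih =>
    rw [List.mem_cons, not_or] at hv
    have hstep : ∀ o ∈ (outcome p x x' D b).support, o.2 ≠ some u →
        (s.update b o).Available (v, u) := fun o ho hou =>
      available_update_of_ne hs (Ne.symm hv.1) (fst_eq_of_mem_support_outcome ho) hou
    have hnn : ∀ t : RunState V B, 0 ≤ ex (freshTurns p x x' D vs t)
        (fun t => if t.Available (v, u) ∧ ¬ t.Free a then 1 else 0) := fun t =>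
      ex_nonneg fun t _ => by split_ifs <;> simp
    have hN := h.noneProb_nonneg u vs
    have hM := h.noneProb_nonneg a vs
    rw [ex_freshTurns_cons, noneProb_cons, noneProb_cons]
    by_cases hfree : s.Free a
    · calc (1 - proposalProb G x' b u) * noneProb G x' u vs *
            (if s.Free a then 1 - (1 - proposalProb G x' b a) * noneProb G x' a vs else 1)
          ≤ proposalProb G x' b a * noneProb G x' u vs +
            (1 - proposalProb G x' b u - proposalProb G x' b a) *
              (noneProb G x' u vs * (1 - noneProb G x' a vs)) := by
            rw [if_pos hfree]
            -- The slack is exactly the product of these four numbers: b cannot propose to both u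
            -- and a, whereas independent proposals could.
            nlinarith [mul_nonneg (mul_nonneg hN hM) (mul_nonneg (h.proposalProb_nonneg b u)
              (h.proposalProb_nonneg b a))]
        _ = ex (outcome p x x' D b) (fun o => (if o.2 = some a then 1 else 0) *
              noneProb G x' u vs + (if o.2 = some u ∨ o.2 = some a then 0 else 1) *
              (noneProb G x' u vs * (1 - noneProb G x' a vs))) := by
            rw [ex_add, ex_mul_const, ex_mul_const, ex_outcome_proposal h,
              ex_outcome_not_proposal₂ h b hau]
        _ ≤ _ := by
            refine ex_mono fun o ho => ?_
            by_cases h1 : o.2 = some u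
            · have : some u ≠ some a := fun e => hau (Option.some.inj e).symm
              simpa [h1, this] using hnn _
            · have hle := ih hv.2 (hstep o ho h1)
              simp only [free_update] at hle
              by_cases h2 : o.2 = some a
              · simpa [h2, hau, hfree] using hle
              · simpa [h1, h2, hfree] using hle
    · rw [if_neg hfree, mul_one, ← ex_outcome_not_proposal h, ← ex_mul_const]
      refine ex_mono fun o ho => ?_
      by_cases h1 : o.2 = some u
      · simpa [h1] using hnn _
      · have hle := ih hv.2 (hstep o ho h1)
        simp only [free_update] at hle
        simpa [h1, hfree] using hle

/-- A lower bound for the probability that an edge is still available after a run. -/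
lemma ex_freshTurns_available (h : IsRunInput G p x x' D) (v : V) (u : B) {pre post : List V}
    (hpre : v ∉ pre) (hpost : v ∉ post) :
    noneProb G x' u pre * noneProb G x' u post *
        ex (outcome p x x' D v) (missValue (fun a => 1 - noneProb G x' a pre) v u) ≤
      ex (freshTurns p x x' D (pre ++ v :: post) ⟨∅, ∅⟩)
        (fun t => if t.Available (v, u) then 1 else 0) := by
  have h0 : (⟨∅, ∅⟩ : RunState V B).Available (v, u) := by simp [RunState.Available]
  have h0' : ∀ a, (⟨∅, ∅⟩ : RunState V B).Free a := by simp [RunState.Free]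
  rw [freshTurns_append, ex_bind]
  simp only [ex_freshTurns_cons]
  calc noneProb G x' u pre * noneProb G x' u post *
        ex (outcome p x x' D v) (missValue (fun a => 1 - noneProb G x' a pre) v u)
      = ex (outcome p x x' D v) (fun o => (noneProb G x' u pre *
          missValue (fun a => 1 - noneProb G x' a pre) v u o) * noneProb G x' u post) := by
        rw [ex_mul_const, ex_const_mul]
        ring
    _ ≤ ex (outcome p x x' D v) (fun o => ex (freshTurns p x x' D pre ⟨∅, ∅⟩)
          (fun s => if (s.update v o).Available (v, u) then 1 else 0) * noneProb G x' u post) := by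
        refine ex_mono fun o _ => mul_le_mul_of_nonneg_right ?_ (h.noneProb_nonneg u post)
        have hnn : 0 ≤ ex (freshTurns p x x' D pre ⟨∅, ∅⟩)
          (fun s => if (s.update v o).Available (v, u) then 1 else 0) :=
          ex_nonneg fun s _ => by split_ifs <;> simp
        rw [missValue]
        by_cases hX : (v, u) ∈ o.1
        · simpa [hX] using hnn
        · have hex : ∀ s : RunState V B, s.Available (v, u) → (v, u) ∉ (s.update v o).examined := by
            intro s hs
            simp [RunState.update, hs.1, hX]
          rw [if_neg hX]
          rcases ho : o.2 with _ | a
          · have h1 := ex_freshTurns_available_ge h u hpre ⟨∅, ∅⟩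
            rw [if_pos h0, one_mul] at h1
            rw [mul_one]
            refine h1.trans (ex_mono fun s _ => ?_)
            by_cases hs : s.Available (v, u)
            · have : (s.update v o).Available (v, u) :=
                ⟨hex s hs, by rw [update_matching_none v s ho]; exact hs.2⟩
              simp [this, hs]
            · simp only [hs, if_false]
              split_ifs <;> simp
          -- A proposal to a ≠ u does no harm if a was taken before the turn of v.
          · by_cases hau : a = u
            · simpa [hau] using hnn
            · have h1 := ex_freshTurns_available_not_free_ge h hau hpre h0
              rw [if_pos (h0' a)] at h1
              simp only [hau, if_false]
              refine h1.trans (ex_mono fun s _ => ?_)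
              by_cases hs : s.Available (v, u) ∧ ¬ s.Free a
              · have : (s.update v o).Available (v, u) :=
                  ⟨hex s hs.1, by rw [update_matching_some v s ho, if_neg hs.2]; exact hs.1.2⟩
                simp [this, hs]
              · simp only [hs, if_false]
                split_ifs <;> simp
    -- The outcome of v is independent of the earlier turns, so the two expectations commute.
    _ = ex (freshTurns p x x' D pre ⟨∅, ∅⟩) (fun s => ex (outcome p x x' D v) fun o =>
          (if (s.update v o).Available (v, u) then 1 else 0) * noneProb G x' u post) := by
        rw [ex_comm]
        exact ex_congr fun o _ => (ex_mul_const _ _ _).symm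
    _ ≤ _ := ex_mono fun s _ => ex_mono fun o _ => ex_freshTurns_available_ge h u hpost _

end FreshEvents

/-! ### Runs in random order -/

section RandomRun

variable {V B : Type*} [DecidableEq V] [DecidableEq B] [Fintype V] [Fintype B]

lemma ofFn_eq_append {n : ℕ} (π : Fin n ≃ V) (v : V) : ∃ pre post : List V,
    (List.ofFn fun i => π i) = pre ++ v :: post ∧ v ∉ pre ∧ v ∉ post ∧ ∀ f : V → ℝ,
      (pre.map f).prod =
        ∏ a ∈ Finset.univ.erase v, (if π.symm a < π.symm v then f a else 1) ∧
      (pre.map f).prod * (post.map f).prod = ∏ a ∈ Finset.univ.erase v, f a := by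
  set l := List.ofFn fun i => π i with hl
  have hlen : l.length = n := by simp [hl]
  have hnd : l.Nodup := List.nodup_ofFn.2 π.injective
  have hi : (π.symm v : ℕ) < l.length := by
    rw [hlen]
    exact (π.symm v).2
  have hget : l[(π.symm v : ℕ)] = v := by simp [hl]
  have hsplit : l = l.take (π.symm v) ++ v :: l.drop (π.symm v + 1) := by
    conv_lhs => rw [← List.take_append_drop (π.symm v) l, List.drop_eq_getElem_cons hi, hget]
  have hnd' := hnd
  rw [hsplit, List.nodup_middle, List.nodup_cons] at hnd'
  have hnot : v ∉ l.take (π.symm v) ∧ v ∉ l.drop (π.symm v + 1) := by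
    simpa only [List.mem_append, not_or] using hnd'.1
  have hall : ∀ a, a ∈ l := fun a => List.mem_ofFn.2 ⟨π.symm a, by simp⟩
  have hmem : ∀ a, a ∈ l.take (π.symm v) ↔ π.symm a < π.symm v := by
    intro a
    rw [List.mem_take_iff_getElem]
    constructor
    · rintro ⟨j, hj, rfl⟩
      rw [Fin.lt_def]
      simpa [hl] using (lt_min_iff.1 hj).1
    · intro h
      have ha : (π.symm a : ℕ) < l.length := by
        rw [hlen]
        exact (π.symm a).2
      exact ⟨π.symm a, lt_min h ha, by simp [hl]⟩
  refine ⟨l.take (π.symm v), l.drop (π.symm v + 1), hsplit, hnot.1, hnot.2, fun f => ⟨?_, ?_⟩⟩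
  · rw [← List.prod_toFinset f (hnd.sublist (List.take_sublist _ _)), ← Finset.prod_filter]
    refine Finset.prod_congr ?_ fun _ _ => rfl
    ext a
    simp only [List.mem_toFinset, hmem, Finset.mem_filter, Finset.mem_erase, Finset.mem_univ,
      and_true]
    exact ⟨fun h => ⟨fun e => absurd (e ▸ h) (lt_irrefl _), h⟩, fun h => h.2⟩
  · rw [← List.prod_append, ← List.map_append, ← List.prod_toFinset f hnd'.2]
    refine Finset.prod_congr ?_ fun _ _ => rfl
    ext a
    have ha := hall a
    rw [hsplit] at ha
    simp only [List.mem_toFinset, Finset.mem_erase, Finset.mem_univ, and_true]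
    constructor
    · intro h e
      exact hnd'.1 (e ▸ h)
    · intro hne
      simp only [List.mem_append, List.mem_cons, hne, false_or] at ha
      exact List.mem_append.2 ha

/-- The average of a function over all orders of `V`. -/
def avgOrder (V : Type*) [DecidableEq V] [Fintype V] (φ : List V → ℝ) : ℝ :=
  (∑ π : Fin (Fintype.card V) ≃ V, φ (List.ofFn fun i => π i)) /
    Fintype.card (Fin (Fintype.card V) ≃ V)

lemma card_orders_pos (V : Type*) [DecidableEq V] [Fintype V] :
    (0 : ℝ) < Fintype.card (Fin (Fintype.card V) ≃ V) := by
  have : Nonempty (Fin (Fintype.card V) ≃ V) := ⟨(Fintype.equivFin V).symm⟩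
  exact_mod_cast Fintype.card_pos

lemma ex_randomOrder_bind {α : Type*} [Finite α] (f : List V → PMF α) (φ : α → ℝ) :
    ex ((randomOrder V).bind f) φ = avgOrder V fun vs => ex (f vs) φ := by
  have : Nonempty (Fin (Fintype.card V) ≃ V) := ⟨(Fintype.equivFin V).symm⟩
  rw [randomOrder, PMF.bind_map, ex_bind, ex_fintype, avgOrder, Finset.sum_div]
  refine Finset.sum_congr rfl fun π _ => ?_
  rw [PMF.uniformOfFintype_apply, ENNReal.toReal_inv, ENNReal.toReal_natCast, Function.comp_apply]
  ring

/-- The probability that a proposal of `v` to `u` is accepted in a random order. -/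
def acceptProb (G : Finset (V × B)) (x' : V × B → ℝ) (v : V) (u : B) : ℝ :=
  ∫ t in (0 : ℝ)..1, ∏ a ∈ Finset.univ.erase v, (1 - t * proposalProb G x' a u)

variable {G : Finset (V × B)} {p x x' : V × B → ℝ} {D : V → PMF (List B)}

lemma avgOrder_mem (h : IsRunInput G p x x' D) (v : V) (u : B) :
    avgOrder V (fun vs => ex (freshTurns p x x' D vs ⟨∅, ∅⟩)
      (fun t => if (v, u) ∈ t.matching then 1 else 0)) =
      proposalProb G x' v u * acceptProb G x' v u := by
  rw [avgOrder, div_eq_iff (card_orders_pos V).ne', acceptProb, mul_assoc, mul_comm _ (_ : ℝ),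
    mul_comm (intervalIntegral _ _ _ _), ← sum_prod_before_eq_integral, mul_comm, Finset.mul_sum]
  refine Finset.sum_congr rfl fun π _ => ?_
  obtain ⟨pre, post, hπ, h1, h2, h3⟩ := ofFn_eq_append π v
  rw [hπ, ex_freshTurns_mem h v u h1 h2, noneProb, (h3 _).1]

/-- The factors of the vertices before and after v combine into a product that is the same for all
orders. Only the rejection probabilities depend on the order, and `missValue` is affine in them. -/
lemma avgOrder_available (h : IsRunInput G p x x' D) (v : V) (u : B) :
    (∏ a ∈ Finset.univ.erase v, (1 - proposalProb G x' a u)) *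
        ex (outcome p x x' D v) (missValue (fun a => 1 - acceptProb G x' v a) v u) ≤
      avgOrder V (fun vs => ex (freshTurns p x x' D vs ⟨∅, ∅⟩)
        (fun t => if t.Available (v, u) then 1 else 0)) := by
  have hN := card_orders_pos V
  have hmiss : ∀ o, missValue (fun a => 1 - acceptProb G x' v a) v u o *
      Fintype.card (Fin (Fintype.card V) ≃ V) =
      ∑ π : Fin (Fintype.card V) ≃ V, missValue (fun a => 1 -
        ∏ b ∈ Finset.univ.erase v,
          (if π.symm b < π.symm v then 1 - proposalProb G x' b a else 1)) v u o := by
    intro o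
    simp only [missValue]
    split_ifs
    · simp
    · rcases o.2 with _ | a
      · simp
      · by_cases hau : a = u
        · simp [hau]
        · simp only [hau, if_false]
          rw [Finset.sum_sub_distrib, sum_prod_before_eq_integral, acceptProb]
          simp
          ring
  rw [avgOrder, le_div_iff₀ hN, mul_assoc, ← ex_mul_const]
  simp only [hmiss]
  rw [ex_finsetSum, Finset.mul_sum]
  refine Finset.sum_le_sum fun π _ => ?_
  obtain ⟨pre, post, hπ, h1, h2, h3⟩ := ofFn_eq_append π v
  have hle := ex_freshTurns_available h v u h1 h2
  simp only [noneProb] at hle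
  rw [(h3 _).2] at hle
  simp only [(h3 _).1] at hle
  rw [hπ]
  exact hle

end RandomRun

/-! ### The base algorithm -/

section Alg1

variable {A B : Type*} [Fintype A] [Fintype B] [DecidableEq A] [DecidableEq B]
  {E S : Finset (A × B)} {p x : A × B → ℝ} {D : A ⊕ B → PMF (List B)}

lemma isRunInput (hp : ∀ e ∈ E, 0 < p e ∧ p e ≤ 1) (hx : IsLPFeasible E p x) (hS : S ⊆ E)
    (hD : IsProportionalFamily S p x 1 D) :
    IsRunInput (addDummies S) (extProb p) (extSol S x 1) (fun e => g (extSol S x 1 e) 1) D where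
  prob _ he := extProb_mem hp hS he
  nonneg _ he := g_nonneg (extSol_mem_Icc hp hx hS he)
  le _ he := g_le_self (extSol_mem_Icc hp hx hS he)
  proportional := hD

/-- The extended solution, with value `0` off the graph. -/
def extSol₀ (S : Finset (A × B)) (x : A × B → ℝ) (v : A ⊕ B) (u : B) : ℝ :=
  if (v, u) ∈ addDummies S then extSol S x 1 (v, u) else 0

lemma extSol₀_mem_Icc (hp : ∀ e ∈ E, 0 < p e ∧ p e ≤ 1) (hx : IsLPFeasible E p x) (hS : S ⊆ E)
    (v : A ⊕ B) (u : B) : extSol₀ S x v u ∈ Set.Icc (0 : ℝ) 1 := by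
  rw [extSol₀]
  split_ifs with h
  · exact extSol_mem_Icc hp hx hS h
  · simp

lemma proposalProb_eq (S : Finset (A × B)) (x : A × B → ℝ) (v : A ⊕ B) (u : B) :
    proposalProb (addDummies S) (fun e => g (extSol S x 1 e) 1) v u = g (extSol₀ S x v u) 1 := by
  rw [proposalProb, extSol₀]
  split_ifs <;> simp

/-- The purpose of the dummy edges: the competitors of v at u have total value exactly 1 minus that
of v. -/
lemma sum_extSol₀ (S : Finset (A × B)) (x : A × B → ℝ) (u : B) :
    ∑ v, extSol₀ S x v u = 1 := by
  rw [Fintype.sum_sum_type]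
  have h1 : ∑ v : A, extSol₀ S x (Sum.inl v) u = ∑ e ∈ S.filter (fun e => e.2 = u), x e := by
    simp only [extSol₀, inl_mem_addDummies, extSol]
    rw [← Finset.sum_filter]
    refine Finset.sum_bij' (fun v _ => (v, u)) (fun e _ => e.1) ?_ ?_ ?_ ?_ ?_
    · intro v hv
      simpa using hv
    · rintro ⟨v, u'⟩ he
      obtain ⟨he, rfl⟩ := Finset.mem_filter.1 he
      simpa using he
    · simp
    · rintro ⟨v, u'⟩ he
      obtain ⟨he, rfl⟩ := Finset.mem_filter.1 he
      rfl
    · simp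
  have h2 : ∑ u' : B, extSol₀ S x (Sum.inr u') u =
      1 - ∑ e ∈ S.filter (fun e => e.2 = u), x e := by
    simp [extSol₀, extSol]
  rw [h1, h2]
  ring

lemma sum_erase_extSol₀ (S : Finset (A × B)) (x : A × B → ℝ) (v : A ⊕ B) (u : B) :
    ∑ a ∈ Finset.univ.erase v, extSol₀ S x a u = 1 - extSol₀ S x v u := by
  rw [← sum_extSol₀ S x u, ← Finset.add_sum_erase _ _ (Finset.mem_univ v)]
  ring

lemma proposalProb_mul_acceptProb_ge (hp : ∀ e ∈ E, 0 < p e ∧ p e ≤ 1) (hx : IsLPFeasible E p x)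
    (hS : S ⊆ E) (v : A ⊕ B) (u : B) :
    (1 - 1 / Real.exp 1) * extSol₀ S x v u ≤
      g (extSol₀ S x v u) 1 *
        acceptProb (addDummies S) (fun e => g (extSol S x 1 e) 1) v u := by
  have hy := extSol₀_mem_Icc hp hx hS (u := u)
  have h := integral_exp_le_integral_prod (Finset.univ.erase v) (y := fun a => extSol₀ S x a u)
    (fun a _ => hy a) le_rfl
  rw [← g_mul_integral (hy v)]
  refine mul_le_mul_of_nonneg_left ?_ (g_nonneg (hy v))
  rw [sum_erase_extSol₀] at h
  simpa [acceptProb, proposalProb_eq] using h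

lemma acceptProb_le (hp : ∀ e ∈ E, 0 < p e ∧ p e ≤ 1) (hx : IsLPFeasible E p x)
    (hS : S ⊆ E) (v : A ⊕ B) (u : B) :
    acceptProb (addDummies S) (fun e => g (extSol S x 1 e) 1) v u ≤
      (1 + Real.exp (-(1 - extSol₀ S x v u))) / 2 := by
  have hy := extSol₀_mem_Icc hp hx hS (u := u)
  have h1 := integral_prod_one_sub_mul_le (Finset.univ.erase v)
    (q := fun a => g (extSol₀ S x a u) 1) fun a _ => ⟨g_nonneg (hy a), g_le_one (hy a)⟩
  have h2 := prod_one_sub_g_le_exp (Finset.univ.erase v) (y := fun a => extSol₀ S x a u)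
    fun a _ => hy a
  rw [sum_erase_extSol₀] at h2
  simp only [acceptProb, proposalProb_eq]
  linarith

lemma prod_one_sub_proposalProb_ge (hp : ∀ e ∈ E, 0 < p e ∧ p e ≤ 1) (hx : IsLPFeasible E p x)
    (hS : S ⊆ E) (v : A ⊕ B) (u : B) :
    (1 - 1 / Real.exp 1) / 2 ≤ ∏ a ∈ Finset.univ.erase v,
      (1 - proposalProb (addDummies S) (fun e => g (extSol S x 1 e) 1) a u) := by
  have hy := extSol₀_mem_Icc hp hx hS (u := u)
  have h := exp_le_prod_one_sub_g (Finset.univ.erase v) (y := fun a => extSol₀ S x a u)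
    fun a _ => hy a
  rw [sum_erase_extSol₀] at h
  simp only [proposalProb_eq]
  refine exp_neg_nine_eighths_ge.trans (le_trans (Real.exp_le_exp.2 ?_) h)
  linarith [(hy v).1]

lemma one_sub_inv_exp_mem : 0 ≤ 1 - 1 / Real.exp 1 ∧ 1 - 1 / Real.exp 1 ≤ 1 := by
  rw [← g_one]
  exact ⟨g_nonneg ⟨zero_le_one, le_rfl⟩, g_le_one ⟨zero_le_one, le_rfl⟩⟩

lemma nodup_of_mem_support_randomOrder {V : Type*} [DecidableEq V] [Fintype V] {vs : List V}
    (h : vs ∈ (randomOrder V).support) : vs.Nodup := by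
  rw [randomOrder, PMF.mem_support_map_iff] at h
  obtain ⟨π, -, rfl⟩ := h
  exact List.nodup_ofFn.2 π.injective

/-- For each fixed order fresh coins replace the queries, and the surely realized dummy edges do not
affect the average over realizations. -/
lemma expect_alg1 (hp : ∀ e ∈ E, 0 < p e ∧ p e ≤ 1) (hS : S ⊆ E)
    (hD : IsProportionalFamily S p x 1 D) (φ : RunState (A ⊕ B) B → ℝ) :
    expectRealization E p (fun R => ex (alg1 S p x 1 D R) φ) =
      avgOrder (A ⊕ B) fun vs => ex (freshTurns (extProb p) (extSol S x 1)
        (fun e => g (extSol S x 1 e) 1) D vs ⟨∅, ∅⟩) φ := by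
  simp only [alg1, ex_randomOrder_bind, avgOrder, div_eq_inv_mul]
  rw [expectRealization_const_mul, expectRealization_finsetSum]
  congr 1
  refine Finset.sum_congr rfl fun π _ => ?_
  rw [← expect_turns (E := addDummies E)
    (fun e he => ⟨(extProb_mem hp le_rfl he).1.le, (extProb_mem hp le_rfl he).2⟩)
    (fun v l hl => ⟨((hD v).1 l hl).1, fun u hu => addDummies_mono hS (((hD v).1 l hl).2 u hu)⟩)
    (List.nodup_ofFn.2 π.injective), expectRealization_addDummies]

/-- Every edge is matched with probability at least `(1 - 1 / e) x e`. -/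
lemma expect_alg1_mem_ge (hp : ∀ e ∈ E, 0 < p e ∧ p e ≤ 1) (hx : IsLPFeasible E p x) (hS : S ⊆ E)
    (hD : IsProportionalFamily S p x 1 D) {e : A × B} (he : e ∈ S) :
    (1 - 1 / Real.exp 1) * x e ≤ expectRealization E p (fun R => ex (alg1 S p x 1 D R)
      fun s => if (Sum.inl e.1, e.2) ∈ s.matching then 1 else 0) := by
  have hmem : ((Sum.inl e.1, e.2) : (A ⊕ B) × B) ∈ addDummies S := inl_mem_addDummies.2 he
  have h := proposalProb_mul_acceptProb_ge hp hx hS (Sum.inl e.1) e.2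
  rw [expect_alg1 hp hS hD, avgOrder_mem (isRunInput hp hx hS hD), proposalProb_eq]
  rwa [show extSol₀ S x (Sum.inl e.1) e.2 = x e from if_pos hmem] at h ⊢

lemma expect_alg1_mem_eq_zero (hp : ∀ e ∈ E, 0 < p e ∧ p e ≤ 1) (hx : IsLPFeasible E p x)
    (hS : S ⊆ E) (hD : IsProportionalFamily S p x 1 D) {e : A × B} (he : e ∈ S → x e = 0) :
    expectRealization E p (fun R => ex (alg1 S p x 1 D R)
      fun s => if (Sum.inl e.1, e.2) ∈ s.matching then 1 else 0) = 0 := by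
  have h0 : extSol₀ S x (Sum.inl e.1) e.2 = 0 := by
    rw [extSol₀]
    split_ifs with h
    · exact he (inl_mem_addDummies.1 h)
    · rfl
  rw [expect_alg1 hp hS hD, avgOrder_mem (isRunInput hp hx hS hD), proposalProb_eq, h0, g_zero,
    zero_mul]

/-- Every edge is still available after a run with a probability that is bounded from below in
terms of the probability that it is examined. -/
lemma expect_alg1_available_ge (hp : ∀ e ∈ E, 0 < p e ∧ p e ≤ 1) (hx : IsLPFeasible E p x)
    (hD : IsProportionalFamily E p x 1 D) {e : A × B} (he : e ∈ E) :
    (1 - 1 / Real.exp 1) ^ 2 / 4 * (1 - g (x e) 1 / p e) ≤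
      expectRealization E p (fun R => ex (alg1 E p x 1 D R)
        fun s => if s.Available (Sum.inl e.1, e.2) then 1 else 0) := by
  have hin := isRunInput hp hx le_rfl hD
  have hmem : ((Sum.inl e.1, e.2) : (A ⊕ B) × B) ∈ addDummies E := inl_mem_addDummies.2 he
  have hκ := one_sub_inv_exp_mem
  -- This κ is 1 - (1 + 1/exp 1)/2, the complement of the bound in `h1` below.
  have hmiss := ex_outcome_miss_ge hin hmem (κ := (1 - 1 / Real.exp 1) / 2)
    (ρ := fun a => 1 - acceptProb (addDummies E) (fun e => g (extSol E x 1 e) 1) (Sum.inl e.1) a)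
    (by linarith) ?_
  · rw [expect_alg1 hp le_rfl hD]
    refine le_trans ?_ (avgOrder_available hin _ _)
    have hx1 := hx.mem_Icc hp he
    have hle : g (x e) 1 / p e ≤ 1 := div_le_one_of_le₀
      ((g_le_self hx1).trans (hx.le_prob he)) (hp e he).1.le
    calc (1 - 1 / Real.exp 1) ^ 2 / 4 * (1 - g (x e) 1 / p e)
        = (1 - 1 / Real.exp 1) / 2 * ((1 - 1 / Real.exp 1) / 2 * (1 - g (x e) 1 / p e)) := by ring
      _ ≤ _ := by
        have hQ := prod_one_sub_proposalProb_ge hp hx le_rfl (Sum.inl e.1) e.2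
        refine mul_le_mul hQ hmiss (mul_nonneg (by linarith) (sub_nonneg.2 hle)) ?_
        exact le_trans (by linarith) hQ
  · intro a _ ha
    have hacc := acceptProb_le hp hx le_rfl (Sum.inl e.1) a
    have hy := extSol₀_mem_Icc hp hx le_rfl (Sum.inl e.1) a
    have hr := hin.ratio_mem ha
    rw [show extSol₀ E x (Sum.inl e.1) a = extSol E x 1 (Sum.inl e.1, a) from if_pos ha]
      at hacc hy
    have hg := g_mul_one_add_exp_le hy
    set y := extSol E x 1 (Sum.inl e.1, a) with hydef
    set acc := acceptProb (addDummies E) (fun e => g (extSol E x 1 e) 1) (Sum.inl e.1) a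
    have h1 : g y 1 / y * ((1 + Real.exp (-(1 - y))) / 2) ≤ (1 + 1 / Real.exp 1) / 2 := by
      rcases hy.1.eq_or_lt with h0 | h0
      · rw [← h0, div_zero, zero_mul]
        positivity
      · rw [div_mul_eq_mul_div, div_le_iff₀ h0]
        linarith
    have h2 := mul_le_mul_of_nonneg_left hacc hr.1
    have h3 : 1 - (1 - acc) = acc := by ring
    rw [h3]
    linarith

end Alg1

/-! ### Two runs -/

section TwoRuns

variable {A B : Type*} [Fintype A] [Fintype B] [DecidableEq A] [DecidableEq B]
  {E S : Finset (A × B)} {w p x : A × B → ℝ}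

lemma matching_of_mem_support_alg1 {D : A ⊕ B → PMF (List B)} {R : Finset (A × B)}
    (hD : IsProportionalFamily S p x 1 D) {s : RunState (A ⊕ B) B}
    (hs : s ∈ (alg1 S p x 1 D R).support) :
    IsMatching s.matching ∧ s.matching ⊆ addDummies R ∧ s.matching ⊆ addDummies S := by
  obtain ⟨vs, hvs, hs⟩ := (PMF.mem_support_bind_iff _ _ _).1 hs
  exact matching_of_mem_support_turns (fun v l hl => ((hD v).1 l hl).2)
    (nodup_of_mem_support_randomOrder hvs) hs (by simp [IsMatching]) (by simp)

lemma isLocal_alg1 {D : A ⊕ B → PMF (List B)} (hD : IsProportionalFamily S p x 1 D) :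
    IsLocal (S : Set (A × B)) fun R => alg1 S p x 1 D R := by
  intro R R' h
  simp only [alg1]
  congr 1
  funext vs
  refine isLocal_turns (G := addDummies S) (fun v l hl => ((hD v).1 l hl).2) vs _ _ _ ?_
  rintro ⟨v | v, u⟩ he
  · simpa using h (v, u) (by simpa using he.2)
  · simp

lemma isLocal_alg1_apply (D : A ⊕ B → PMF (List B)) (s : RunState (A ⊕ B) B) :
    IsLocal {e : A × B | (Sum.inl e.1, e.2) ∈ s.examined} fun R => alg1 S p x 1 D R s := by
  intro R R' h
  simp only [alg1, PMF.bind_apply]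
  refine tsum_congr fun vs => ?_
  rw [turns_apply_congr]
  rintro ⟨v | v, u⟩ he
  · simpa using h (v, u) he
  · simp

lemma available_subset (E : Finset (A × B)) (s : RunState (A ⊕ B) B) : available E s ⊆ E :=
  Finset.filter_subset _ _

lemma mem_available {s : RunState (A ⊕ B) B} {e : A × B} :
    e ∈ available E s ↔ e ∈ E ∧ s.Available (Sum.inl e.1, e.2) :=
  Finset.mem_filter

variable {D : Finset (A × B) → A ⊕ B → PMF (List B)}

/-- The edges available after the first run are independent of it. -/
lemma expect_alg1_alg1 (hD : ∀ S ⊆ E, IsProportionalFamily S p x 1 (D S))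
    (Φ : RunState (A ⊕ B) B → RunState (A ⊕ B) B → ℝ) :
    expectRealization E p (fun R => ex (alg1 E p x 1 (D E) R) fun s =>
      ex (alg1 (available E s) p x 1 (D (available E s)) R) (Φ s)) =
    expectRealization E p (fun R => ex (alg1 E p x 1 (D E) R) fun s =>
      expectRealization E p fun R' =>
        ex (alg1 (available E s) p x 1 (D (available E s)) R') (Φ s)) := by
  have := Fintype.ofFinite (RunState (A ⊕ B) B)
  simp only [ex_fintype (alg1 E _ _ _ _ _)]
  rw [expectRealization_finsetSum, expectRealization_finsetSum]
  refine Finset.sum_congr rfl fun s _ => ?_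
  -- With s fixed, its probability is a function of the examined edges and the second run one of the
  -- available edges.
  have hd : Disjoint {e : A × B | (Sum.inl e.1, e.2) ∈ s.examined}
      (available E s : Set (A × B)) :=
    Set.disjoint_left.2 fun e he he' => (mem_available.1 he').2.1 he
  rw [expectRealization_mul hd ((isLocal_alg1_apply (D E) s).comp ENNReal.toReal)
    ((isLocal_alg1 (hD _ (available_subset E s))).comp fun P => ex P (Φ s))]
  rw [expectRealization_mul_const]

/-- The probability that the edge `e` is in the output of the two runs. -/
def twoRoundsProb (E : Finset (A × B)) (p x : A × B → ℝ)
    (D : Finset (A × B) → A ⊕ B → PMF (List B)) (e : A × B) : ℝ :=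
  expectRealization E p fun R =>
    ex (twoRounds E p x D R) fun M => if (Sum.inl e.1, e.2) ∈ M then 1 else 0

lemma ex_twoRounds (R : Finset (A × B)) (φ : Finset ((A ⊕ B) × B) → ℝ) :
    ex (twoRounds E p x D R) φ = ex (alg1 E p x 1 (D E) R) fun s =>
      ex (alg1 (available E s) p x 1 (D (available E s)) R) fun t =>
        φ (s.matching ∪ t.matching) := by
  rw [twoRounds, ex_bind]
  simp only [ex_map]

/-- Being matched in the first run and being available after it exclude each other, so the two
contributions add up. -/
lemma twoRoundsProb_ge (hp : ∀ e ∈ E, 0 < p e ∧ p e ≤ 1) (hx : IsLPFeasible E p x)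
    (hD : ∀ S ⊆ E, IsProportionalFamily S p x 1 (D S)) {e : A × B} (he : e ∈ E) :
    (1 - 1 / Real.exp 1) * x e +
        (1 - 1 / Real.exp 1) ^ 3 / 4 * (1 - g (x e) 1 / p e) * x e ≤
      twoRoundsProb E p x D e := by
  have hp' : ∀ e ∈ E, 0 ≤ p e ∧ p e ≤ 1 := fun e he => ⟨(hp e he).1.le, (hp e he).2⟩
  have hκ := one_sub_inv_exp_mem
  have hx0 := hx.nonneg e he
  set I : RunState (A ⊕ B) B → ℝ := fun s => if (Sum.inl e.1, e.2) ∈ s.matching then 1 else 0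
    with hI
  set J : RunState (A ⊕ B) B → ℝ := fun s => if s.Available (Sum.inl e.1, e.2) then 1 else 0
    with hJ
  have h1 : expectRealization E p (fun R => ex (alg1 E p x 1 (D E) R) I) +
      expectRealization E p (fun R => ex (alg1 E p x 1 (D E) R) fun s =>
        ex (alg1 (available E s) p x 1 (D (available E s)) R) fun t => J s * I t) ≤
      twoRoundsProb E p x D e := by
    rw [twoRoundsProb, ← expectRealization_add]
    refine expectRealization_mono hp' fun R _ => ?_
    rw [ex_twoRounds, ← ex_add]
    refine ex_mono fun s _ => ?_
    rw [← ex_const (alg1 (available E s) p x 1 (D (available E s)) R) (I s), ← ex_add]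
    refine ex_mono fun t _ => ?_
    by_cases h2 : s.Available (Sum.inl e.1, e.2)
    · have h3 : (Sum.inl e.1, e.2) ∉ s.matching := fun h => (h2.2 _ h).1 rfl
      simp [hI, hJ, h2, h3]
    · by_cases h3 : (Sum.inl e.1, e.2) ∈ s.matching
      · simp [hI, hJ, h2, h3]
      · simp only [hI, hJ, h2, h3, if_false, zero_mul, add_zero]
        split_ifs <;> simp
  refine le_trans (add_le_add (expect_alg1_mem_ge hp hx le_rfl (hD E le_rfl) he) ?_) h1
  rw [expect_alg1_alg1 hD]
  have h4 : ∀ s, J s * ((1 - 1 / Real.exp 1) * x e) ≤ expectRealization E p fun R' =>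
      ex (alg1 (available E s) p x 1 (D (available E s)) R') fun t => J s * I t := by
    intro s
    simp only [ex_const_mul, expectRealization_const_mul]
    by_cases h2 : s.Available (Sum.inl e.1, e.2)
    · simp only [hJ, h2, if_true, one_mul]
      exact expect_alg1_mem_ge hp hx (available_subset E s) (hD _ (available_subset E s))
        (mem_available.2 ⟨he, h2⟩)
    · simp [hJ, h2]
  calc (1 - 1 / Real.exp 1) ^ 3 / 4 * (1 - g (x e) 1 / p e) * x e
      = (1 - 1 / Real.exp 1) * x e *
          ((1 - 1 / Real.exp 1) ^ 2 / 4 * (1 - g (x e) 1 / p e)) := by ring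
    _ ≤ (1 - 1 / Real.exp 1) * x e *
          expectRealization E p (fun R => ex (alg1 E p x 1 (D E) R) J) :=
        mul_le_mul_of_nonneg_left (expect_alg1_available_ge hp hx (hD E le_rfl) he)
          (mul_nonneg hκ.1 hx0)
    _ = expectRealization E p (fun R => ex (alg1 E p x 1 (D E) R) fun s =>
          J s * ((1 - 1 / Real.exp 1) * x e)) := by
        simp only [ex_mul_const, expectRealization_mul_const]
        rw [mul_comm]
    _ ≤ _ := expectRealization_mono hp' fun R _ => ex_mono fun s _ => h4 s

lemma twoRoundsProb_nonneg (hp : ∀ e ∈ E, 0 < p e ∧ p e ≤ 1) (e : A × B) :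
    0 ≤ twoRoundsProb E p x D e :=
  expectRealization_nonneg (fun e he => ⟨(hp e he).1.le, (hp e he).2⟩) fun R _ =>
    ex_nonneg fun M _ => by split_ifs <;> simp

/-- Such an edge is never proposed, as g(0) = 0. This takes care of negative weights, for which a
lower bound on the probability would be useless. -/
lemma twoRoundsProb_eq_zero (hp : ∀ e ∈ E, 0 < p e ∧ p e ≤ 1) (hx : IsLPFeasible E p x)
    (hD : ∀ S ⊆ E, IsProportionalFamily S p x 1 (D S)) {e : A × B} (he : x e = 0) :
    twoRoundsProb E p x D e = 0 := by
  have hp' : ∀ e ∈ E, 0 ≤ p e ∧ p e ≤ 1 := fun e he => ⟨(hp e he).1.le, (hp e he).2⟩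
  refine le_antisymm ?_ (twoRoundsProb_nonneg hp e)
  set I : RunState (A ⊕ B) B → ℝ := fun s => if (Sum.inl e.1, e.2) ∈ s.matching then 1 else 0
    with hI
  have h0 : ∀ S ⊆ E, expectRealization E p (fun R => ex (alg1 S p x 1 (D S) R) I) = 0 :=
    fun S hS => expect_alg1_mem_eq_zero hp hx hS (hD S hS) fun _ => he
  calc twoRoundsProb E p x D e
      ≤ expectRealization E p (fun R => ex (alg1 E p x 1 (D E) R) I +
          ex (alg1 E p x 1 (D E) R) fun s =>
            ex (alg1 (available E s) p x 1 (D (available E s)) R) I) := by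
        refine expectRealization_mono hp' fun R _ => ?_
        rw [ex_twoRounds, ← ex_add]
        refine ex_mono fun s _ => ?_
        rw [← ex_const (alg1 (available E s) p x 1 (D (available E s)) R) (I s), ← ex_add]
        refine ex_mono fun t _ => ?_
        simp only [hI, Finset.mem_union]
        by_cases h1 : (Sum.inl e.1, e.2) ∈ s.matching
        · simp only [h1, true_or, if_true]
          split_ifs <;> norm_num
        · simp [h1]
    _ = 0 := by
        rw [expectRealization_add, h0 E le_rfl, expect_alg1_alg1 hD fun _ => I]
        simp only [h0 _ (available_subset E _), ex_const, expectRealization_const, add_zero]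

/-- The output of the two runs contains a matching of realized edges. -/
lemma realEdges_of_mem_support_twoRounds (hD : ∀ S ⊆ E, IsProportionalFamily S p x 1 (D S))
    {R : Finset (A × B)} {M : Finset ((A ⊕ B) × B)} (hM : M ∈ (twoRounds E p x D R).support) :
    IsMatching (realEdges M) ∧ realEdges M ⊆ R ∧ realEdges M ⊆ E := by
  obtain ⟨s, hs, hM⟩ := (PMF.mem_support_bind_iff _ _ _).1 hM
  obtain ⟨t, ht, rfl⟩ := (PMF.mem_support_map_iff _ _ _).1 hM
  obtain ⟨hs1, hs2, hs3⟩ := matching_of_mem_support_alg1 (hD E le_rfl) hs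
  obtain ⟨ht1, ht2, ht3⟩ := matching_of_mem_support_alg1 (hD _ (available_subset E s)) ht
  have hmem : ∀ e : A × B, e ∈ realEdges (s.matching ∪ t.matching) ↔
      (Sum.inl e.1, e.2) ∈ s.matching ∨ (Sum.inl e.1, e.2) ∈ t.matching := by
    simp [realEdges]
  have hav : ∀ e : A × B, (Sum.inl e.1, e.2) ∈ t.matching → e ∈ available E s :=
    fun e he => inl_mem_addDummies.1 (ht3 he)
  refine ⟨?_, fun e he => ?_, fun e he => ?_⟩
  · intro e he f hf hne
    have hne' : ((Sum.inl e.1, e.2) : (A ⊕ B) × B) ≠ (Sum.inl f.1, f.2) := by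
      intro h
      simp only [Prod.mk.injEq, Sum.inl.injEq] at h
      exact hne (Prod.ext h.1 h.2)
    rw [hmem] at he hf
    suffices h : (Sum.inl e.1 : A ⊕ B) ≠ Sum.inl f.1 ∧ e.2 ≠ f.2 from
      ⟨fun h' => h.1 (congrArg _ h'), h.2⟩
    rcases he with he | he <;> rcases hf with hf | hf
    · exact hs1 _ he _ hf hne'
    · exact (mem_available.1 (hav f hf)).2.2 _ he
    · have h := (mem_available.1 (hav e he)).2.2 _ hf
      exact ⟨h.1.symm, h.2.symm⟩
    · exact ht1 _ he _ hf hne'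
  · rcases (hmem e).1 he with h | h
    · exact inl_mem_addDummies.1 (hs2 h)
    · exact inl_mem_addDummies.1 (ht2 h)
  · rcases (hmem e).1 he with h | h
    · exact inl_mem_addDummies.1 (hs3 h)
    · exact available_subset E s (hav e h)

lemma sum_extWeight {M : Finset ((A ⊕ B) × B)} (hM : realEdges M ⊆ E) :
    ∑ e ∈ M, extWeight w e = ∑ e ∈ E, w e * if (Sum.inl e.1, e.2) ∈ M then 1 else 0 := by
  have h1 : ∑ e ∈ realEdges M, w e =
      ∑ e ∈ E, w e * if (Sum.inl e.1, e.2) ∈ M then 1 else 0 := by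
    rw [← Finset.sum_subset hM]
    · refine Finset.sum_congr rfl fun e he => ?_
      rw [if_pos (Finset.mem_filter.1 he).2, mul_one]
    · intro e _ he
      rw [if_neg fun h => he (Finset.mem_filter.2 ⟨Finset.mem_univ _, h⟩), mul_zero]
  have hinj : Function.Injective fun e : A × B => ((Sum.inl e.1, e.2) : (A ⊕ B) × B) := by
    intro e f h
    simp only [Prod.mk.injEq, Sum.inl.injEq] at h
    exact Prod.ext h.1 h.2
  rw [← h1, ← Finset.sum_subset (s₁ := (realEdges M).image fun e => (Sum.inl e.1, e.2)),
    Finset.sum_image hinj.injOn]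
  · exact Finset.sum_congr rfl fun e _ => rfl
  · intro e he
    obtain ⟨f, hf, rfl⟩ := Finset.mem_image.1 he
    exact (Finset.mem_filter.1 hf).2
  · rintro ⟨v | v, u⟩ he hne
    · exact absurd (Finset.mem_image.2 ⟨(v, u), Finset.mem_filter.2 ⟨Finset.mem_univ _, he⟩, rfl⟩)
        hne
    · rfl

lemma twoRoundsWeight_eq (hD : ∀ S ⊆ E, IsProportionalFamily S p x 1 (D S)) :
    twoRoundsWeight E w p x D = ∑ e ∈ E, w e * twoRoundsProb E p x D e := by
  simp only [twoRoundsProb, ← expectRealization_const_mul]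
  rw [← expectRealization_finsetSum, twoRoundsWeight]
  refine expectRealization_congr fun R _ => ?_
  simp only [← ex_const_mul]
  rw [← ex_finsetSum, ← ex_fintype]
  exact ex_congr fun M hM => sum_extWeight (realEdges_of_mem_support_twoRounds hD hM).2.2

lemma twoRoundsWeight_ge (hp : ∀ e ∈ E, 0 < p e ∧ p e ≤ 1) (hx : IsLPOptimal E w p x)
    (hD : ∀ S ⊆ E, IsProportionalFamily S p x 1 (D S)) :
    ∑ e ∈ E, w e * x e * ((1 - 1 / Real.exp 1) +
      (1 - 1 / Real.exp 1) ^ 3 / 4 * (1 - g (x e) 1 / p e)) ≤ twoRoundsWeight E w p x D := by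
  rw [twoRoundsWeight_eq hD]
  refine Finset.sum_le_sum fun e he => ?_
  rcases (hx.1.nonneg e he).eq_or_lt with h0 | h0
  · rw [twoRoundsProb_eq_zero hp hx.1 hD h0.symm, ← h0]
    simp
  · have hw : 0 ≤ w e := by
      by_contra h
      exact h0.ne' (hx.eq_zero_of_neg he (not_le.1 h))
    have := mul_le_mul_of_nonneg_left (twoRoundsProb_ge hp hx.1 hD he) hw
    linarith

lemma g_div_le_one (hp : ∀ e ∈ E, 0 < p e ∧ p e ≤ 1) (hx : IsLPFeasible E p x) {e : A × B}
    (he : e ∈ E) : g (x e) 1 / p e ≤ 1 :=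
  div_le_one_of_le₀ ((g_le_self (hx.mem_Icc hp he)).trans (hx.le_prob he)) (hp e he).1.le

/-- Light edges satisfy 1 - τ ≤ 1 - g(x_e)/p_e whatever the sign of 1 - τ, and heavy edges
contribute nonnegative terms on the right. -/
lemma lpValue_sub_heavy_mul_le (hp : ∀ e ∈ E, 0 < p e ∧ p e ≤ 1) (hx : IsLPOptimal E w p x)
    (τ : ℝ) : (lpValue E w x - ∑ e ∈ heavy E p x τ, w e * x e) * (1 - τ) ≤
      ∑ e ∈ E, w e * x e * (1 - g (x e) 1 / p e) := by
  have h1 : lpValue E w x - ∑ e ∈ heavy E p x τ, w e * x e =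
      ∑ e ∈ E, if τ ≤ g (x e) 1 / p e then 0 else w e * x e := by
    rw [heavy, Finset.sum_filter, lpValue, ← Finset.sum_sub_distrib]
    refine Finset.sum_congr rfl fun e _ => ?_
    split_ifs <;> ring
  rw [h1, Finset.sum_mul]
  refine Finset.sum_le_sum fun e he => ?_
  have hwx := hx.mul_nonneg he
  split_ifs with h
  · rw [zero_mul]
    exact mul_nonneg hwx (sub_nonneg.2 (g_div_le_one hp hx.1 he))
  · exact mul_le_mul_of_nonneg_left (by linarith) hwx

end TwoRuns

end StochMatching

end

open StochMatching in
theorem lemma5 {A B : Type*} [Fintype A] [Fintype B] [DecidableEq A] [DecidableEq B]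
    (E : Finset (A × B)) (w p x : A × B → ℝ)
    (hp : ∀ e ∈ E, 0 < p e ∧ p e ≤ 1)
    (hx : IsLPOptimal E w p x)
    (hopt : 0 < opt E w p) :
    (∀ S ⊆ E, ∃ d : A ⊕ B → PMF (List B), IsProportionalFamily S p x 1 d) ∧
    ∀ D : Finset (A × B) → A ⊕ B → PMF (List B),
      (∀ S ⊆ E, IsProportionalFamily S p x 1 (D S)) →
      (∀ R ⊆ E, ∀ M ∈ (twoRounds E p x D R).support,
        IsMatching (realEdges M) ∧ realEdges M ⊆ R) ∧
      ∀ τ : ℝ,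
        twoRoundsWeight E w p x D / opt E w p ≥
          (1 - 1 / Real.exp 1) +
            (1 - 1 / Real.exp 1) ^ 3 / 4 *
              (1 - (∑ e ∈ heavy E p x τ, w e * x e) / lpValue E w x) * (1 - τ) := by
  refine ⟨fun S hS => exists_isProportionalFamily hp hx.1 hS, fun D hD => ⟨fun R _ M hM => ?_,
    fun τ => ?_⟩⟩
  · have h := realEdges_of_mem_support_twoRounds hD hM
    exact ⟨h.1, h.2.1⟩
  · have hLP := opt_le_lpValue hp hx
    have hLP0 := hopt.trans_le hLP
    have hκ := one_sub_inv_exp_mem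
    have hge := twoRoundsWeight_ge hp hx hD
    have hheavy := mul_le_mul_of_nonneg_left (lpValue_sub_heavy_mul_le hp hx τ)
      (by have := hκ.1; positivity : 0 ≤ (1 - 1 / Real.exp 1) ^ 3 / 4)
    have hsplit : ∑ e ∈ E, w e * x e * ((1 - 1 / Real.exp 1) +
        (1 - 1 / Real.exp 1) ^ 3 / 4 * (1 - g (x e) 1 / p e)) =
        (1 - 1 / Real.exp 1) * lpValue E w x + (1 - 1 / Real.exp 1) ^ 3 / 4 *
          ∑ e ∈ E, w e * x e * (1 - g (x e) 1 / p e) := by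
      rw [lpValue, Finset.mul_sum, Finset.mul_sum, ← Finset.sum_add_distrib]
      exact Finset.sum_congr rfl fun e _ => by ring
    set c := (1 - 1 / Real.exp 1) + (1 - 1 / Real.exp 1) ^ 3 / 4 *
      (1 - (∑ e ∈ heavy E p x τ, w e * x e) / lpValue E w x) * (1 - τ) with hc
    have hcLP : c * lpValue E w x ≤ twoRoundsWeight E w p x D := by
      refine le_trans (le_of_eq ?_) (le_trans (add_le_add_right hheavy _) (hsplit ▸ hge))
      rw [hc]
      field_simp
    have hw0 : 0 ≤ twoRoundsWeight E w p x D := by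
      refine le_trans (Finset.sum_nonneg fun e he => ?_) hge
      have := sub_nonneg.2 (g_div_le_one hp hx.1 he)
      have := hκ.1
      have := hx.mul_nonneg he
      positivity
    rw [ge_iff_le, le_div_iff₀ hopt]
    -- For large τ the bound c can be negative; then OPT ≤ OPT_LP points the wrong way, and
    -- nonnegativity of the expected weight suffices.
    rcases le_total 0 c with h | h
    · exact (mul_le_mul_of_nonneg_left hLP h).trans hcLP
    · exact (mul_nonpos_of_nonpos_of_nonneg h hopt.le).trans hw0
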